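/- Let $V$ be a finite-dimensional real vector space with dual $V^*$. Manifolds are smooth, Hausdorff, second countable, finite-dimensional and without boundary. For a manifold $M$ let $\Omega^q(M)$ be the space of smooth differential $q$-forms on $M$, and let $(\Omega^1\otimes V)(M)=\Omega^1(M)\otimes V=\Omega^1(M;V)$ be the space of $V$-valued $1$-forms on $M$; both are presheaves of sets on the category of smooth manifolds and smooth maps, via pullback of forms. A natural $q$-form on $\Omega^1\otimes V$ is a natural transformation of set-valued presheaves $\tau\colon\Omega^1\otimes V\to\Omega^q$, i.e. a family of maps of sets $\tau_M\colon\Omega^1(M;V)\to\Omega^q(M)$ (not assumed linear or continuous) with $\tau_M(f^*\alpha)=f^*\tau_N(\alpha)$ for every smooth map $f\colon M\to N$ and every $\alpha\in\Omega^1(N;V)$. Let $\Omega^q(\Omega^1\otimes V)$ be the vector space of natural $q$-forms; with $(d\tau)_M(\alpha)=d(\tau_M(\alpha))$ and $(\sigma\wedge\tau)_M(\alpha)=\sigma_M(\alpha)\wedge\tau_M(\alpha)$, the graded vector space $\Omega^\bullet(\Omega^1\otimes V)=\bigoplus_{q\ge0}\Omega^q(\Omega^1\otimes V)$ is a differential graded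 algebra. Let $\mathrm{Kos}^\bullet V^*=\bigwedge^\bullet V^*\otimes\mathrm{Sym}^\bullet V^*$ be the Koszul differential graded algebra: it is graded by giving $\ell\in V^*=\bigwedge^1V^*$ degree $1$ and the corresponding element $\tilde\ell\in V^*=\mathrm{Sym}^1V^*$ degree $2$, and its differential $d_K$ is the graded derivation with $d_K\ell=\tilde\ell$ and $d_K\tilde\ell=0$. Theorem. There is a unique homomorphism of differential graded algebras (degree-preserving, unital, multiplicative and commuting with the differentials) $$\eta\colon(\mathrm{Kos}^\bullet V^*,d_K)\longrightarrow(\Omega^\bullet(\Omega^1\otimes V),d)$$ such that for every $\ell\in V^*$ and every manifold $M$ $$\eta(\ell)_M\Big(\sum_i\alpha_i\otimes v_i\Big)=\sum_i\langle v_i,\ell\rangle\,\alpha_i\qquad(\alpha_i\in\Omega^1(M),\ v_i\in V),$$ and $\eta$ is an isomorphism. -/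

import Mathlib

open scoped Manifold ContDiff Bundle Topology TensorProduct DirectSum

set_option linter.unusedSectionVars false

namespace NatDeRham

section
variable (W : Type*) [AddCommGroup W] [Module ℝ W]

/-- The Koszul algebra `⋀ W ⊗ Sym W`. As `Sym W` sits in even degrees, the graded tensor product of
algebras is the plain one. -/
abbrev Koszul := ExteriorAlgebra ℝ W ⊗[ℝ] SymmetricAlgebra ℝ W

namespace Koszul
variable {W}
/-- The generator `w ∈ ⋀¹ W`, of degree one. -/
noncomputable def gen : W →ₗ[ℝ] Koszul W :=
  (TensorProduct.mk ℝ _ _).flip 1 ∘ₗ ExteriorAlgebra.ι ℝ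

/-- The generator `w̃ ∈ Sym¹ W`, of degree two. -/
noncomputable def tilde : W →ₗ[ℝ] Koszul W :=
  TensorProduct.mk ℝ _ _ 1 ∘ₗ SymmetricAlgebra.ι ℝ W

variable (W) in
/-- The subspace `⋀ᵖ W ⊗ Symʳ W`. -/
noncomputable def bigrade (p r : ℕ) : Submodule ℝ (Koszul W) :=
  Submodule.map₂ (TensorProduct.mk ℝ _ _) (⋀[ℝ]^p W)
    (LinearMap.range (SymmetricAlgebra.ι ℝ W) ^ r)

variable (W) in
/-- The homogeneous part of degree `n`: the sum of the `⋀ᵖ W ⊗ Symʳ W` with `p + 2 r = n`. -/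
noncomputable def grade (n : ℕ) : Submodule ℝ (Koszul W) :=
  ⨆ (p : ℕ) (r : ℕ) (_ : p + 2 * r = n), bigrade W p r

/-- Contraction of the exterior algebra with a linear form (an antiderivation). -/
noncomputable def contract (c : Module.Dual ℝ W) : ExteriorAlgebra ℝ W →ₗ[ℝ] ExteriorAlgebra ℝ W :=
  CliffordAlgebra.contractLeft (Q := (0 : QuadraticForm ℝ W)) c

theorem contract_ι (c : Module.Dual ℝ W) (w : W) :
    contract c (ExteriorAlgebra.ι ℝ w) = algebraMap ℝ _ (c w) :=
  CliffordAlgebra.contractLeft_ι (Q := (0 : QuadraticForm ℝ W)) (d := c) w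

theorem contract_algebraMap (c : Module.Dual ℝ W) (r : ℝ) :
    contract c (algebraMap ℝ _ r) = 0 :=
  CliffordAlgebra.contractLeft_algebraMap (Q := (0 : QuadraticForm ℝ W)) (d := c) r

theorem contract_mul (c : Module.Dual ℝ W) {p : ℕ} {a : ExteriorAlgebra ℝ W}
    (ha : a ∈ ⋀[ℝ]^p W) (b : ExteriorAlgebra ℝ W) :
    contract c (a * b) = contract c a * b + (-1 : ℝ) ^ p • (a * contract c b) := by
  induction ha using Submodule.pow_induction_on_left' with
  | algebraMap r =>
    rw [contract_algebraMap, ← Algebra.smul_def, ← Algebra.smul_def, map_smul]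
    simp
  | add x y i hx hy ihx ihy =>
    rw [add_mul, map_add, map_add, ihx, ihy, add_mul, add_mul, smul_add]; abel
  | mem_mul m hm i x hx ih =>
    obtain ⟨w, rfl⟩ := hm
    have h1 : ∀ z, contract c (ExteriorAlgebra.ι ℝ w * z) =
        c w • z - ExteriorAlgebra.ι ℝ w * contract c z := fun z =>
      CliffordAlgebra.contractLeft_ι_mul (Q := (0 : QuadraticForm ℝ W)) c w z
    rw [mul_assoc, h1, h1, ih, sub_mul, mul_add, smul_mul_assoc, mul_assoc, pow_succ]
    simp only [mul_smul_comm, mul_neg, mul_one, neg_smul, mul_assoc]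
    abel

variable [FiniteDimensional ℝ W]

variable (W) in
/-- The Koszul differential: the antiderivation (`d_mul`) with `d w = w̃` (`d_gen`) and `d w̃ = 0`
(`d_tilde`), written in a basis `bᵢ` with dual basis `bᵢ*` as `∑ i, ι(bᵢ*) ⊗ (b̃ᵢ · )`. -/
noncomputable def d : Koszul W →ₗ[ℝ] Koszul W :=
  ∑ i, TensorProduct.map (contract ((Module.finBasis ℝ W).coord i))
    (LinearMap.mulLeft ℝ (SymmetricAlgebra.ι ℝ W (Module.finBasis ℝ W i)))

theorem d_tmul (a : ExteriorAlgebra ℝ W) (s : SymmetricAlgebra ℝ W) :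
    d W (a ⊗ₜ s) = ∑ i, contract ((Module.finBasis ℝ W).coord i) a ⊗ₜ[ℝ]
      (SymmetricAlgebra.ι ℝ W (Module.finBasis ℝ W i) * s) := by
  simp [d]

theorem d_gen (w : W) : d W (gen w) = tilde w := by
  have h2 : d W (gen w) = ∑ i, (Module.finBasis ℝ W).repr w i • tilde (Module.finBasis ℝ W i) := by
    change d W (ExteriorAlgebra.ι ℝ w ⊗ₜ 1) = _
    rw [d_tmul]
    refine Finset.sum_congr rfl fun i _ => ?_
    rw [contract_ι, Algebra.algebraMap_eq_smul_one, ← TensorProduct.smul_tmul', mul_one]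
    rfl
  rw [h2]
  simp_rw [← map_smul]
  rw [← map_sum, Module.Basis.sum_repr]

theorem d_tilde (w : W) : d W (tilde w) = 0 := by
  change d W (1 ⊗ₜ SymmetricAlgebra.ι ℝ W w) = 0
  rw [d_tmul]
  refine Finset.sum_eq_zero fun i _ => ?_
  rw [← map_one (algebraMap ℝ (ExteriorAlgebra ℝ W)), contract_algebraMap, TensorProduct.zero_tmul]

theorem d_mul {p r : ℕ} {x : Koszul W} (hx : x ∈ bigrade W p r) (y : Koszul W) :
    d W (x * y) = d W x * y + (-1 : ℝ) ^ p • (x * d W y) := by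
  have key : bigrade W p r ≤ LinearMap.eqLocus (d W ∘ₗ LinearMap.mulRight ℝ y)
      (LinearMap.mulRight ℝ y ∘ₗ d W + (-1 : ℝ) ^ p • LinearMap.mulRight ℝ (d W y)) := by
    refine Submodule.map₂_le.2 fun a ha s _ => ?_
    change d W (a ⊗ₜ s * y) = d W (a ⊗ₜ s) * y + (-1 : ℝ) ^ p • (a ⊗ₜ s * d W y)
    induction y using TensorProduct.induction_on with
    | zero => simp
    | add y z hy hz => rw [mul_add, map_add, hy, hz, map_add, mul_add, mul_add, smul_add]; abel
    | tmul b t =>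
      rw [Algebra.TensorProduct.tmul_mul_tmul, d_tmul, d_tmul, d_tmul, Finset.sum_mul,
        Finset.mul_sum, Finset.smul_sum, ← Finset.sum_add_distrib]
      refine Finset.sum_congr rfl fun i _ => ?_
      rw [contract_mul _ ha, Algebra.TensorProduct.tmul_mul_tmul,
        Algebra.TensorProduct.tmul_mul_tmul, TensorProduct.add_tmul, TensorProduct.smul_tmul',
        mul_assoc, mul_left_comm s]
  exact key hx

end Koszul
end

section
variable {E X : Type*} [NormedAddCommGroup E] [NormedSpace ℝ E]
  [NormedAddCommGroup X] [NormedSpace ℝ X]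

theorem contDiffAt_toCMM {q : ℕ} {n : WithTop ℕ∞} {w : X → E [⋀^Fin q]→L[ℝ] ℝ} {x : X}
    (h : ContDiffAt ℝ n w x) :
    ContDiffAt ℝ n (fun y => (w y).toContinuousMultilinearMap) x := by
  let L : (E [⋀^Fin q]→L[ℝ] ℝ) →L[ℝ] ContinuousMultilinearMap ℝ (fun _ : Fin q => E) ℝ :=
    ContinuousAlternatingMap.toContinuousMultilinearMapCLM ℝ
  exact L.contDiff.contDiffAt.comp x h
end

section
variable {E F X : Type*} [NormedAddCommGroup E] [NormedSpace ℝ E] [FiniteDimensional ℝ E]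
  [NormedAddCommGroup F] [NormedSpace ℝ F] [NormedAddCommGroup X] [NormedSpace ℝ X]

theorem finiteDimensional_cmm (q : ℕ) :
    FiniteDimensional ℝ (ContinuousMultilinearMap ℝ (fun _ : Fin q => E) ℝ) :=
  FiniteDimensional.of_injective
    (ContinuousMultilinearMap.toMultilinearMapLinear :
      ContinuousMultilinearMap ℝ (fun _ : Fin q => E) ℝ →ₗ[ℝ] _)
    ContinuousMultilinearMap.toMultilinearMap_injective

theorem contDiffAt_alt_iff {q : ℕ} {n : WithTop ℕ∞} {w : X → E [⋀^Fin q]→L[ℝ] ℝ} {x : X} :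
    ContDiffAt ℝ n w x ↔ ContDiffAt ℝ n (fun y => (w y).toContinuousMultilinearMap) x := by
  have := finiteDimensional_cmm (E := E) q
  let L : (E [⋀^Fin q]→L[ℝ] ℝ) →L[ℝ] ContinuousMultilinearMap ℝ (fun _ : Fin q => E) ℝ :=
    ContinuousAlternatingMap.toContinuousMultilinearMapCLM ℝ
  have hL : Function.Injective L :=
    ContinuousAlternatingMap.toContinuousMultilinearMap_injective
  obtain ⟨R, hR⟩ := L.toLinearMap.exists_leftInverse_of_injective (LinearMap.ker_eq_bot.2 hL)
  refine ⟨fun h => L.contDiff.contDiffAt.comp x h, fun h => ?_⟩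
  have := (LinearMap.toContinuousLinearMap R).contDiff (n := n) |>.contDiffAt.comp x h
  convert this using 1
  funext y
  exact (congrArg (fun T => T (w y)) hR).symm

theorem contDiffAt_alt_comp {q : ℕ} {n : WithTop ℕ∞} {w : X → F [⋀^Fin q]→L[ℝ] ℝ}
    {A : X → E →L[ℝ] F} {x : X} (hw : ContDiffAt ℝ n w x) (hA : ContDiffAt ℝ n A x) :
    ContDiffAt ℝ n (fun y => (w y).compContinuousLinearMap (A y)) x := by
  rw [contDiffAt_alt_iff]
  have h1 : ContDiffAt ℝ n (fun y => (w y).toContinuousMultilinearMap) x :=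
    contDiffAt_toCMM hw
  have h2 : ContDiffAt ℝ n (fun y =>
      ContinuousMultilinearMap.compContinuousLinearMapContinuousMultilinear ℝ
        (fun _ : Fin q => E) (fun _ : Fin q => F) ℝ (fun _ => A y)) x :=
    (ContinuousMultilinearMap.contDiff _).contDiffAt.comp x (contDiffAt_pi.2 fun _ => hA)
  exact h2.clm_apply h1
end

section
variable {E M : Type*} [NormedAddCommGroup E] [NormedSpace ℝ E]
  [TopologicalSpace M] [ChartedSpace E M]
  {E' N : Type*} [NormedAddCommGroup E'] [NormedSpace ℝ E']
  [TopologicalSpace N] [ChartedSpace E' N]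
  {E'' P : Type*} [NormedAddCommGroup E''] [NormedSpace ℝ E'']
  [TopologicalSpace P] [ChartedSpace E'' P]

variable (E M) in
/-- A differential `q`-form on `M` without any smoothness: a choice of an alternating `q`-linear form
on each tangent space. -/
abbrev RawForm (q : ℕ) := ∀ x : M, TangentSpace 𝓘(ℝ, E) x [⋀^Fin q]→L[ℝ] ℝ

variable (E M) in
/-- Smooth differential `q`-forms on `M`: smooth sections of the bundle of alternating `q`-linear
forms on the tangent spaces. -/
abbrev DF (q : ℕ) [IsManifold 𝓘(ℝ, E) ∞ M] := Cₛ^∞⟮𝓘(ℝ, E); E [⋀^Fin q]→L[ℝ] ℝ,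
  fun x : M => TangentSpace 𝓘(ℝ, E) x [⋀^Fin q]→L[ℝ] Bundle.Trivial M ℝ x⟯

section
variable {T S : Type*} [AddCommGroup T] [Module ℝ T] [TopologicalSpace T]
  [AddCommGroup S] [Module ℝ S] [TopologicalSpace S]

/-- The multilinear form `(v, w) ↦ a(v) b(w)`. -/
noncomputable def altMul {p q : ℕ} (a : T [⋀^Fin p]→L[ℝ] ℝ) (b : T [⋀^Fin q]→L[ℝ] ℝ) :
    ContinuousMultilinearMap ℝ (fun _ : Fin (p + q) => T) ℝ where
  toMultilinearMap := (LinearMap.mul' ℝ ℝ).compMultilinearMap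
    ((MultilinearMap.domCoprod a.toMultilinearMap b.toMultilinearMap).domDomCongr finSumFinEquiv)
  cont := by
    have : Continuous fun v : Fin (p + q) → T =>
      a (fun i => v (Fin.castAdd q i)) * b (fun j => v (Fin.natAdd p j)) :=
      (a.cont.comp (by fun_prop)).mul (b.cont.comp (by fun_prop))
    convert this using 2
    simp [MultilinearMap.domCoprod_apply]

theorem altMul_apply {p q : ℕ} (a : T [⋀^Fin p]→L[ℝ] ℝ) (b : T [⋀^Fin q]→L[ℝ] ℝ)
    (v : Fin (p + q) → T) :
    altMul a b v = a (fun i => v (Fin.castAdd q i)) * b (fun j => v (Fin.natAdd p j)) := by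
  have h : altMul a b v = (LinearMap.mul' ℝ ℝ).compMultilinearMap
    ((MultilinearMap.domCoprod a.toMultilinearMap b.toMultilinearMap).domDomCongr
      finSumFinEquiv) v := rfl
  rw [h]
  simp [MultilinearMap.domCoprod_apply]

/-- The wedge product of alternating forms, in the normalisation
`(a ∧ b)(v₁, …, v_{p+q}) = (1 / (p! q!)) ∑ σ, sign σ · a(v_σ(1), …, v_σ(p)) b(v_σ(p+1), …)`. -/
noncomputable def altWedge {p q : ℕ} (a : T [⋀^Fin p]→L[ℝ] ℝ) (b : T [⋀^Fin q]→L[ℝ] ℝ) :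
    T [⋀^Fin (p + q)]→L[ℝ] ℝ :=
  ((p.factorial * q.factorial : ℝ)⁻¹) • (altMul a b).alternatization

theorem altWedge_apply {p q : ℕ} (a : T [⋀^Fin p]→L[ℝ] ℝ) (b : T [⋀^Fin q]→L[ℝ] ℝ)
    (v : Fin (p + q) → T) :
    altWedge a b v = ((p.factorial * q.factorial : ℝ)⁻¹) *
      ∑ σ : Equiv.Perm (Fin (p + q)), ((Equiv.Perm.sign σ : ℤ) : ℝ) *
        (a (fun i => v (σ (Fin.castAdd q i))) * b (fun j => v (σ (Fin.natAdd p j)))) := by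
  simp only [altWedge, ContinuousAlternatingMap.smul_apply,
    ContinuousMultilinearMap.alternatization_apply_apply, altMul_apply, smul_eq_mul]
  simp [Units.smul_def]

theorem altWedge_comp {p q : ℕ} (a : T [⋀^Fin p]→L[ℝ] ℝ) (b : T [⋀^Fin q]→L[ℝ] ℝ) (A : S →L[ℝ] T) :
    (altWedge a b).compContinuousLinearMap A =
      altWedge (a.compContinuousLinearMap A) (b.compContinuousLinearMap A) := by
  ext v
  simp only [ContinuousAlternatingMap.compContinuousLinearMap_apply, altWedge_apply]
  rfl

/-- The wedge product as a bilinear map. -/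
noncomputable def altWedgeₗ (p q : ℕ) :
    (T [⋀^Fin p]→L[ℝ] ℝ) →ₗ[ℝ] (T [⋀^Fin q]→L[ℝ] ℝ) →ₗ[ℝ] (T [⋀^Fin (p + q)]→L[ℝ] ℝ) :=
  LinearMap.mk₂ ℝ altWedge
    (fun a a' b => by
      ext v
      simp only [ContinuousAlternatingMap.add_apply, altWedge_apply, add_mul, mul_add,
        Finset.sum_add_distrib])
    (fun c a b => by
      ext v
      simp only [ContinuousAlternatingMap.smul_apply, altWedge_apply, smul_eq_mul, Finset.mul_sum]
      exact Finset.sum_congr rfl fun _ _ => by ring)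
    (fun a b b' => by
      ext v
      simp only [ContinuousAlternatingMap.add_apply, altWedge_apply, mul_add,
        Finset.sum_add_distrib])
    (fun c a b => by
      ext v
      simp only [ContinuousAlternatingMap.smul_apply, altWedge_apply, smul_eq_mul, Finset.mul_sum]
      exact Finset.sum_congr rfl fun _ _ => by ring)
end

theorem contDiffAt_altWedge {X : Type*} [NormedAddCommGroup X] [NormedSpace ℝ X]
    [FiniteDimensional ℝ E] {p q : ℕ} {n : WithTop ℕ∞} {a : X → E [⋀^Fin p]→L[ℝ] ℝ}
    {b : X → E [⋀^Fin q]→L[ℝ] ℝ} {x : X} (ha : ContDiffAt ℝ n a x) (hb : ContDiffAt ℝ n b x) :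
    ContDiffAt ℝ n (fun y => altWedge (a y) (b y)) x := by
  have hfin : ∀ r : ℕ, FiniteDimensional ℝ (E [⋀^Fin r]→L[ℝ] ℝ) := fun r => by
    have := finiteDimensional_cmm (E := E) r
    exact FiniteDimensional.of_injective
      (ContinuousAlternatingMap.toContinuousMultilinearMapCLM ℝ :
        (E [⋀^Fin r]→L[ℝ] ℝ) →L[ℝ] ContinuousMultilinearMap ℝ (fun _ : Fin r => E) ℝ).toLinearMap
      ContinuousAlternatingMap.toContinuousMultilinearMap_injective
  have := hfin p
  have := hfin q
  let B := LinearMap.toContinuousBilinearMap (altWedgeₗ (T := E) p q)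
  exact (B.contDiff.contDiffAt.comp x ha).clm_apply hb

/-- Pullback of forms along a map, through its differential. -/
noncomputable def rawPull {q : ℕ} (f : M → N) (w : RawForm E' N q) : RawForm E M q :=
  fun x => (w (f x)).compContinuousLinearMap (mfderiv 𝓘(ℝ, E) 𝓘(ℝ, E') f x)

/-- Smoothness of a form at a point, as a section of the bundle of alternating forms. -/
def SmoothAt {q : ℕ} [IsManifold 𝓘(ℝ, E) ∞ M] (w : RawForm E M q) (x : M) : Prop :=
  ContMDiffAt 𝓘(ℝ, E) (𝓘(ℝ, E).prod 𝓘(ℝ, E [⋀^Fin q]→L[ℝ] ℝ)) ∞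
    (fun y => Bundle.TotalSpace.mk' (E [⋀^Fin q]→L[ℝ] ℝ)
      (E := fun x : M => TangentSpace 𝓘(ℝ, E) x [⋀^Fin q]→L[ℝ] Bundle.Trivial M ℝ x) y (w y)) x

/-- The expression of a form in the preferred chart around `x`. -/
noncomputable def rep {q : ℕ} (w : RawForm E M q) (x : M) : E → E [⋀^Fin q]→L[ℝ] ℝ :=
  fun y => rawPull (extChartAt 𝓘(ℝ, E) x).symm w y

/-- The exterior derivative: at `x`, the exterior derivative of the expression of the form in the
preferred chart around `x`. By `rawD_rawPull` and `rep_rawD` it is natural, and it may be computed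
in any chart. -/
noncomputable def rawD {q : ℕ} (w : RawForm E M q) : RawForm E M (q + 1) :=
  fun x => (extDeriv (rep w x) (extChartAt 𝓘(ℝ, E) x x)).compContinuousLinearMap
      (mfderiv 𝓘(ℝ, E) 𝓘(ℝ, E) (extChartAt 𝓘(ℝ, E) x) x)

theorem rawPull_comp {q : ℕ} (g : N → P) (f : M → N) (w : RawForm E'' P q) {x : M}
    (hg : MDifferentiableAt 𝓘(ℝ, E') 𝓘(ℝ, E'') g (f x))
    (hf : MDifferentiableAt 𝓘(ℝ, E) 𝓘(ℝ, E') f x) :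
    rawPull (E := E) (g ∘ f) w x = rawPull f (rawPull (E := E') g w) x := by
  simp only [rawPull]
  rw [mfderiv_comp x hg hf]
  rfl

theorem rawPull_congr {q : ℕ} {f g : M → N} (w : RawForm E' N q) {x : M} (h : f =ᶠ[𝓝 x] g) :
    rawPull (E := E) f w x = rawPull g w x := by
  have h1 := h.mfderiv_eq (I := 𝓘(ℝ, E)) (I' := 𝓘(ℝ, E'))
  have h2 := h.eq_of_nhds
  have key : ∀ (p p' : N) (A A' : E →L[ℝ] E'), p = p' → A = A' →
      (ContinuousAlternatingMap.compContinuousLinearMap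
        (show E' [⋀^Fin q]→L[ℝ] ℝ from w p) A : E [⋀^Fin q]→L[ℝ] ℝ) =
      ContinuousAlternatingMap.compContinuousLinearMap
        (show E' [⋀^Fin q]→L[ℝ] ℝ from w p') A' := by
    rintro p _ A _ rfl rfl; rfl
  exact key _ _ _ _ h2 h1

theorem rawPull_id {q : ℕ} (w : RawForm E M q) : rawPull id w = w := by
  funext x
  simp only [rawPull, mfderiv_id]
  rfl

theorem contMDiffAt_chart_symm [IsManifold 𝓘(ℝ, E) ∞ M] {x : M} {y : E} (hy : y ∈ (extChartAt 𝓘(ℝ, E) x).target) :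
    ContMDiffAt 𝓘(ℝ, E) 𝓘(ℝ, E) ∞ (extChartAt 𝓘(ℝ, E) x).symm y :=
  (contMDiffOn_extChartAt_symm x).contMDiffAt
    ((isOpen_extChartAt_target (I := 𝓘(ℝ, E)) x).mem_nhds hy)

theorem contDiffAt_written {f : M → N} {x : M} (hf : ContMDiffAt 𝓘(ℝ, E) 𝓘(ℝ, E') ∞ f x) :
    ContDiffAt ℝ ∞ (writtenInExtChartAt 𝓘(ℝ, E) 𝓘(ℝ, E') x f) (extChartAt 𝓘(ℝ, E) x x) := by
  have := (contMDiffAt_iff.1 hf).2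
  simpa [writtenInExtChartAt, contDiffWithinAt_univ] using this

variable [IsManifold 𝓘(ℝ, E) ∞ M] [IsManifold 𝓘(ℝ, E') ∞ N]

theorem smoothAt_iff {q : ℕ} (w : RawForm E M q) (x : M) :
    SmoothAt w x ↔ ContDiffAt ℝ ∞ (rep w x) (extChartAt 𝓘(ℝ, E) x x) := by
  unfold SmoothAt
  rw [Bundle.contMDiffAt_section]
  have h1 : (fun y => (trivializationAt (E [⋀^Fin q]→L[ℝ] ℝ)
      (fun x : M => TangentSpace 𝓘(ℝ, E) x [⋀^Fin q]→L[ℝ] Bundle.Trivial M ℝ x) x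
        ⟨y, w y⟩).2) =ᶠ[𝓝 x] fun y => rep w x (extChartAt 𝓘(ℝ, E) x y) := by
    filter_upwards [(chartAt E x).open_source.mem_nhds (mem_chart_source E x)] with y hy
    have hy' : y ∈ (extChartAt 𝓘(ℝ, E) x).source := by simpa using hy
    have hb : (extChartAt 𝓘(ℝ, E) x).symm (extChartAt 𝓘(ℝ, E) x y) = y :=
      (extChartAt 𝓘(ℝ, E) x).left_inv hy'
    rw [FiberBundle.trivializationAt_continuousAlternatingMap_apply]
    simp only [ContinuousAlternatingMap.inCoordinates]
    rw [TangentBundle.symmL_trivializationAt hy]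
    simp only [modelWithCornersSelf_coe, Set.range_id, mfderivWithin_univ, rep, rawPull]
    ext v
    have key : ∀ (p p' : M), p = p' → ∀ v : Fin q → E,
        (show E [⋀^Fin q]→L[ℝ] ℝ from w p) v = (show E [⋀^Fin q]→L[ℝ] ℝ from w p') v := by
      rintro p _ rfl v; rfl
    refine Eq.trans ?_ (key _ _ hb.symm _)
    simp
    rfl
  rw [h1.contMDiffAt_iff, ← contMDiffAt_iff_contDiffAt]
  constructor
  · intro h
    have h2 : ContMDiffAt 𝓘(ℝ, E) 𝓘(ℝ, E) ∞ (extChartAt 𝓘(ℝ, E) x).symm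
        (extChartAt 𝓘(ℝ, E) x x) :=
      (contMDiffOn_extChartAt_symm x).contMDiffAt (extChartAt_target_mem_nhds x)
    have h3 := ContMDiffAt.comp_of_eq h h2 (by simp)
    refine h3.congr_of_eventuallyEq ?_
    filter_upwards [extChartAt_target_mem_nhds (I := 𝓘(ℝ, E)) x] with y hy
    exact (congrArg (rep w x) ((extChartAt 𝓘(ℝ, E) x).right_inv hy)).symm
  · intro h
    exact ContMDiffAt.comp x h contMDiffAt_extChartAt


theorem rep_rawPull {q : ℕ} (w : RawForm E' N q) {f : M → N} {x : M}
    (hf : ContMDiffAt 𝓘(ℝ, E) 𝓘(ℝ, E') ∞ f x) :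
    rep (rawPull f w) x =ᶠ[𝓝 (extChartAt 𝓘(ℝ, E) x x)]
      fun y => (rep w (f x) (writtenInExtChartAt 𝓘(ℝ, E) 𝓘(ℝ, E') x f y)).compContinuousLinearMap
        (fderiv ℝ (writtenInExtChartAt 𝓘(ℝ, E) 𝓘(ℝ, E') x f) y) := by
  set φ := extChartAt 𝓘(ℝ, E) x with hφ
  set ψ := extChartAt 𝓘(ℝ, E') (f x) with hψ
  have hcont : Filter.Tendsto φ.symm (𝓝 (φ x)) (𝓝 x) := by
    have := (contMDiffAt_chart_symm (mem_extChartAt_target (I := 𝓘(ℝ, E)) x)).continuousAt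
    rw [ContinuousAt, extChartAt_to_inv] at this
    exact this
  have e1 : ∀ᶠ z in 𝓝 x, ContMDiffAt 𝓘(ℝ, E) 𝓘(ℝ, E') 1 f z :=
    contMDiffAt_iff_contMDiffAt_nhds (n := 1) (by simp) |>.1 (hf.of_le (by norm_cast))
  have e2 : ∀ᶠ z in 𝓝 x, f z ∈ ψ.source :=
    hf.continuousAt.eventually (extChartAt_source_mem_nhds (I := 𝓘(ℝ, E')) (f x))
  filter_upwards [extChartAt_target_mem_nhds (I := 𝓘(ℝ, E)) x, hcont.eventually e1,
    hcont.eventually e2.eventually_nhds] with y hy h1 h2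
  have hs : MDifferentiableAt 𝓘(ℝ, E) 𝓘(ℝ, E) φ.symm y :=
    (contMDiffAt_chart_symm hy).mdifferentiableAt (by simp)
  have hfm : MDifferentiableAt 𝓘(ℝ, E) 𝓘(ℝ, E') f (φ.symm y) := h1.mdifferentiableAt (by simp)
  have h2' := h2.self_of_nhds
  have hψm : MDifferentiableAt 𝓘(ℝ, E') 𝓘(ℝ, E') ψ (f (φ.symm y)) :=
    mdifferentiableAt_extChartAt (by simpa [hψ] using h2')
  have hg : MDifferentiableAt 𝓘(ℝ, E) 𝓘(ℝ, E') (ψ ∘ f ∘ φ.symm) y :=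
    hψm.comp y (hfm.comp y hs)
  have hψs : MDifferentiableAt 𝓘(ℝ, E') 𝓘(ℝ, E') ψ.symm ((ψ ∘ f ∘ φ.symm) y) :=
    (contMDiffAt_chart_symm (ψ.map_source h2')).mdifferentiableAt (by simp)
  have heq : f ∘ φ.symm =ᶠ[𝓝 y] ψ.symm ∘ (ψ ∘ f ∘ φ.symm) := by
    filter_upwards [hs.continuousAt.eventually h2] with z hz
    exact (ψ.left_inv hz).symm
  have c1 : rep (rawPull f w) x y = rawPull (f ∘ φ.symm) w y := (rawPull_comp f φ.symm w hfm hs).symm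
  have c2 : rawPull (E := E) (f ∘ φ.symm) w y = rawPull (ψ.symm ∘ (ψ ∘ f ∘ φ.symm)) w y :=
    rawPull_congr w heq
  have c3 : rawPull (E := E) (ψ.symm ∘ (ψ ∘ f ∘ φ.symm)) w y =
      rawPull (ψ ∘ f ∘ φ.symm) (rawPull (E := E') ψ.symm w) y := rawPull_comp _ _ w hψs hg
  refine (c1.trans (c2.trans c3)).trans ?_
  unfold rawPull
  rw [mfderiv_eq_fderiv]
  rfl

theorem smoothAt_rawPull [FiniteDimensional ℝ E] {q : ℕ} {w : RawForm E' N q} {f : M → N} {x : M}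
    (hf : ContMDiffAt 𝓘(ℝ, E) 𝓘(ℝ, E') ∞ f x) (hw : SmoothAt w (f x)) :
    SmoothAt (rawPull (E := E) f w) x := by
  rw [smoothAt_iff] at hw ⊢
  refine ContDiffAt.congr_of_eventuallyEq ?_ (rep_rawPull w hf)
  have hg := contDiffAt_written hf
  refine contDiffAt_alt_comp (ContDiffAt.comp _ ?_ hg) (hg.fderiv_right (m := ∞) (by simp))
  have hgx : writtenInExtChartAt 𝓘(ℝ, E) 𝓘(ℝ, E') x f (extChartAt 𝓘(ℝ, E) x x) =
      extChartAt 𝓘(ℝ, E') (f x) (f x) := by simp [writtenInExtChartAt]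
  rw [hgx]
  exact hw

theorem rawD_rawPull {q : ℕ} {w : RawForm E' N q} {f : M → N} {x : M}
    (hf : ContMDiffAt 𝓘(ℝ, E) 𝓘(ℝ, E') ∞ f x) (hw : SmoothAt w (f x)) :
    rawD (rawPull (E := E) f w) x = rawPull f (rawD w) x := by
  rw [smoothAt_iff] at hw
  have hg := contDiffAt_written hf
  have hgx : writtenInExtChartAt 𝓘(ℝ, E) 𝓘(ℝ, E') x f (extChartAt 𝓘(ℝ, E) x x) =
      extChartAt 𝓘(ℝ, E') (f x) (f x) := by simp [writtenInExtChartAt]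
  have hfd := hf.mdifferentiableAt (by simp)
  have hext := extDeriv_pullback (r := ∞) (x := extChartAt 𝓘(ℝ, E) x x)
    (f := writtenInExtChartAt 𝓘(ℝ, E) 𝓘(ℝ, E') x f)
    (show DifferentiableAt ℝ (rep w (f x)) _ by rw [hgx]; exact hw.differentiableAt (by simp)) hg
    (by rw [minSmoothness_of_isRCLikeNormedField]; exact WithTop.coe_le_coe.2 (le_top : (2 : ℕ∞) ≤ ⊤))
  unfold rawD
  rw [(rep_rawPull w hf).extDeriv_eq, hext, hgx]
  simp only [rawPull]
  have hA : (fderiv ℝ (writtenInExtChartAt 𝓘(ℝ, E) 𝓘(ℝ, E') x f) (extChartAt 𝓘(ℝ, E) x x)) ∘L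
      (mfderiv 𝓘(ℝ, E) 𝓘(ℝ, E) (extChartAt 𝓘(ℝ, E) x) x : E →L[ℝ] E) =
      (mfderiv 𝓘(ℝ, E') 𝓘(ℝ, E') (extChartAt 𝓘(ℝ, E') (f x)) (f x) : E' →L[ℝ] E') ∘L
      (mfderiv 𝓘(ℝ, E) 𝓘(ℝ, E') f x : E →L[ℝ] E') := by
    rw [← mfderiv_eq_fderiv]
    have h1 := mfderiv_comp (I := 𝓘(ℝ, E)) (I' := 𝓘(ℝ, E)) (I'' := 𝓘(ℝ, E')) x
      (g := writtenInExtChartAt 𝓘(ℝ, E) 𝓘(ℝ, E') x f)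
      (f := extChartAt 𝓘(ℝ, E) x) (hg.contMDiffAt.mdifferentiableAt (by simp))
      (mdifferentiableAt_extChartAt (mem_chart_source E x))
    have h2 := mfderiv_comp (I := 𝓘(ℝ, E)) (I' := 𝓘(ℝ, E')) (I'' := 𝓘(ℝ, E')) x
      (g := extChartAt 𝓘(ℝ, E') (f x)) (f := f)
      (mdifferentiableAt_extChartAt (mem_chart_source E' (f x))) hfd
    have h3 : writtenInExtChartAt 𝓘(ℝ, E) 𝓘(ℝ, E') x f ∘ extChartAt 𝓘(ℝ, E) x =ᶠ[𝓝 x]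
        extChartAt 𝓘(ℝ, E') (f x) ∘ f := by
      filter_upwards [extChartAt_source_mem_nhds (I := 𝓘(ℝ, E)) x] with z hz
      exact congrArg (fun z => extChartAt 𝓘(ℝ, E') (f x) (f z))
        ((extChartAt 𝓘(ℝ, E) x).left_inv hz)
    have h4 := h3.mfderiv_eq (I := 𝓘(ℝ, E)) (I' := 𝓘(ℝ, E'))
    exact h1.symm.trans (h4.trans h2)
  ext v
  have := fun i => congrArg (fun T : E →L[ℝ] E' => T (v i)) hA
  exact congrArg (extDeriv (rep w (f x)) _) (funext this)

theorem rawD_model {q : ℕ} (w : RawForm E E q) :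
    rawD w = fun x => extDeriv (fun y : E => (show E [⋀^Fin q]→L[ℝ] ℝ from w y)) x := by
  funext x
  have h : rep w x = fun y : E => (show E [⋀^Fin q]→L[ℝ] ℝ from w y) := by
    funext y
    exact congrFun (rawPull_id w) y
  unfold rawD
  rw [h]
  have : mfderiv 𝓘(ℝ, E) 𝓘(ℝ, E) (extChartAt 𝓘(ℝ, E) x) x = ContinuousLinearMap.id ℝ E := by
    have hid : ⇑(extChartAt 𝓘(ℝ, E) x) = id := by
      simp only [mfld_simps, chartAt_self_eq]
    rw [mfderiv_eq_fderiv, hid]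
    exact fderiv_id
  rw [this]
  rfl

theorem rep_rawD {q : ℕ} {w : RawForm E M q} (hw : ∀ x, SmoothAt w x) (x : M) {y : E}
    (hy : y ∈ (extChartAt 𝓘(ℝ, E) x).target) :
    rep (rawD w) x y = extDeriv (rep w x) y := by
  have h := rawD_rawPull (w := w) (contMDiffAt_chart_symm hy) (hw _)
  rw [rawD_model] at h
  exact h.symm

theorem smoothAt_rawD [FiniteDimensional ℝ E] {q : ℕ} {w : RawForm E M q}
    (hw : ∀ x, SmoothAt w x) (x : M) :
    SmoothAt (rawD w) x := by
  have h := (smoothAt_iff w x).1 (hw x)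
  rw [smoothAt_iff]
  have e : rep (rawD w) x =ᶠ[𝓝 (extChartAt 𝓘(ℝ, E) x x)] extDeriv (rep w x) := by
    filter_upwards [extChartAt_target_mem_nhds (I := 𝓘(ℝ, E)) x] with y hy
    exact rep_rawD hw x hy
  refine ContDiffAt.congr_of_eventuallyEq ?_ e
  have h1 : ContDiffAt ℝ ∞ (fderiv ℝ (rep w x)) (extChartAt 𝓘(ℝ, E) x x) :=
    h.fderiv_right (m := ∞) (by simp)
  exact (ContinuousAlternatingMap.alternatizeUncurryFinCLM ℝ E ℝ).contDiff.contDiffAt.comp _ h1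

end

section
variable {E M : Type*} [NormedAddCommGroup E] [NormedSpace ℝ E] [TopologicalSpace M]
  [ChartedSpace E M] [IsManifold 𝓘(ℝ, E) ∞ M]

theorem rep_add {q : ℕ} (w w' : RawForm E M q) (x : M) : rep (w + w') x = rep w x + rep w' x := rfl

theorem rep_smul {q : ℕ} (c : ℝ) (w : RawForm E M q) (x : M) : rep (c • w) x = c • rep w x := rfl

theorem rawD_add {q : ℕ} {w w' : RawForm E M q} (hw : ∀ x, SmoothAt w x)
    (hw' : ∀ x, SmoothAt w' x) : rawD (w + w') = rawD w + rawD w' := by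
  funext x
  have h := ((smoothAt_iff w x).1 (hw x)).differentiableAt (by simp)
  have h' := ((smoothAt_iff w' x).1 (hw' x)).differentiableAt (by simp)
  simp only [rawD, rep_add, extDeriv_add h h', Pi.add_apply]
  rfl

theorem rawD_smul {q : ℕ} (c : ℝ) (w : RawForm E M q) : rawD (c • w) = c • rawD w := by
  funext x
  simp only [rawD, rep_smul, extDeriv_smul, Pi.smul_apply]
  rfl

theorem smoothAt_wedge [FiniteDimensional ℝ E] {p q : ℕ} {a : RawForm E M p} {b : RawForm E M q}
    {x : M} (ha : SmoothAt a x) (hb : SmoothAt b x) :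
    SmoothAt (fun y => altWedge (a y) (b y) : RawForm E M (p + q)) x := by
  rw [smoothAt_iff] at ha hb ⊢
  have e : rep (fun y => altWedge (a y) (b y) : RawForm E M (p + q)) x =
      fun y => altWedge (rep a x y) (rep b x y) := by
    funext y
    exact altWedge_comp _ _ _
  rw [e]
  exact contDiffAt_altWedge ha hb

theorem smoothAt_one (x : M) : SmoothAt (fun y => ContinuousAlternatingMap.constOfIsEmpty ℝ
    (TangentSpace 𝓘(ℝ, E) y) (Fin 0) (1 : ℝ) : RawForm E M 0) x := by
  rw [smoothAt_iff]
  have e : rep (fun y => ContinuousAlternatingMap.constOfIsEmpty ℝ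
      (TangentSpace 𝓘(ℝ, E) y) (Fin 0) (1 : ℝ) : RawForm E M 0) x =
      fun _ => ContinuousAlternatingMap.constOfIsEmpty ℝ E (Fin 0) (1 : ℝ) := by
    funext y
    ext v
    rfl
  rw [e]
  exact contDiffAt_const
end

/-- A smooth manifold: second countable, Hausdorff, without boundary, modelled on a
finite-dimensional real vector space. -/
structure Man where
  carrier : Type
  model : Type
  [normedAddCommGroup : NormedAddCommGroup model]
  [normedSpace : NormedSpace ℝ model]
  [finiteDimensional : FiniteDimensional ℝ model]
  [topologicalSpace : TopologicalSpace carrier]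
  [t2Space : T2Space carrier]
  [secondCountable : SecondCountableTopology carrier]
  [chartedSpace : ChartedSpace model carrier]
  [isManifold : IsManifold 𝓘(ℝ, model) ∞ carrier]

attribute [instance] Man.normedAddCommGroup Man.normedSpace Man.finiteDimensional
  Man.topologicalSpace Man.t2Space Man.secondCountable Man.chartedSpace Man.isManifold

open CategoryTheory

/-- The category of smooth manifolds and smooth maps. -/
noncomputable instance : Category Man where
  Hom M N := C^∞⟮𝓘(ℝ, M.model), M.carrier; 𝓘(ℝ, N.model), N.carrier⟯
  id _ := ContMDiffMap.id
  comp f g := ContMDiffMap.comp g f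

/-- The smooth map underlying a morphism. -/
def Man.Hom.map {M N : Man} (f : M ⟶ N) :
    C^∞⟮𝓘(ℝ, M.model), M.carrier; 𝓘(ℝ, N.model), N.carrier⟯ := f

/-- `Ω^q(M)`. -/
def Form (M : Man) (q : ℕ) : Type := DF M.model M.carrier q

noncomputable instance (M : Man) (q : ℕ) : AddCommGroup (Form M q) :=
  inferInstanceAs (AddCommGroup (DF M.model M.carrier q))

noncomputable instance (M : Man) (q : ℕ) : Module ℝ (Form M q) :=
  inferInstanceAs (Module ℝ (DF M.model M.carrier q))

namespace Form

/-- Bundle a form that is smooth at every point. -/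
noncomputable def mk {M : Man} {q : ℕ} (w : RawForm M.model M.carrier q)
    (hw : ∀ x, SmoothAt w x) : Form M q :=
  ⟨w, hw⟩

/-- The underlying family of alternating forms. -/
noncomputable def raw {M : Man} {q : ℕ} (w : Form M q) :
    RawForm M.model M.carrier q :=
  fun x => ContMDiffSection.toFun w x

theorem raw_injective {M : Man} {q : ℕ} : Function.Injective (raw : Form M q → _) :=
  fun _ _ h => ContMDiffSection.coe_injective h

theorem smoothAt {M : Man} {q : ℕ} (w : Form M q) (x : M.carrier) : SmoothAt w.raw x :=
  ContMDiffSection.contMDiff_toFun w x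

/-- Pullback of smooth forms along a smooth map. -/
noncomputable def pullback {M N : Man} (f : M ⟶ N) {q : ℕ} : Form N q →ₗ[ℝ] Form M q where
  toFun w := mk (rawPull (Man.Hom.map f) w.raw) fun x =>
    smoothAt_rawPull ((Man.Hom.map f).contMDiff x) (w.smoothAt _)
  map_add' _ _ := raw_injective rfl
  map_smul' _ _ := raw_injective rfl

/-- The exterior derivative of smooth forms. -/
noncomputable def d {M : Man} {q : ℕ} : Form M q →ₗ[ℝ] Form M (q + 1) where
  toFun w := mk (rawD w.raw) (smoothAt_rawD w.smoothAt)
  map_add' w w' := raw_injective (rawD_add w.smoothAt w'.smoothAt)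
  map_smul' c w := raw_injective (rawD_smul c w.raw)

/-- The wedge product of smooth forms. -/
noncomputable def wedge {M : Man} {p q : ℕ} : Form M p →ₗ[ℝ] Form M q →ₗ[ℝ] Form M (p + q) :=
  LinearMap.mk₂ ℝ (fun a b => mk (fun x => altWedge (a.raw x) (b.raw x))
      fun x => smoothAt_wedge (a.smoothAt x) (b.smoothAt x))
    (fun a a' b => raw_injective <| funext fun x =>
      LinearMap.map_add₂ (altWedgeₗ p q) (a.raw x) (a'.raw x) (b.raw x))
    (fun c a b => raw_injective <| funext fun x =>
      LinearMap.map_smul₂ (altWedgeₗ p q) c (a.raw x) (b.raw x))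
    (fun a b b' => raw_injective <| funext fun x =>
      map_add (altWedgeₗ p q (a.raw x)) (b.raw x) (b'.raw x))
    (fun c a b => raw_injective <| funext fun x =>
      map_smul (altWedgeₗ p q (a.raw x)) c (b.raw x))

/-- The constant function `1`, as a `0`-form. -/
noncomputable def one (M : Man) : Form M 0 :=
  mk (fun y => ContinuousAlternatingMap.constOfIsEmpty ℝ
    (TangentSpace 𝓘(ℝ, M.model) y) (Fin 0) (1 : ℝ)) smoothAt_one

theorem pullback_id {M : Man} {q : ℕ} (w : Form M q) : pullback (𝟙 M) w = w :=
  raw_injective (rawPull_id w.raw)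

theorem pullback_comp {M N P : Man} (f : M ⟶ N) (g : N ⟶ P) {q : ℕ} (w : Form P q) :
    pullback (f ≫ g) w = pullback f (pullback g w) :=
  raw_injective <| funext fun x => rawPull_comp (Man.Hom.map g) (Man.Hom.map f) w.raw
    (((Man.Hom.map g).contMDiff _).mdifferentiableAt (by simp))
    (((Man.Hom.map f).contMDiff x).mdifferentiableAt (by simp))

theorem pullback_d {M N : Man} (f : M ⟶ N) {q : ℕ} (w : Form N q) :
    d (pullback f w) = pullback f (d w) :=
  raw_injective <| funext fun x =>
    rawD_rawPull ((Man.Hom.map f).contMDiff x) (w.smoothAt _)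

theorem pullback_wedge {M N : Man} (f : M ⟶ N) {p q : ℕ} (a : Form N p) (b : Form N q) :
    pullback f (wedge a b) = wedge (pullback f a) (pullback f b) :=
  raw_injective <| funext fun _ => altWedge_comp _ _ _

theorem pullback_one {M N : Man} (f : M ⟶ N) : pullback f (one N) = one M :=
  raw_injective <| funext fun _ => rfl

end Form

section
variable (V : Type*) [AddCommGroup V] [Module ℝ V]

/-- `Ω¹(M; V) = Ω¹(M) ⊗ V`, the one-forms on `M` with values in the finite-dimensional space `V`. -/
abbrev OneFormTensor (M : Man) := Form M 1 ⊗[ℝ] V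

variable {V} in
/-- Pullback of `V`-valued one-forms. -/
noncomputable def OneFormTensor.pullback {M N : Man} (f : M ⟶ N) :
    OneFormTensor V N →ₗ[ℝ] OneFormTensor V M :=
  LinearMap.rTensor V (Form.pullback f)

/-- Natural `q`-forms on the presheaf `Ω¹ ⊗ V`: families of maps of sets `Ω¹(M; V) → Ω^q(M)`, one for
each manifold `M`, that commute with pullback along every smooth map. -/
noncomputable def NatForm (q : ℕ) : Submodule ℝ (∀ M : Man, OneFormTensor V M → Form M q) where
  carrier := {τ | ∀ ⦃M N : Man⦄ (f : M ⟶ N) (α : OneFormTensor V N),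
    τ M (OneFormTensor.pullback f α) = Form.pullback f (τ N α)}
  zero_mem' M N f α := by simp
  add_mem' := fun {σ τ} hσ hτ M N f α => by
    simp only [Pi.add_apply, map_add]; rw [hσ f α, hτ f α]
  smul_mem' := fun c τ hτ M N f α => by
    simp only [Pi.smul_apply, map_smul]; rw [hτ f α]

namespace NatForm
variable {V}

/-- The exterior derivative of a natural form: apply `d` to each value. -/
noncomputable def d {q : ℕ} : NatForm V q →ₗ[ℝ] NatForm V (q + 1) where
  toFun τ := ⟨fun M α => Form.d (τ.1 M α), fun M N f α => by
    change Form.d (τ.1 M (OneFormTensor.pullback f α)) = Form.pullback f (Form.d (τ.1 N α))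
    rw [τ.2 f α, Form.pullback_d]⟩
  map_add' σ τ := Subtype.ext <| funext fun M => funext fun α =>
    map_add Form.d (σ.1 M α) (τ.1 M α)
  map_smul' c τ := Subtype.ext <| funext fun M => funext fun α =>
    map_smul Form.d c (τ.1 M α)

/-- The wedge product of natural forms: wedge the values. -/
noncomputable def wedge {p q : ℕ} (σ : NatForm V p) (τ : NatForm V q) : NatForm V (p + q) :=
  ⟨fun M α => Form.wedge (σ.1 M α) (τ.1 M α), fun M N f α => by
    change Form.wedge (σ.1 M (OneFormTensor.pullback f α)) (τ.1 M (OneFormTensor.pullback f α)) =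
      Form.pullback f (Form.wedge (σ.1 N α) (τ.1 N α))
    rw [σ.2 f α, τ.2 f α, Form.pullback_wedge]⟩

noncomputable instance : GradedMonoid.GOne fun q : ℕ => NatForm V q where
  one := ⟨fun M _ => Form.one M, fun _ _ f _ => (Form.pullback_one f).symm⟩

noncomputable instance : DirectSum.GNonUnitalNonAssocSemiring fun q : ℕ => NatForm V q where
  mul := wedge
  mul_zero σ := Subtype.ext <| funext fun M => funext fun α => map_zero (Form.wedge (σ.1 M α))
  zero_mul τ := Subtype.ext <| funext fun M => funext fun α =>
    LinearMap.map_zero₂ Form.wedge (τ.1 M α)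
  mul_add σ τ τ' := Subtype.ext <| funext fun M => funext fun α =>
    map_add (Form.wedge (σ.1 M α)) (τ.1 M α) (τ'.1 M α)
  add_mul σ σ' τ := Subtype.ext <| funext fun M => funext fun α =>
    LinearMap.map_add₂ Form.wedge (σ.1 M α) (σ'.1 M α) (τ.1 M α)

/-- The map `Ω¹(M) ⊗ V → Ω¹(M)`, `α ⊗ v ↦ ℓ(v) α`. -/
noncomputable def evalAt (l : Module.Dual ℝ V) (M : Man) : OneFormTensor V M →ₗ[ℝ] Form M 1 :=
  TensorProduct.lift ((LinearMap.lsmul ℝ (Form M 1)).flip.compl₂ l)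

theorem evalAt_tmul (l : Module.Dual ℝ V) (M : Man) (a : Form M 1) (v : V) :
    evalAt l M (a ⊗ₜ v) = l v • a := rfl

/-- The natural one-form `∑ αᵢ ⊗ vᵢ ↦ ∑ ℓ(vᵢ) αᵢ` given by a linear form `ℓ` on `V`. -/
noncomputable def eval (l : Module.Dual ℝ V) : NatForm V 1 :=
  ⟨fun M α => evalAt l M α, fun M N f α => by
    change evalAt l M (OneFormTensor.pullback f α) = Form.pullback f (evalAt l N α)
    induction α using TensorProduct.induction_on with
    | zero => rw [LinearMap.map_zero, LinearMap.map_zero, LinearMap.map_zero, LinearMap.map_zero]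
    | add a b ha hb =>
      rw [LinearMap.map_add, LinearMap.map_add, LinearMap.map_add, LinearMap.map_add, ha, hb]
    | tmul a v =>
      rw [OneFormTensor.pullback, LinearMap.rTensor_tmul, evalAt_tmul, evalAt_tmul,
        LinearMap.map_smul]⟩

end NatForm

/-- The algebra `Ω^•(Ω¹ ⊗ V)` of natural forms, the direct sum of its homogeneous parts, with the
wedge product as multiplication. -/
abbrev DeRham := ⨁ q : ℕ, NatForm V q

/-- The exterior derivative of natural forms, on all degrees. -/
noncomputable def DeRham.d : DeRham V →ₗ[ℝ] DeRham V :=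
  DirectSum.toModule ℝ ℕ _ fun q => DirectSum.lof ℝ ℕ (fun q => NatForm V q) (q + 1) ∘ₗ NatForm.d

/-- The class of a natural `q`-form in `Ω^•(Ω¹ ⊗ V)`. -/
noncomputable abbrev DeRham.of (q : ℕ) : NatForm V q →ₗ[ℝ] DeRham V :=
  DirectSum.lof ℝ ℕ (fun q => NatForm V q) q

/-- Homomorphisms of differential graded algebras `Kos^• V* → Ω^•(Ω¹ ⊗ V)`. -/
structure IsDGAHom [FiniteDimensional ℝ V]
    (η : Koszul (Module.Dual ℝ V) →ₗ[ℝ] DeRham V) : Prop where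
  map_one : η 1 = 1
  map_mul : ∀ x y, η (x * y) = η x * η y
  map_grade : ∀ n, ∀ x ∈ Koszul.grade (Module.Dual ℝ V) n, η x ∈ LinearMap.range (DeRham.of V n)
  map_d : ∀ x, η (Koszul.d (Module.Dual ℝ V) x) = DeRham.d V (η x)
end

end NatDeRham

/-! A natural form is recovered by adding auxiliary coordinates to the base. In a basis of `V` its
argument becomes an `ℝⁿ`-valued one-form `g` on a vector space `E`. Evaluating on `g + dt e_a` over
`ℝ × E` and contracting with `∂_t` gives the operator `Fam.contr a`, which lowers the degree by one.
Evaluating on `g + y dz e_a` over `ℝ × ℝ × E` and contracting with `∂_y` and `∂_z` at `y = z = 0`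
gives `Fam.contrT a`, which lowers it by two. On a polynomial in the components `α_a` and their
differentials these are the derivatives with respect to `α_a` and `dα_a`, because `dα_a` turns into
`dα_a + dy ∧ dz`.

The analytic core is `IsNat.eq_zero`: a natural family of positive degree killed by all these
operators vanishes. The form `g + y dz e_a` on `E` is a pullback along the graph of `(y, z)`. The
symmetries of `y dz` (slices, translation in `z`, the scaling `(c y, c⁻¹ z)`) show that the value
upstairs has only the components `F(g)`, `y · contr a F` along `dz`, and `contrT a F` along `dy ∧
dz`. If the last two vanish, adding `y dz e_a` does not change `F`. Every one-form on `E` is a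
finite sum of such terms, so `F(g) = F(0)`, and `F(0)` is a pullback from a constant map, hence zero
in positive degree. Continuity enters only through the smoothness of the values of `F` in the base
point.

The Koszul algebra carries the matching derivatives `del` and `delT`, and Euler's identity (`euler`)
rebuilds an element of degree `q > 0` from them. Solving it recursively for the operators of a
natural form defines `taylor`. The derivatives of `taylor` are the `taylor` elements of the
contractions (`del_taylor`, `delT_taylor`), which rests on the commutation rules of the operators.
Injectivity then follows from the vanishing criterion. Compatibility with products and differentials
follows by induction on the degree, since both sides have the same derivatives (`taylor_wedge`,
`taylor_D`). Surjectivity holds because the image is a subalgebra closed under `d` that contains the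
generators. The map `η` is the inverse. Manifolds reduce to vector spaces by `Man.exists_param`. -/

namespace NatDeRham

/-! ### Derivations, grading and Euler's identity on the Koszul algebra -/

namespace Koszul
section
variable {W : Type*} [AddCommGroup W] [Module ℝ W]

/-- The algebra homomorphism `s ↦ s + ε D(s)`, where `D` is the derivation of `Sym W` that extends the
linear form `c`. -/
noncomputable def symLift (c : Module.Dual ℝ W) :
    SymmetricAlgebra ℝ W →ₐ[ℝ] TrivSqZeroExt (SymmetricAlgebra ℝ W) (SymmetricAlgebra ℝ W) :=
  SymmetricAlgebra.lift
    ((TrivSqZeroExt.inlAlgHom ℝ (SymmetricAlgebra ℝ W) (SymmetricAlgebra ℝ W)).toLinearMap ∘ₗ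
        SymmetricAlgebra.ι ℝ W +
      (TrivSqZeroExt.inrHom (SymmetricAlgebra ℝ W) (SymmetricAlgebra ℝ W)).restrictScalars ℝ ∘ₗ
        (Algebra.linearMap ℝ (SymmetricAlgebra ℝ W)) ∘ₗ c)

theorem fst_symLift (c : Module.Dual ℝ W) (s : SymmetricAlgebra ℝ W) : (symLift c s).fst = s := by
  have : (TrivSqZeroExt.fstHom ℝ (SymmetricAlgebra ℝ W) (SymmetricAlgebra ℝ W)).comp (symLift c) =
      AlgHom.id ℝ _ := by
    refine SymmetricAlgebra.algHom_ext (LinearMap.ext fun w => ?_)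
    simp [symLift]
  exact congrArg (fun T : SymmetricAlgebra ℝ W →ₐ[ℝ] _ => T s) this

/-- The derivation of the symmetric algebra that extends a linear form. -/
noncomputable def symDer (c : Module.Dual ℝ W) :
    SymmetricAlgebra ℝ W →ₗ[ℝ] SymmetricAlgebra ℝ W :=
  (TrivSqZeroExt.sndHom (SymmetricAlgebra ℝ W) (SymmetricAlgebra ℝ W)).restrictScalars ℝ ∘ₗ
    (symLift c).toLinearMap

/-- The coefficient of `ε` in a product of dual numbers obeys the Leibniz rule, and the constant
part of `symLift c s` is `s`. -/
theorem symDer_mul (c : Module.Dual ℝ W) (s t : SymmetricAlgebra ℝ W) :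
    symDer c (s * t) = symDer c s * t + s * symDer c t := by
  simp [symDer, fst_symLift, TrivSqZeroExt.snd_mul]
  ring

theorem symDer_algebraMap (c : Module.Dual ℝ W) (r : ℝ) :
    symDer c (algebraMap ℝ _ r) = 0 := by
  simp [symDer, TrivSqZeroExt.algebraMap_eq_inl']

theorem symDer_ι (c : Module.Dual ℝ W) (w : W) :
    symDer c (SymmetricAlgebra.ι ℝ W w) = algebraMap ℝ _ (c w) := by
  simp [symDer, symLift, Algebra.algebraMap_eq_smul_one]

/-- Contraction of the exterior factor with a linear form. -/
noncomputable def del (c : Module.Dual ℝ W) : Koszul W →ₗ[ℝ] Koszul W :=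
  TensorProduct.map (contract c) LinearMap.id

/-- Differentiation of the symmetric factor along a linear form. -/
noncomputable def delT (c : Module.Dual ℝ W) : Koszul W →ₗ[ℝ] Koszul W :=
  TensorProduct.map LinearMap.id (symDer c)

@[simp] theorem del_tmul (c : Module.Dual ℝ W) (a : ExteriorAlgebra ℝ W)
    (s : SymmetricAlgebra ℝ W) : del c (a ⊗ₜ s) = contract c a ⊗ₜ s := rfl

@[simp] theorem delT_tmul (c : Module.Dual ℝ W) (a : ExteriorAlgebra ℝ W)
    (s : SymmetricAlgebra ℝ W) : delT c (a ⊗ₜ s) = a ⊗ₜ symDer c s := rfl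

theorem gen_eq (w : W) : (gen w : Koszul W) = ExteriorAlgebra.ι ℝ w ⊗ₜ 1 := rfl

theorem tilde_eq (w : W) : (tilde w : Koszul W) = 1 ⊗ₜ SymmetricAlgebra.ι ℝ W w := rfl

theorem contract_ι_mul (c : Module.Dual ℝ W) (w : W) (a : ExteriorAlgebra ℝ W) :
    contract c (ExteriorAlgebra.ι ℝ w * a) = c w • a - ExteriorAlgebra.ι ℝ w * contract c a :=
  CliffordAlgebra.contractLeft_ι_mul (Q := (0 : QuadraticForm ℝ W)) c w a

theorem contract_comm (c c' : Module.Dual ℝ W) (a : ExteriorAlgebra ℝ W) :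
    contract c (contract c' a) = -contract c' (contract c a) :=
  CliffordAlgebra.contractLeft_comm (Q := (0 : QuadraticForm ℝ W)) (d := c) (d' := c') a

theorem del_gen_mul (c : Module.Dual ℝ W) (w : W) (x : Koszul W) :
    del c (gen w * x) = c w • x - gen w * del c x := by
  induction x using TensorProduct.induction_on with
  | zero => simp
  | add x y hx hy => rw [mul_add, map_add, hx, hy, map_add, mul_add, smul_add]; abel
  | tmul a s =>
    simp [gen_eq, contract_ι_mul, TensorProduct.sub_tmul, TensorProduct.smul_tmul']

theorem del_tilde_mul (c : Module.Dual ℝ W) (w : W) (x : Koszul W) :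
    del c (tilde w * x) = tilde w * del c x := by
  induction x using TensorProduct.induction_on with
  | zero => simp
  | add x y hx hy => rw [mul_add, map_add, hx, hy, map_add, mul_add]
  | tmul a s => simp [tilde_eq]

theorem delT_gen_mul (c : Module.Dual ℝ W) (w : W) (x : Koszul W) :
    delT c (gen w * x) = gen w * delT c x := by
  induction x using TensorProduct.induction_on with
  | zero => simp
  | add x y hx hy => rw [mul_add, map_add, hx, hy, map_add, mul_add]
  | tmul a s => simp [gen_eq]

theorem delT_mul (c : Module.Dual ℝ W) (x y : Koszul W) :
    delT c (x * y) = delT c x * y + x * delT c y := by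
  induction x using TensorProduct.induction_on with
  | zero => simp
  | add x y hx hy => rw [add_mul, map_add, hx, hy, map_add, add_mul, add_mul]; abel
  | tmul a s =>
    induction y using TensorProduct.induction_on with
    | zero => simp
    | add x y hx hy => rw [mul_add, map_add, hx, hy, map_add, mul_add, mul_add]; abel
    | tmul b t => simp [symDer_mul, TensorProduct.tmul_add]

theorem delT_tilde (c : Module.Dual ℝ W) (w : W) : delT c (tilde w) = c w • 1 := by
  rw [tilde_eq, delT_tmul, symDer_ι, Algebra.algebraMap_eq_smul_one, TensorProduct.tmul_smul]
  rfl

theorem delT_tilde_mul (c : Module.Dual ℝ W) (w : W) (x : Koszul W) :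
    delT c (tilde w * x) = c w • x + tilde w * delT c x := by
  rw [delT_mul, delT_tilde, smul_one_mul]

theorem del_one (c : Module.Dual ℝ W) : del c (1 : Koszul W) = 0 := by
  change del c (1 ⊗ₜ 1) = 0
  rw [del_tmul, ← map_one (algebraMap ℝ _), contract_algebraMap, TensorProduct.zero_tmul]

theorem delT_one (c : Module.Dual ℝ W) : delT c (1 : Koszul W) = 0 := by
  change delT c (1 ⊗ₜ 1) = 0
  rw [delT_tmul, ← map_one (algebraMap ℝ (SymmetricAlgebra ℝ W)), symDer_algebraMap,
    TensorProduct.tmul_zero]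

theorem bigrade_le_grade (p r : ℕ) : bigrade W p r ≤ grade W (p + 2 * r) :=
  le_iSup_of_le p (le_iSup_of_le r (le_iSup_of_le rfl le_rfl))

theorem grade_le {n : ℕ} {S : Submodule ℝ (Koszul W)}
    (h : ∀ p r, p + 2 * r = n → ∀ a ∈ ⋀[ℝ]^p W,
      ∀ s ∈ LinearMap.range (SymmetricAlgebra.ι ℝ W) ^ r, a ⊗ₜ[ℝ] s ∈ S) : grade W n ≤ S :=
  iSup_le fun p => iSup_le fun r => iSup_le fun hpr =>
    Submodule.map₂_le.2 fun a ha s hs => h p r hpr a ha s hs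

theorem tmul_mem_grade {p r n : ℕ} (h : p + 2 * r = n) {a : ExteriorAlgebra ℝ W}
    {s : SymmetricAlgebra ℝ W} (ha : a ∈ ⋀[ℝ]^p W)
    (hs : s ∈ LinearMap.range (SymmetricAlgebra.ι ℝ W) ^ r) : a ⊗ₜ[ℝ] s ∈ grade W n :=
  h ▸ bigrade_le_grade p r (Submodule.apply_mem_map₂ _ ha hs)

theorem one_mem_grade : (1 : Koszul W) ∈ grade W 0 :=
  tmul_mem_grade (p := 0) (r := 0) rfl
    (by simp) (by simp)

theorem gen_mul_mem {n : ℕ} (w : W) {x : Koszul W} (hx : x ∈ grade W n) :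
    gen w * x ∈ grade W (n + 1) := by
  refine grade_le (S := (grade W (n + 1)).comap (LinearMap.mulLeft ℝ (gen w)))
    (fun p r h a ha s hs => ?_) hx
  rw [Submodule.mem_comap, LinearMap.mulLeft_apply, gen_eq, Algebra.TensorProduct.tmul_mul_tmul,
    one_mul]
  refine tmul_mem_grade (p := p + 1) (r := r) (by omega) ?_ hs
  rw [ExteriorAlgebra.exteriorPower, pow_succ']
  exact Submodule.mul_mem_mul ⟨w, rfl⟩ ha

theorem tilde_mul_mem {n : ℕ} (w : W) {x : Koszul W} (hx : x ∈ grade W n) :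
    tilde w * x ∈ grade W (n + 2) := by
  refine grade_le (S := (grade W (n + 2)).comap (LinearMap.mulLeft ℝ (tilde w)))
    (fun p r h a ha s hs => ?_) hx
  rw [Submodule.mem_comap, LinearMap.mulLeft_apply, tilde_eq, Algebra.TensorProduct.tmul_mul_tmul,
    one_mul]
  refine tmul_mem_grade (p := p) (r := r + 1) (by omega) ha ?_
  rw [pow_succ']
  exact Submodule.mul_mem_mul ⟨w, rfl⟩ hs

theorem mul_mem_grade {m n : ℕ} {x y : Koszul W} (hx : x ∈ grade W m) (hy : y ∈ grade W n) :
    x * y ∈ grade W (m + n) := by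
  refine grade_le (S := (grade W (m + n)).comap (LinearMap.mulRight ℝ y))
    (fun p r h a ha s hs => ?_) hx
  refine grade_le (S := (grade W (m + n)).comap (LinearMap.mulLeft ℝ (a ⊗ₜ s)))
    (fun p' r' h' a' ha' s' hs' => ?_) hy
  rw [Submodule.mem_comap, LinearMap.mulLeft_apply, Algebra.TensorProduct.tmul_mul_tmul]
  refine tmul_mem_grade (p := p + p') (r := r + r') (by omega) ?_ ?_
  · rw [ExteriorAlgebra.exteriorPower, pow_add]; exact Submodule.mul_mem_mul ha ha'
  · rw [pow_add]; exact Submodule.mul_mem_mul hs hs'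

/-- With truncated subtraction the first half says too little for `p = 0`; the second half supplies
the vanishing on constants. -/
theorem contract_mem (c : Module.Dual ℝ W) {p : ℕ} {a : ExteriorAlgebra ℝ W}
    (ha : a ∈ ⋀[ℝ]^p W) : contract c a ∈ ⋀[ℝ]^(p - 1) W ∧ (p = 0 → contract c a = 0) := by
  induction ha using Submodule.pow_induction_on_left' with
  | algebraMap r => rw [contract_algebraMap]; exact ⟨Submodule.zero_mem _, fun _ => rfl⟩
  | add x y i hx hy ihx ihy =>
    rw [map_add]
    exact ⟨Submodule.add_mem _ ihx.1 ihy.1, fun h => by rw [ihx.2 h, ihy.2 h, add_zero]⟩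
  | mem_mul m hm i x hx ih =>
    obtain ⟨w, rfl⟩ := hm
    refine ⟨?_, fun h => by omega⟩
    rw [contract_ι_mul]
    refine Submodule.sub_mem _ (Submodule.smul_mem _ _ hx) ?_
    rcases i with _ | i
    · rw [ih.2 rfl, mul_zero]; exact Submodule.zero_mem _
    · rw [Nat.succ_eq_add_one, Nat.add_sub_cancel, ExteriorAlgebra.exteriorPower, pow_succ']
      exact Submodule.mul_mem_mul ⟨w, rfl⟩ ih.1

theorem del_mul (c : Module.Dual ℝ W) {n : ℕ} {x : Koszul W} (hx : x ∈ grade W n)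
    (y : Koszul W) : del c (x * y) = del c x * y + (-1 : ℝ) ^ n • (x * del c y) := by
  refine grade_le (S := LinearMap.eqLocus (del c ∘ₗ LinearMap.mulRight ℝ y)
      (LinearMap.mulRight ℝ y ∘ₗ del c + (-1 : ℝ) ^ n • LinearMap.mulRight ℝ (del c y)))
    (fun p r h a ha s _ => ?_) hx
  change del c (a ⊗ₜ s * y) = del c (a ⊗ₜ s) * y + (-1 : ℝ) ^ n • (a ⊗ₜ s * del c y)
  -- The symmetric factor has even degree `2 r`, so the total degree and the exterior degree give
  -- the same sign.
  have hn : (-1 : ℝ) ^ n = (-1) ^ p := by rw [← h, pow_add, pow_mul]; simp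
  induction y using TensorProduct.induction_on with
  | zero => simp
  | add y z hy hz => rw [mul_add, map_add, hy, hz, map_add, mul_add, mul_add, smul_add]; abel
  | tmul b t =>
    rw [Algebra.TensorProduct.tmul_mul_tmul, del_tmul, del_tmul, del_tmul, contract_mul _ ha,
      Algebra.TensorProduct.tmul_mul_tmul, Algebra.TensorProduct.tmul_mul_tmul,
      TensorProduct.add_tmul, TensorProduct.smul_tmul', hn]

/-- A pure tensor is the product of `a ⊗ 1` and `1 ⊗ s`, so the inductions on the two factors
combine. Both the uniqueness of `η` and surjectivity use this. -/
theorem induction {P : Koszul W → Prop} (h1 : ∀ r : ℝ, P (algebraMap ℝ _ r))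
    (hgen : ∀ w, P (gen w)) (htilde : ∀ w, P (tilde w))
    (hadd : ∀ x y, P x → P y → P (x + y)) (hmul : ∀ x y, P x → P y → P (x * y))
    (x : Koszul W) : P x := by
  induction x using TensorProduct.induction_on with
  | zero => simpa using h1 0
  | add x y hx hy => exact hadd _ _ hx hy
  | tmul a s =>
    have ha : P (a ⊗ₜ 1) := by
      induction a using ExteriorAlgebra.induction with
      | algebraMap r => exact h1 r
      | ι w => exact hgen w
      | mul a b ha hb => simpa using hmul _ _ ha hb
      | add a b ha hb => rw [TensorProduct.add_tmul]; exact hadd _ _ ha hb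
    have hs : P (1 ⊗ₜ s) := by
      induction s using SymmetricAlgebra.induction with
      | algebraMap r =>
        have := h1 r
        rwa [Algebra.TensorProduct.algebraMap_apply, Algebra.algebraMap_eq_smul_one,
          ← TensorProduct.smul_tmul', ← TensorProduct.tmul_smul,
          ← Algebra.algebraMap_eq_smul_one] at this
      | ι w => exact htilde w
      | mul a b ha hb => simpa using hmul _ _ ha hb
      | add a b ha hb => rw [TensorProduct.tmul_add]; exact hadd _ _ ha hb
    simpa using hmul _ _ ha hs

section
variable [FiniteDimensional ℝ W]

theorem d_mem_grade {n : ℕ} {x : Koszul W} (hx : x ∈ grade W n) : d W x ∈ grade W (n + 1) := by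
  refine grade_le (S := (grade W (n + 1)).comap (d W)) (fun p r h a ha s hs => ?_) hx
  rw [Submodule.mem_comap, d_tmul]
  refine Submodule.sum_mem _ fun i _ => ?_
  rcases p with _ | p
  · rw [(contract_mem _ ha).2 rfl, TensorProduct.zero_tmul]; exact Submodule.zero_mem _
  · refine tmul_mem_grade (p := p) (r := r + 1) (by omega) (contract_mem _ ha).1 ?_
    rw [pow_succ']
    exact Submodule.mul_mem_mul ⟨_, rfl⟩ hs

/-- Two contractions of the exterior algebra anticommute, and `d` contracts in each summand. -/
theorem del_d (c : Module.Dual ℝ W) (x : Koszul W) : del c (d W x) = -d W (del c x) := by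
  induction x using TensorProduct.induction_on with
  | zero => simp
  | add x y hx hy => rw [map_add, map_add, hx, hy, map_add, map_add]; abel
  | tmul a s =>
    rw [del_tmul, d_tmul, d_tmul, map_sum, ← Finset.sum_neg_distrib]
    refine Finset.sum_congr rfl fun i _ => ?_
    rw [del_tmul, contract_comm, TensorProduct.neg_tmul]

/-- Differentiating the factor `b̃ᵢ` of the `i`-th summand of `d` leaves `c(bᵢ)` times the
contraction with `bᵢ*`, and `∑ c(bᵢ) bᵢ* = c`. The counterpart for natural forms is
`IsNat.contrT_D`. -/
theorem delT_d (c : Module.Dual ℝ W) (x : Koszul W) :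
    delT c (d W x) = d W (delT c x) + del c x := by
  induction x using TensorProduct.induction_on with
  | zero => simp
  | add x y hx hy => rw [map_add, map_add, hx, hy, map_add, map_add, map_add]; abel
  | tmul a s =>
    rw [delT_tmul, d_tmul, d_tmul, map_sum, del_tmul]
    have h : contract c a = ∑ i, c (Module.finBasis ℝ W i) •
        contract ((Module.finBasis ℝ W).coord i) a := by
      have hc : c = ∑ i, c (Module.finBasis ℝ W i) • (Module.finBasis ℝ W).coord i := by
        refine (Module.finBasis ℝ W).ext fun j => ?_
        simp
      have h2 : ∀ c', contract c' a =
          CliffordAlgebra.contractLeft (Q := (0 : QuadraticForm ℝ W)) c' a := fun _ => rfl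
      simp only [h2]
      conv_lhs => rw [hc]
      simp only [map_sum, map_smul, LinearMap.sum_apply, LinearMap.smul_apply]
    rw [h, TensorProduct.sum_tmul, ← Finset.sum_add_distrib]
    refine Finset.sum_congr rfl fun i _ => ?_
    rw [delT_tmul, symDer_mul, symDer_ι, TensorProduct.tmul_add, ← Algebra.smul_def,
      TensorProduct.tmul_smul, TensorProduct.smul_tmul', add_comm]

end

section
variable {κ : Type*} [Fintype κ] {l : κ → W} {c : κ → Module.Dual ℝ W}

/-- The operator `∑ ι(l k) · contract (c k)` is a derivation that fixes each generator by `h`, so it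
counts exterior factors. Moving `ι(l k)` past a generator and contracting past it each cost a sign,
and the two signs cancel. -/
theorem euler_ext (h : ∀ w, ∑ k, c k w • l k = w) {p : ℕ} {a : ExteriorAlgebra ℝ W}
    (ha : a ∈ ⋀[ℝ]^p W) : ∑ k, ExteriorAlgebra.ι ℝ (l k) * contract (c k) a = (p : ℝ) • a := by
  induction ha using Submodule.pow_induction_on_left' with
  | algebraMap r => simp [contract_algebraMap]
  | add x y i hx hy ihx ihy => simp only [map_add, mul_add, Finset.sum_add_distrib, ihx, ihy, smul_add]
  | mem_mul m hm i x hx ih =>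
    obtain ⟨w, rfl⟩ := hm
    have h1 : ∀ k, ExteriorAlgebra.ι ℝ (l k) * contract (c k) (ExteriorAlgebra.ι ℝ w * x) =
        ExteriorAlgebra.ι ℝ (c k w • l k) * x +
          ExteriorAlgebra.ι ℝ w * (ExteriorAlgebra.ι ℝ (l k) * contract (c k) x) := by
      intro k
      have h2 := ExteriorAlgebra.ι_add_mul_swap (R := ℝ) (l k) w
      rw [contract_ι_mul, mul_sub, ← mul_assoc, eq_neg_of_add_eq_zero_left h2, map_smul,
        smul_mul_assoc, mul_smul_comm, neg_mul, sub_neg_eq_add, mul_assoc]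
    rw [Finset.sum_congr rfl fun k _ => h1 k, Finset.sum_add_distrib, ← Finset.sum_mul, ← map_sum,
      h w, ← Finset.mul_sum, ih, mul_smul_comm, Nat.succ_eq_add_one, Nat.cast_add, Nat.cast_one,
      add_smul, one_smul, add_comm]

theorem euler_sym (h : ∀ w, ∑ k, c k w • l k = w) {r : ℕ} {s : SymmetricAlgebra ℝ W}
    (hs : s ∈ LinearMap.range (SymmetricAlgebra.ι ℝ W) ^ r) :
    ∑ k, SymmetricAlgebra.ι ℝ W (l k) * symDer (c k) s = (r : ℝ) • s := by
  induction hs using Submodule.pow_induction_on_left' with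
  | algebraMap r => simp [symDer_algebraMap]
  | add x y i hx hy ihx ihy => simp only [map_add, mul_add, Finset.sum_add_distrib, ihx, ihy, smul_add]
  | mem_mul m hm i x hx ih =>
    obtain ⟨w, rfl⟩ := hm
    have h1 : ∀ k, SymmetricAlgebra.ι ℝ W (l k) * symDer (c k) (SymmetricAlgebra.ι ℝ W w * x) =
        SymmetricAlgebra.ι ℝ W (c k w • l k) * x +
          SymmetricAlgebra.ι ℝ W w * (SymmetricAlgebra.ι ℝ W (l k) * symDer (c k) x) := by
      intro k
      rw [symDer_mul, symDer_ι, ← Algebra.smul_def, map_smul, mul_add, mul_smul_comm,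
        smul_mul_assoc, mul_left_comm]
    rw [Finset.sum_congr rfl fun k _ => h1 k, Finset.sum_add_distrib, ← Finset.sum_mul, ← map_sum,
      h w, ← Finset.mul_sum, ih, mul_smul_comm, Nat.succ_eq_add_one, Nat.cast_add, Nat.cast_one,
      add_smul, one_smul, add_comm]

/-- The weights one and two are the degrees of the generators, so the sum of the two number
operators counts the total degree `p + 2 r`. -/
theorem euler (h : ∀ w, ∑ k, c k w • l k = w) {n : ℕ} {x : Koszul W} (hx : x ∈ grade W n) :
    ∑ k, gen (l k) * del (c k) x + (2 : ℝ) • ∑ k, tilde (l k) * delT (c k) x = (n : ℝ) • x := by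
  refine grade_le (S := LinearMap.eqLocus
      (∑ k, LinearMap.mulLeft ℝ (gen (l k)) ∘ₗ del (c k) +
        (2 : ℝ) • ∑ k, LinearMap.mulLeft ℝ (tilde (l k)) ∘ₗ delT (c k))
      ((n : ℝ) • LinearMap.id)) (fun p r hpr a ha s hs => ?_) hx |> fun h => by
    simpa [LinearMap.mem_eqLocus] using h
  simp only [LinearMap.mem_eqLocus, LinearMap.add_apply, LinearMap.sum_apply, LinearMap.smul_apply,
    LinearMap.comp_apply, LinearMap.mulLeft_apply, del_tmul, delT_tmul, LinearMap.id_apply, gen_eq,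
    tilde_eq, Algebra.TensorProduct.tmul_mul_tmul, one_mul]
  rw [← TensorProduct.sum_tmul, ← TensorProduct.tmul_sum, euler_ext h ha, euler_sym h hs, ← hpr,
    TensorProduct.tmul_smul, ← TensorProduct.smul_tmul', smul_smul, ← add_smul]
  push_cast
  rfl

/-- Euler's identity expresses `n • x` through the derivatives of `x`. Degree zero is excluded
because constants have no derivatives. -/
theorem eq_of_del_eq (h : ∀ w, ∑ k, c k w • l k = w) {n : ℕ} (hn : n ≠ 0) {x y : Koszul W}
    (hx : x ∈ grade W n) (hy : y ∈ grade W n) (h1 : ∀ k, del (c k) x = del (c k) y)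
    (h2 : ∀ k, delT (c k) x = delT (c k) y) : x = y := by
  have hx' := euler h hx
  simp only [h1, h2] at hx'
  rw [euler h hy] at hx'
  exact (smul_right_injective _ (Nat.cast_ne_zero.2 hn) hx').symm

end
end
end Koszul

/-! ### Alternating functions of sequences and their wedge product -/

section
variable {T S : Type*}

/-- Prepend an entry to a sequence. -/
def scons (X : T) (v : ℕ → T) : ℕ → T
  | 0 => X
  | n + 1 => v n

@[simp] theorem scons_zero (X : T) (v : ℕ → T) : scons X v 0 = X := rfl

@[simp] theorem scons_succ (X : T) (v : ℕ → T) (n : ℕ) : scons X v (n + 1) = v n := rfl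

theorem scons_eta (v : ℕ → T) : scons (v 0) (fun n => v (n + 1)) = v := by
  funext n; cases n <;> rfl

theorem map_scons (f : T → S) (X : T) (v : ℕ → T) :
    (fun n => f (scons X v n)) = scons (f X) (fun n => f (v n)) := by
  funext n; cases n <;> rfl

/-- Insert an entry at position `k` of a sequence. -/
def sins (k : ℕ) (X : T) (v : ℕ → T) : ℕ → T :=
  fun i => if i < k then v i else if i = k then X else v (i - 1)

end

section
variable {T S : Type*} [NormedAddCommGroup T] [NormedSpace ℝ T]
  [NormedAddCommGroup S] [NormedSpace ℝ S]

/-- A function of sequences of vectors is alternating of degree `q` if it is an alternating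
`q`-linear form in the first `q` entries. -/
def IsAlt (q : ℕ) (φ : (ℕ → T) → ℝ) : Prop :=
  ∃ w : T [⋀^Fin q]→L[ℝ] ℝ, ∀ v, φ v = w fun i => v i

namespace IsAlt
variable {q : ℕ} {φ : (ℕ → T) → ℝ}

theorem congr (h : IsAlt q φ) {v w : ℕ → T} (hvw : ∀ i < q, v i = w i) : φ v = φ w := by
  obtain ⟨a, ha⟩ := h
  rw [ha, ha]
  exact congrArg a (funext fun i => hvw i i.2)

theorem cons (h : IsAlt (q + 1) φ) (X : T) : IsAlt q fun v => φ (scons X v) := by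
  obtain ⟨a, ha⟩ := h
  refine ⟨{ a.toAlternatingMap.curryLeft X with
    cont := a.cont.comp (f := fun m : Fin q → T => (Fin.cons X m : Fin (q + 1) → T))
      (by fun_prop) }, fun v => (ha _).trans ?_⟩
  refine congrArg a (funext fun i => ?_)
  cases i using Fin.cases <;> rfl

theorem comp (h : IsAlt q φ) (L : S →L[ℝ] T) : IsAlt q fun v => φ fun i => L (v i) := by
  obtain ⟨a, ha⟩ := h
  exact ⟨a.compContinuousLinearMap L, fun v => ha _⟩

theorem cons_add (h : IsAlt (q + 1) φ) (X Y : T) (v : ℕ → T) :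
    φ (scons (X + Y) v) = φ (scons X v) + φ (scons Y v) := by
  obtain ⟨a, ha⟩ := h
  have e : ∀ X, (fun i : Fin (q + 1) => scons X v i) = Fin.cons X fun i : Fin q => v i := fun X => by
    funext i; cases i using Fin.cases <;> rfl
  rw [ha, ha, ha, e, e, e]
  exact a.toMultilinearMap.cons_add _ _ _

theorem cons_smul (h : IsAlt (q + 1) φ) (c : ℝ) (X : T) (v : ℕ → T) :
    φ (scons (c • X) v) = c * φ (scons X v) := by
  obtain ⟨a, ha⟩ := h
  have e : ∀ X, (fun i : Fin (q + 1) => scons X v i) = Fin.cons X fun i : Fin q => v i := fun X => by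
    funext i; cases i using Fin.cases <;> rfl
  rw [ha, ha, e, e]
  exact a.toMultilinearMap.cons_smul _ _ _

theorem cons_zero (h : IsAlt (q + 1) φ) (v : ℕ → T) : φ (scons 0 v) = 0 := by
  simpa using h.cons_smul 0 0 v

theorem cons_self (h : IsAlt (q + 2) φ) (X : T) (v : ℕ → T) : φ (scons X (scons X v)) = 0 := by
  obtain ⟨a, ha⟩ := h
  rw [ha]
  exact a.map_eq_zero_of_eq _ (i := 0) (j := 1) rfl (by simp)

theorem cons_swap (h : IsAlt (q + 2) φ) (X Y : T) (v : ℕ → T) :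
    φ (scons X (scons Y v)) = -φ (scons Y (scons X v)) := by
  have h1 := h.cons_self (X + Y) v
  have h2 : ∀ Z, φ (scons Z (scons (X + Y) v)) = φ (scons Z (scons X v)) + φ (scons Z (scons Y v)) :=
    fun Z => (h.cons Z).cons_add X Y v
  rw [h.cons_add, h2, h2, h.cons_self, h.cons_self] at h1
  linarith

/-- Bringing the inserted entry to the front takes `k` transpositions. -/
theorem sins_eq (h : IsAlt (q + 1) φ) {k : ℕ} (hk : k ≤ q) (X : T) (v : ℕ → T) :
    φ (sins k X v) = (-1) ^ k * φ (scons X v) := by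
  obtain ⟨a, ha⟩ := h
  rw [ha, ha]
  have h1 := a.toAlternatingMap.map_insertNth ⟨k, by omega⟩ X fun i : Fin q => v i
  have e1 : (fun i : Fin (q + 1) => sins k X v i) =
      Fin.insertNth ⟨k, by omega⟩ X fun i : Fin q => v i := by
    refine Fin.eq_insertNth_iff.2 ⟨by simp [sins], funext fun i => ?_⟩
    simp only [Fin.removeNth_apply, sins, Fin.succAbove, Fin.lt_def, Fin.val_castSucc]
    by_cases hi : (i : ℕ) < k
    · simp [hi]
    · simp [hi, show ¬ ((i : ℕ) + 1 < k) by omega, show (i : ℕ) + 1 ≠ k by omega]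
  have e2 : (fun i : Fin (q + 1) => scons X v i) = Matrix.vecCons X fun i : Fin q => v i := by
    funext i; cases i using Fin.cases <;> rfl
  rw [e1, e2]
  simpa using h1

/-- A form with no component along the first factor is pulled back from `T`. It suffices to test
`(1, 0)` against vectors of `T`, because a second occurrence of `(1, 0)` gives zero anyway. -/
theorem eq_of_cons_fst {q : ℕ} {φ : (ℕ → ℝ × T) → ℝ} (h : IsAlt q φ)
    (h1 : 0 < q → ∀ v : ℕ → T, φ (scons (1, 0) fun i => (0, v i)) = 0) (X : ℕ → ℝ × T) :
    φ X = φ fun i => (0, (X i).2) := by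
  induction q generalizing φ X with
  | zero => exact h.congr (by simp)
  | succ q ih =>
    have h2 : ∀ u, φ (scons (1, 0) u) = 0 := fun u => by
      -- The contraction with `(1, 0)` again has no component along `(1, 0)`, by alternation, so the
      -- induction hypothesis moves `u` into `T`.
      rw [ih (h.cons (1, 0)) ?_ u]
      · exact h1 (by omega) _
      · intro hq v
        obtain ⟨q, rfl⟩ := Nat.exists_eq_succ_of_ne_zero hq.ne'
        exact h.cons_self _ _
    rw [← scons_eta X]
    generalize X 0 = x
    generalize (fun n => X (n + 1)) = u
    have h3 : φ (scons x u) = φ (scons (0, x.2) u) := by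
      have : x = x.1 • ((1 : ℝ), (0 : T)) + (0, x.2) := by ext <;> simp
      conv_lhs => rw [this]
      rw [h.cons_add, h.cons_smul, h2, mul_zero, zero_add]
    rw [h3, ih (h.cons (0, x.2)) ?_ u, map_scons (fun x : ℝ × T => ((0 : ℝ), x.2))]
    intro hq v
    obtain ⟨q, rfl⟩ := Nat.exists_eq_succ_of_ne_zero hq.ne'
    rw [h.cons_swap, h2, neg_zero]

/-- The three hypotheses kill the components along `dy`, `dz` and `dy ∧ dz`, which leaves only the
one pulled back from `T`. -/
theorem eq_of_cons_fst_snd {q : ℕ} {φ : (ℕ → ℝ × ℝ × T) → ℝ} (h : IsAlt q φ)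
    (h1 : 0 < q → ∀ v : ℕ → T, φ (scons (1, 0, 0) fun i => (0, 0, v i)) = 0)
    (h2 : 0 < q → ∀ v : ℕ → T, φ (scons (0, 1, 0) fun i => (0, 0, v i)) = 0)
    (h3 : 1 < q → ∀ v : ℕ → T, φ (scons (1, 0, 0) (scons (0, 1, 0) fun i => (0, 0, v i))) = 0)
    (X : ℕ → ℝ × ℝ × T) : φ X = φ fun i => (0, 0, (X i).2.2) := by
  rw [h.eq_of_cons_fst ?_ X]
  · refine IsAlt.eq_of_cons_fst (h.comp (ContinuousLinearMap.inr ℝ ℝ (ℝ × T))) ?_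
      fun i => (X i).2
    intro hq v
    have := h2 hq v
    rw [map_scons]
    exact this
  · intro hq u
    obtain ⟨q, rfl⟩ := Nat.exists_eq_succ_of_ne_zero hq.ne'
    refine (IsAlt.eq_of_cons_fst ((h.cons (1, 0, 0)).comp (ContinuousLinearMap.inr ℝ ℝ (ℝ × T))) ?_
      u).trans (h1 (by omega) _)
    intro hq v
    rw [map_scons]
    exact h3 (by omega) v

end IsAlt

/-- The action of a permutation of `{0, …, n - 1}` on the natural numbers. -/
def permExt {n : ℕ} (σ : Equiv.Perm (Fin n)) (i : ℕ) : ℕ := if h : i < n then σ ⟨i, h⟩ else i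

/-- The wedge product for alternating functions of sequences of vectors, where `n = p + q`. -/
noncomputable def seqWedge (n p q : ℕ) (φ ψ : (ℕ → T) → ℝ) (v : ℕ → T) : ℝ :=
  (p.factorial * q.factorial : ℝ)⁻¹ * ∑ σ : Equiv.Perm (Fin n), ((Equiv.Perm.sign σ : ℤ) : ℝ) *
    (φ (fun i => v (permExt σ i)) * ψ (fun j => v (permExt σ (p + j))))

theorem altWedge_eq_seqWedge {p q : ℕ} (a : T [⋀^Fin p]→L[ℝ] ℝ) (b : T [⋀^Fin q]→L[ℝ] ℝ)
    (v : ℕ → T) : altWedge a b (fun i => v i) =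
      seqWedge (p + q) p q (fun u => a fun i => u i) (fun u => b fun i => u i) v := by
  rw [altWedge_apply, seqWedge]
  congr 1
  refine Finset.sum_congr rfl fun σ _ => ?_
  congr 2
  · refine congrArg a (funext fun i => ?_)
    simp only [permExt]
    rw [dif_pos (by omega)]
    rfl
  · refine congrArg b (funext fun i => ?_)
    simp only [permExt]
    rw [dif_pos (by omega)]
    rfl

theorem IsAlt.seqWedge {p q : ℕ} {φ ψ : (ℕ → T) → ℝ} (hφ : IsAlt p φ) (hψ : IsAlt q ψ) :
    IsAlt (p + q) (seqWedge (p + q) p q φ ψ) := by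
  obtain ⟨a, ha⟩ := hφ
  obtain ⟨b, hb⟩ := hψ
  refine ⟨altWedge a b, fun v => ?_⟩
  rw [altWedge_eq_seqWedge, ← funext ha, ← funext hb]

theorem seqWedge_zero_zero (φ ψ : (ℕ → T) → ℝ) (v : ℕ → T) : seqWedge 0 0 0 φ ψ v = φ v * ψ v := by
  simp [seqWedge, permExt]

/-- Permutations of `{0, …, n}`, described by the preimage `k` of `0` and the permutation of the
other elements. -/
def insPerm {n : ℕ} (x : Fin (n + 1) × Equiv.Perm (Fin n)) : Equiv.Perm (Fin (n + 1)) :=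
  Equiv.Perm.decomposeFin.symm (0, x.2) * x.1.cycleRange

theorem insPerm_self {n : ℕ} (k : Fin (n + 1)) (ρ : Equiv.Perm (Fin n)) :
    insPerm (k, ρ) k = 0 := by
  simp [insPerm]

theorem insPerm_succAbove {n : ℕ} (k : Fin (n + 1)) (ρ : Equiv.Perm (Fin n)) (i : Fin n) :
    insPerm (k, ρ) (k.succAbove i) = (ρ i).succ := by
  simp [insPerm]

theorem sign_insPerm {n : ℕ} (k : Fin (n + 1)) (ρ : Equiv.Perm (Fin n)) :
    Equiv.Perm.sign (insPerm (k, ρ)) = (-1) ^ (k : ℕ) * Equiv.Perm.sign ρ := by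
  simp [insPerm, mul_comm]

theorem insPerm_bijective {n : ℕ} : Function.Bijective (insPerm (n := n)) := by
  rw [Fintype.bijective_iff_injective_and_card]
  refine ⟨?_, ?_⟩
  · rintro ⟨k, ρ⟩ ⟨k', ρ'⟩ h
    have hk : k = k' := by
      apply (insPerm (k', ρ')).injective
      rw [← h, insPerm_self, h, insPerm_self]
    subst hk
    refine Prod.ext rfl (Equiv.ext fun i => Fin.succ_injective _ ?_)
    rw [← insPerm_succAbove k, h, insPerm_succAbove]
  · simp [Fintype.card_perm, Nat.factorial_succ]

/-- The permutation `insPerm (k, ρ)` sends `k` to `0`, so the prepended vector reappears in slot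
`k`, and `ρ` arranges the remaining slots. -/
theorem scons_permExt_insPerm {n : ℕ} (k : Fin (n + 1)) (ρ : Equiv.Perm (Fin n)) (X : T)
    (v : ℕ → T) {i : ℕ} (hi : i < n + 1) :
    scons X v (permExt (insPerm (k, ρ)) i) = sins k X (fun i => v (permExt ρ i)) i := by
  simp only [permExt, dif_pos hi]
  rcases Fin.eq_self_or_eq_succAbove k ⟨i, hi⟩ with h | ⟨j, h⟩
  · rw [h, insPerm_self]
    have : i = k := congrArg Fin.val h
    simp [sins, this]
  · rw [h, insPerm_succAbove]
    have hj : i = k.succAbove j := congrArg Fin.val h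
    simp only [Fin.val_succ, scons_succ, sins]
    simp only [Fin.succAbove, Fin.lt_def, Fin.val_castSucc] at hj
    by_cases hjk : (j : ℕ) < k
    · rw [if_pos hjk] at hj
      simp only [Fin.val_castSucc] at hj
      subst hj
      rw [if_pos hjk, dif_pos j.2]
    · rw [if_neg hjk] at hj
      simp only [Fin.val_succ] at hj
      subst hj
      rw [if_neg (by omega), if_neg (by omega), dif_pos (by simp)]
      simp

/-- Interior multiplication is an antiderivation. Permutations are sorted by the slot `k` in which
`X` lands: for `k < p` it enters `φ`, otherwise `ψ`. The conditionals replace the terms in which `p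
- 1` or `q - 1` would truncate. -/
theorem seqWedge_scons {n p q : ℕ} (hn : n + 1 = p + q) {φ ψ : (ℕ → T) → ℝ} (hφ : IsAlt p φ)
    (hψ : IsAlt q ψ) (X : T) (v : ℕ → T) :
    seqWedge (n + 1) p q φ ψ (scons X v) =
      (if p = 0 then 0 else seqWedge n (p - 1) q (fun u => φ (scons X u)) ψ v) +
      (-1) ^ p * (if q = 0 then 0 else seqWedge n p (q - 1) φ (fun u => ψ (scons X u)) v) := by
  set A : ℝ := ∑ ρ : Equiv.Perm (Fin n), ((Equiv.Perm.sign ρ : ℤ) : ℝ) *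
    (φ (scons X fun i => v (permExt ρ i)) * ψ (fun j => v (permExt ρ (p - 1 + j)))) with hA
  set B : ℝ := ∑ ρ : Equiv.Perm (Fin n), ((Equiv.Perm.sign ρ : ℤ) : ℝ) *
    (φ (fun i => v (permExt ρ i)) * ψ (scons X fun j => v (permExt ρ (p + j)))) with hB
  have key : ∀ k : Fin (n + 1), ∀ ρ : Equiv.Perm (Fin n),
      ((Equiv.Perm.sign (insPerm (k, ρ)) : ℤ) : ℝ) *
        (φ (fun i => scons X v (permExt (insPerm (k, ρ)) i)) *
          ψ (fun j => scons X v (permExt (insPerm (k, ρ)) (p + j)))) =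
      if (k : ℕ) < p then ((Equiv.Perm.sign ρ : ℤ) : ℝ) *
        (φ (scons X fun i => v (permExt ρ i)) * ψ (fun j => v (permExt ρ (p - 1 + j))))
      else (-1) ^ p * (((Equiv.Perm.sign ρ : ℤ) : ℝ) *
        (φ (fun i => v (permExt ρ i)) * ψ (scons X fun j => v (permExt ρ (p + j))))) := by
    intro k ρ
    have hs : ((Equiv.Perm.sign (insPerm (k, ρ)) : ℤ) : ℝ) =
        (-1) ^ (k : ℕ) * ((Equiv.Perm.sign ρ : ℤ) : ℝ) := by
      rw [sign_insPerm]; push_cast; rfl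
    have e1 : φ (fun i => scons X v (permExt (insPerm (k, ρ)) i)) =
        φ (sins k X fun i => v (permExt ρ i)) :=
      hφ.congr fun i hi => scons_permExt_insPerm k ρ X v (by omega)
    have e2 : ψ (fun j => scons X v (permExt (insPerm (k, ρ)) (p + j))) =
        ψ fun j => sins k X (fun i => v (permExt ρ i)) (p + j) :=
      hψ.congr fun j hj => scons_permExt_insPerm k ρ X v (by omega)
    have hk2 : ((-1 : ℝ) ^ (k : ℕ)) * (-1) ^ (k : ℕ) = 1 := by
      rw [← pow_add, Even.neg_one_pow ⟨_, rfl⟩]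
    rw [hs, e1, e2]
    split_ifs with hkp
    -- Here `X` enters `φ`; moving it to the front gives `(-1) ^ k`, which cancels the sign of the
    -- insertion.
    · obtain ⟨p, rfl⟩ := Nat.exists_eq_succ_of_ne_zero (show p ≠ 0 by omega)
      have e3 : (fun j => sins k X (fun i => v (permExt ρ i)) (p.succ + j)) =
          fun j => v (permExt ρ (p.succ - 1 + j)) := by
        funext j
        simp only [sins]
        rw [if_neg (by omega), if_neg (by omega)]
        congr 2
        omega
      rw [hφ.sins_eq (by omega), e3]
      linear_combination ((Equiv.Perm.sign ρ : ℤ) : ℝ) *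
        (φ (scons X fun i => v (permExt ρ i)) * ψ (fun j => v (permExt ρ (p.succ - 1 + j)))) * hk2
    · obtain ⟨q, rfl⟩ := Nat.exists_eq_succ_of_ne_zero (show q ≠ 0 by omega)
      -- Here `X` enters `ψ` at its slot `m = k - p`; moving it to the front cancels `(-1) ^ m` and
      -- leaves `(-1) ^ p`.
      obtain ⟨m, hm⟩ := Nat.exists_eq_add_of_le (show p ≤ k by omega)
      have e3 : (fun j => sins k X (fun i => v (permExt ρ i)) (p + j)) =
          sins m X fun j => v (permExt ρ (p + j)) := by
        funext j
        simp only [sins, hm]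
        by_cases h1 : j < m
        · simp [h1]
        · by_cases h2 : j = m
          · simp [h2]
          · simp only [add_lt_add_iff_left, h1, if_false, add_right_inj, h2]
            congr 2
            omega
      have e4 : φ (sins k X fun i => v (permExt ρ i)) = φ fun i => v (permExt ρ i) :=
        hφ.congr fun i hi => by simp [sins, show i < (k : ℕ) by omega]
      have hm2 : ((-1 : ℝ) ^ m) * (-1) ^ m = 1 := by
        rw [← pow_add, Even.neg_one_pow ⟨_, rfl⟩]
      rw [e4, e3, hψ.sins_eq (by omega), hm, pow_add]
      linear_combination (-1 : ℝ) ^ p * ((Equiv.Perm.sign ρ : ℤ) : ℝ) *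
        (φ (fun i => v (permExt ρ i)) * ψ (scons X fun j => v (permExt ρ (p + j)))) * hm2
  have hsum : ∑ σ : Equiv.Perm (Fin (n + 1)), ((Equiv.Perm.sign σ : ℤ) : ℝ) *
      (φ (fun i => scons X v (permExt σ i)) * ψ (fun j => scons X v (permExt σ (p + j)))) =
      p * A + (-1) ^ p * (q * B) := by
    rw [← insPerm_bijective.sum_comp, Fintype.sum_prod_type]
    have h1 : ∀ k : Fin (n + 1), ∑ ρ : Equiv.Perm (Fin n),
        ((Equiv.Perm.sign (insPerm (k, ρ)) : ℤ) : ℝ) *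
        (φ (fun i => scons X v (permExt (insPerm (k, ρ)) i)) *
          ψ (fun j => scons X v (permExt (insPerm (k, ρ)) (p + j)))) =
        (fun k : ℕ => if k < p then A else (-1) ^ p * B) k := by
      intro k
      rw [Finset.sum_congr rfl fun ρ _ => key k ρ]
      simp only
      split_ifs
      · rfl
      · rw [hB, Finset.mul_sum]
    rw [Finset.sum_congr rfl fun k _ => h1 k,
      Fin.sum_univ_eq_sum_range (fun k => if k < p then A else (-1) ^ p * B) (n + 1), hn,
      Finset.sum_range_add,
      Finset.sum_congr (g := fun _ => A) rfl fun k hk => if_pos (Finset.mem_range.1 hk),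
      Finset.sum_congr (g := fun _ => (-1) ^ p * B) rfl fun k _ => if_neg (by omega)]
    simp
    ring
  rw [seqWedge, hsum]
  -- The `p` slots of `φ` contribute equally, and so do the `q` slots of `ψ`; these factors turn
  -- `p!` and `q!` into `(p - 1)!` and `(q - 1)!`.
  rcases p with _ | p <;> rcases q with _ | q
  · omega
  · simp [seqWedge, Nat.factorial_succ, hB]
    field_simp
  · simp [seqWedge, Nat.factorial_succ, hA]
    field_simp
  · simp [seqWedge, Nat.factorial_succ, hA, hB]
    field_simp
end

/-! ### Smooth `ℝⁿ`-valued one-forms on vector spaces, and families that depend on them -/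

section
variable (n : ℕ) (E : Type*) [NormedAddCommGroup E] [NormedSpace ℝ E]

/-- Smooth `ℝⁿ`-valued one-forms on a normed space. -/
def SF : Submodule ℝ (E → E →L[ℝ] (Fin n → ℝ)) where
  carrier := {g | ContDiff ℝ ∞ g}
  zero_mem' := contDiff_const (𝕜 := ℝ) (n := ∞) (c := (0 : E →L[ℝ] (Fin n → ℝ)))
  add_mem' := fun {f g} (hf : ContDiff ℝ ∞ f) (hg : ContDiff ℝ ∞ g) => hf.add hg
  smul_mem' := fun _ f (hf : ContDiff ℝ ∞ f) => contDiff_const.smul hf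
end

namespace SF
variable {n : ℕ} {E E' E'' : Type*} [NormedAddCommGroup E] [NormedSpace ℝ E]
  [NormedAddCommGroup E'] [NormedSpace ℝ E'] [NormedAddCommGroup E''] [NormedSpace ℝ E'']

theorem contDiff (g : SF n E) : ContDiff ℝ ∞ g.1 := g.2

/-- Pullback of one-forms along a smooth map. -/
noncomputable def pull (f : E → E') (hf : ContDiff ℝ ∞ f) (g : SF n E') : SF n E :=
  ⟨fun x => (g.1 (f x)).comp (fderiv ℝ f x),
    ((contDiff g).comp hf).clm_comp (hf.fderiv_right (m := ∞) (by simp))⟩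

/-- The one-form `y dz`, in the direction of the basis vector with index `a`. -/
noncomputable def form (a : Fin n) (y z : E → ℝ) (hy : ContDiff ℝ ∞ y) (hz : ContDiff ℝ ∞ z) :
    SF n E :=
  ⟨fun x => y x • (fderiv ℝ z x).smulRight (Pi.single a 1),
    hy.smul ((hz.fderiv_right (m := ∞) (by simp)).smulRight contDiff_const)⟩

theorem pull_add (f : E → E') (hf : ContDiff ℝ ∞ f) (g g' : SF n E') :
    pull f hf (g + g') = pull f hf g + pull f hf g' :=
  Subtype.ext <| funext fun _ => ContinuousLinearMap.add_comp _ _ _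

theorem pull_pull (f : E → E') (hf : ContDiff ℝ ∞ f) (h : E' → E'') (hh : ContDiff ℝ ∞ h)
    (g : SF n E'') : pull f hf (pull h hh g) = pull (fun x => h (f x)) (hh.comp hf) g := by
  refine Subtype.ext <| funext fun x => ?_
  have := fderiv_comp x (hh.differentiable (by simp) (f x)) (hf.differentiable (by simp) x)
  change ((g.1 (h (f x))).comp (fderiv ℝ h (f x))).comp (fderiv ℝ f x) =
    (g.1 (h (f x))).comp (fderiv ℝ (h ∘ f) x)
  rw [this]
  rfl

theorem pull_id (g : SF n E) : pull (fun x => x) contDiff_id g = g := by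
  refine Subtype.ext <| funext fun x => ?_
  change (g.1 x).comp (fderiv ℝ (fun x => x) x) = _
  rw [fderiv_fun_id]
  rfl

theorem pull_form (a : Fin n) (f : E → E') (hf : ContDiff ℝ ∞ f) (y z : E' → ℝ)
    (hy : ContDiff ℝ ∞ y) (hz : ContDiff ℝ ∞ z) :
    pull f hf (form a y z hy hz) =
      form a (fun x => y (f x)) (fun x => z (f x)) (hy.comp hf) (hz.comp hf) := by
  refine Subtype.ext <| funext fun x => ?_
  have := fderiv_comp x (hz.differentiable (by simp) (f x)) (hf.differentiable (by simp) x)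
  change (y (f x) • (fderiv ℝ z (f x)).smulRight (Pi.single a 1)).comp (fderiv ℝ f x) =
    y (f x) • (fderiv ℝ (z ∘ f) x).smulRight (Pi.single a 1)
  rw [this]
  rfl

theorem form_const (a : Fin n) (y : E → ℝ) (c : ℝ) (hy : ContDiff ℝ ∞ y) :
    form a y (fun _ => c) hy contDiff_const = 0 := by
  refine Subtype.ext <| funext fun x => ?_
  change y x • (fderiv ℝ (fun _ => c) x).smulRight (Pi.single a (1 : ℝ) : Fin n → ℝ) = 0
  rw [fderiv_fun_const]
  ext
  simp

/-- This freedom to move a constant between coefficient and coordinate is behind the scaling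
arguments for `y dz`. -/
theorem form_smul (a : Fin n) (y z : E → ℝ) (hy : ContDiff ℝ ∞ y) (hz : ContDiff ℝ ∞ z) (c : ℝ) :
    form a y (fun x => c * z x) hy (contDiff_const.mul hz) =
      form a (fun x => c * y x) z (contDiff_const.mul hy) hz := by
  refine Subtype.ext <| funext fun x => ?_
  change y x • (fderiv ℝ (fun x => c * z x) x).smulRight (Pi.single a (1 : ℝ) : Fin n → ℝ) =
    (c * y x) • (fderiv ℝ z x).smulRight (Pi.single a (1 : ℝ) : Fin n → ℝ)
  rw [fderiv_const_mul (hz.differentiable (by simp) x)]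
  ext
  simp
  ring

theorem form_congr (a : Fin n) {y z y' z' : E → ℝ} {hy : ContDiff ℝ ∞ y} {hz : ContDiff ℝ ∞ z}
    {hy' : ContDiff ℝ ∞ y'} {hz' : ContDiff ℝ ∞ z'} (h1 : ∀ x, y x = y' x) (h2 : ∀ x, z x = z' x) :
    form a y z hy hz = form a y' z' hy' hz' := by
  obtain rfl := funext h1
  obtain rfl := funext h2
  rfl

theorem pull_congr {f f' : E → E'} {hf : ContDiff ℝ ∞ f} {hf' : ContDiff ℝ ∞ f'} (g : SF n E')
    (h : ∀ x, f x = f' x) : pull f hf g = pull f' hf' g := by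
  obtain rfl := funext h
  rfl

/-- The one-form `g + dt` on `ℝ × E`, where `dt` goes in the direction with index `a`. -/
noncomputable def ext1 (a : Fin n) (g : SF n E) : SF n (ℝ × E) :=
  pull Prod.snd contDiff_snd g + form a (fun _ => 1) Prod.fst contDiff_const contDiff_fst

/-- The one-form `g + y dz` on `ℝ × ℝ × E`, where `y dz` goes in the direction with index `a`. -/
noncomputable def ext2 (a : Fin n) (g : SF n E) : SF n (ℝ × ℝ × E) :=
  pull (fun x => x.2.2) (contDiff_snd.comp contDiff_snd) g +
    form a Prod.fst (fun x => x.2.1) contDiff_fst (contDiff_fst.comp contDiff_snd)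

theorem pull_ext1 (a : Fin n) (g : SF n E') (f : E → ℝ × E') (hf : ContDiff ℝ ∞ f) :
    pull f hf (ext1 a g) = pull (fun x => (f x).2) hf.snd g +
      form a (fun _ => 1) (fun x => (f x).1) contDiff_const hf.fst := by
  rw [ext1, pull_add, pull_pull, pull_form]

theorem pull_ext2 (a : Fin n) (g : SF n E') (f : E → ℝ × ℝ × E') (hf : ContDiff ℝ ∞ f) :
    pull f hf (ext2 a g) = pull (fun x => (f x).2.2) hf.snd.snd g +
      form a (fun x => (f x).1) (fun x => (f x).2.1) hf.fst hf.snd.fst := by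
  rw [ext2, pull_add, pull_pull, pull_form]

end SF

/-- Families of functions that evaluate something of the nature of a differential form, depending on
a one-form on a vector space, at a point on a sequence of tangent vectors. -/
def Fam (n : ℕ) := ∀ (E : Type) [NormedAddCommGroup E] [NormedSpace ℝ E] [FiniteDimensional ℝ E],
  SF n E → E → (ℕ → E) → ℝ

namespace Fam
variable {n : ℕ}

@[ext] theorem ext {F G : Fam n} (h : ∀ (E : Type) [NormedAddCommGroup E] [NormedSpace ℝ E]
    [FiniteDimensional ℝ E] (g : SF n E) (x : E) (v : ℕ → E), F E g x v = G E g x v) : F = G := by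
  funext E _ _ _ g x v
  exact h E g x v

noncomputable instance : Add (Fam n) where
  add F G := fun E _ _ _ g x v => F E g x v + G E g x v

noncomputable instance : Zero (Fam n) where
  zero := fun _ _ _ _ _ _ _ => 0

noncomputable instance : Neg (Fam n) where
  neg F := fun E _ _ _ g x v => -F E g x v

noncomputable instance : AddCommGroup (Fam n) where
  nsmul := nsmulRec
  zsmul := zsmulRec
  add_assoc F G H := ext fun E _ _ _ g x v => add_assoc (F E g x v) (G E g x v) (H E g x v)
  zero_add F := ext fun E _ _ _ g x v => zero_add (F E g x v)
  add_zero F := ext fun E _ _ _ g x v => add_zero (F E g x v)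
  neg_add_cancel F := ext fun E _ _ _ g x v => neg_add_cancel (F E g x v)
  add_comm F G := ext fun E _ _ _ g x v => add_comm (F E g x v) (G E g x v)

noncomputable instance : Module ℝ (Fam n) where
  smul r F := fun E _ _ _ g x v => r * F E g x v
  one_smul F := ext fun E _ _ _ g x v => one_mul (F E g x v)
  mul_smul r s F := ext fun E _ _ _ g x v => mul_assoc r s (F E g x v)
  smul_zero r := ext fun _ _ _ _ _ _ _ => mul_zero r
  smul_add r F G := ext fun E _ _ _ g x v => mul_add r (F E g x v) (G E g x v)
  add_smul r s F := ext fun E _ _ _ g x v => add_mul r s (F E g x v)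
  zero_smul F := ext fun E _ _ _ g x v => zero_mul (F E g x v)

end Fam

/-- The families that come from natural `q`-forms on vector spaces. -/
structure IsNat {n : ℕ} (q : ℕ) (F : Fam n) : Prop where
  alt : ∀ (E : Type) [NormedAddCommGroup E] [NormedSpace ℝ E] [FiniteDimensional ℝ E]
    (g : SF n E) (x : E), IsAlt q (F E g x)
  smooth : ∀ (E : Type) [NormedAddCommGroup E] [NormedSpace ℝ E] [FiniteDimensional ℝ E]
    (g : SF n E) (v : ℕ → E), ContDiff ℝ ∞ fun x => F E g x v
  nat : ∀ (E E' : Type) [NormedAddCommGroup E] [NormedSpace ℝ E] [FiniteDimensional ℝ E]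
    [NormedAddCommGroup E'] [NormedSpace ℝ E'] [FiniteDimensional ℝ E'] (f : E → E')
    (hf : ContDiff ℝ ∞ f) (g : SF n E') (x : E) (v : ℕ → E),
    F E (SF.pull f hf g) x v = F E' g (f x) fun i => fderiv ℝ f x (v i)

namespace Fam
variable {n : ℕ}

/-- Contraction with an additional variable `t`, where `dt` is added to the argument. -/
noncomputable def contr (a : Fin n) (F : Fam n) : Fam n := fun E _ _ _ g x v =>
  F (ℝ × E) (SF.ext1 a g) (0, x) (scons (1, 0) fun i => (0, v i))

/-- Contraction with two additional variables `y` and `z`, where `y dz` is added to the argument. -/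
noncomputable def contrT (a : Fin n) (F : Fam n) : Fam n := fun E _ _ _ g x v =>
  F (ℝ × ℝ × E) (SF.ext2 a g) (0, 0, x) (scons (1, 0, 0) (scons (0, 1, 0) fun i => (0, 0, v i)))

/-- The wedge product. -/
noncomputable def wedge (p q : ℕ) (F G : Fam n) : Fam n := fun E _ _ _ g x =>
  seqWedge (p + q) p q (F E g x) (G E g x)

end Fam

section
variable {T : Type*}
/-- Remove the entry at position `i` of a sequence. -/
def srem (i : ℕ) (v : ℕ → T) : ℕ → T := fun j => if j < i then v j else v (j + 1)

theorem srem_zero_scons (X : T) (v : ℕ → T) : srem 0 (scons X v) = v := by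
  funext j; simp [srem]

theorem srem_succ_scons (i : ℕ) (X : T) (v : ℕ → T) :
    srem (i + 1) (scons X v) = scons X (srem i v) := by
  funext j
  cases j <;> simp [srem]

theorem map_srem {S : Type*} (f : T → S) (i : ℕ) (v : ℕ → T) :
    (fun j => f (srem i v j)) = srem i fun j => f (v j) := by
  funext j; simp only [srem]; split_ifs <;> rfl
end

/-- The exterior derivative. -/
noncomputable def Fam.D {n : ℕ} (q : ℕ) (F : Fam n) : Fam n := fun E _ _ _ g x v =>
  ∑ i ∈ Finset.range (q + 1), (-1) ^ i * fderiv ℝ (fun y => F E g y (srem i v)) x (v i)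

/-! ### The vanishing criterion for natural families -/

namespace IsNat
variable {n q : ℕ} {F G : Fam n} {E E' : Type} [NormedAddCommGroup E] [NormedSpace ℝ E]
  [FiniteDimensional ℝ E] [NormedAddCommGroup E'] [NormedSpace ℝ E'] [FiniteDimensional ℝ E']

/-- Naturality with the pulled back form, the image point and the image vectors left free up to
equations, so that each symmetry is applied by naming a map. -/
theorem transfer (hF : IsNat q F) (f : E → E') (hf : ContDiff ℝ ∞ f) {g : SF n E} {g' : SF n E'}
    (hg : SF.pull f hf g' = g) {x : E} {y : E'} (hxy : f x = y) {L : E →L[ℝ] E'}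
    (hL : HasFDerivAt f L x) {v : ℕ → E} {w : ℕ → E'} (hv : ∀ i, L (v i) = w i) :
    F E g x v = F E' g' y w := by
  rw [← hg, hF.nat, hL.fderiv, hxy, funext hv]

theorem transfer_affine (hF : IsNat q F) (L : E →L[ℝ] E') (c : E') {g : SF n E} {g' : SF n E'}
    (hg : SF.pull (fun x => L x + c) (L.contDiff.add contDiff_const) g' = g) {x : E} {y : E'}
    (hxy : L x + c = y) {v : ℕ → E} {w : ℕ → E'} (hv : ∀ i, L (v i) = w i) :
    F E g x v = F E' g' y w :=
  hF.transfer _ _ hg hxy (L.hasFDerivAt.add_const c) hv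

/-- The projection to `E` kills `∂_t`. -/
theorem pull_snd_cons (hF : IsNat (q + 1) F) (g : SF n E) (x : ℝ × E) (v : ℕ → E) :
    F (ℝ × E) (SF.pull Prod.snd contDiff_snd g) x (scons (1, 0) fun i => (0, v i)) = 0 := by
  rw [hF.transfer Prod.snd contDiff_snd rfl rfl hasFDerivAt_snd (w := scons 0 v) fun i => by
    cases i <;> rfl]
  exact (hF.alt E g x.2).cons_zero v

/-- On a slice `t = const` the form `dt` restricts to zero. -/
theorem ext1_inr (hF : IsNat q F) (a : Fin n) (g : SF n E) (t : ℝ) (x : E) (v : ℕ → E) :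
    F (ℝ × E) (SF.ext1 a g) (t, x) (fun i => (0, v i)) = F E g x v := by
  refine (hF.transfer_affine (ContinuousLinearMap.inr ℝ ℝ E) (t, 0) ?_ (by simp)
    fun i => by simp).symm
  rw [SF.pull_ext1, SF.form_congr (z' := fun _ => t) (hy' := contDiff_const) (hz' := contDiff_const)
    a (fun _ => rfl) (fun x => by simp), SF.form_const, add_zero]
  exact (SF.pull_congr g fun x => by simp).trans (SF.pull_id g)

/-- On a slice with `y` and `z` constant the form `y dz` restricts to zero. -/
theorem ext2_inr (hF : IsNat q F) (a : Fin n) (g : SF n E) (y z : ℝ) (x : E) (v : ℕ → E) :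
    F (ℝ × ℝ × E) (SF.ext2 a g) (y, z, x) (fun i => (0, 0, v i)) = F E g x v := by
  refine (hF.transfer_affine ((ContinuousLinearMap.inr ℝ ℝ (ℝ × E)).comp
    (ContinuousLinearMap.inr ℝ ℝ E)) (y, z, 0) ?_ (by simp) fun i => by simp).symm
  rw [SF.pull_ext2, SF.form_congr (z' := fun _ => z) (y' := fun _ => y) (hy' := contDiff_const)
    (hz' := contDiff_const) a (fun _ => by simp) (fun x => by simp), SF.form_const, add_zero]
  exact (SF.pull_congr g fun x => by simp).trans (SF.pull_id g)

/-- The form `g + dt` is invariant under translation in `t`. -/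
theorem ext1_translate (hF : IsNat q F) (a : Fin n) (g : SF n E) (t : ℝ) (x : E) (v : ℕ → ℝ × E) :
    F (ℝ × E) (SF.ext1 a g) (t, x) v = F (ℝ × E) (SF.ext1 a g) (0, x) v := by
  refine (hF.transfer_affine (ContinuousLinearMap.id ℝ (ℝ × E)) (t, 0) ?_ (by simp)
    fun i => by simp).symm
  rw [SF.pull_ext1, SF.ext1]
  congr 1
  · exact SF.pull_congr g fun x => by simp
  · refine Subtype.ext <| funext fun x => ?_
    simp [SF.form]

/-- On the slice `z = const` the form `y dz` vanishes, so the argument is pulled back from `E` and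
`∂_y` contracts to zero. -/
theorem ext2_cons_fst (hF : IsNat (q + 1) F) (a : Fin n) (g : SF n E) (y z : ℝ) (x : E)
    (v : ℕ → E) :
    F (ℝ × ℝ × E) (SF.ext2 a g) (y, z, x) (scons (1, 0, 0) fun i => (0, 0, v i)) = 0 := by
  refine Eq.trans (hF.transfer_affine ((ContinuousLinearMap.fst ℝ ℝ E).prod
    ((0 : ℝ × E →L[ℝ] ℝ).prod (ContinuousLinearMap.snd ℝ ℝ E))) (0, z, 0)
    (g := SF.pull Prod.snd contDiff_snd g) (x := (y, x)) (v := scons (1, 0) fun i => (0, v i))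
    ?_ (by simp) fun i => ?_).symm (hF.pull_snd_cons g (y, x) v)
  · rw [SF.pull_ext2, SF.form_congr (z' := fun _ => z) (y' := fun x => x.1) (hy' := contDiff_fst)
      (hz' := contDiff_const) a (fun _ => by simp) (fun x => by simp), SF.form_const, add_zero]
    exact SF.pull_congr g fun x => by simp
  · cases i <;> simp

/-- On the slice with constant `y`, the argument `g + y dz` is the pullback of `g + dt` along `t = y
z`, which sends `∂_z` to `y ∂_t`. The slice is `h1` and the rescaling is `h2`; `y = 0` is allowed.
-/
theorem ext2_cons_snd (hF : IsNat (q + 1) F) (a : Fin n) (g : SF n E) (y z : ℝ) (x : E)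
    (v : ℕ → E) :
    F (ℝ × ℝ × E) (SF.ext2 a g) (y, z, x) (scons (0, 1, 0) fun i => (0, 0, v i)) =
      y * Fam.contr a F E g x v := by
  have h1 : F (ℝ × E) (SF.pull Prod.snd contDiff_snd g +
      SF.form a (fun _ => y) (fun x => x.1) contDiff_const contDiff_fst) (z, x)
      (scons (1, 0) fun i => (0, v i)) =
      F (ℝ × ℝ × E) (SF.ext2 a g) (y, z, x) (scons (0, 1, 0) fun i => (0, 0, v i)) := by
    refine hF.transfer_affine (ContinuousLinearMap.inr ℝ ℝ (ℝ × E)) (y, 0, 0) ?_ (by simp)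
      fun i => ?_
    · rw [SF.pull_ext2]
      congr 1
      · exact SF.pull_congr g fun x => by simp
      · exact SF.form_congr a (fun x => by simp) (fun x => by simp)
    · cases i <;> simp
  have h2 : F (ℝ × E) (SF.pull Prod.snd contDiff_snd g +
      SF.form a (fun _ => y) (fun x => x.1) contDiff_const contDiff_fst) (z, x)
      (scons (1, 0) fun i => (0, v i)) =
      F (ℝ × E) (SF.ext1 a g) (y * z, x) (scons (y • (1, 0)) fun i => (0, v i)) := by
    refine hF.transfer_affine ((y • ContinuousLinearMap.fst ℝ ℝ E).prod
      (ContinuousLinearMap.snd ℝ ℝ E)) (0, 0) ?_ (by simp) fun i => ?_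
    · rw [SF.pull_ext1]
      congr 1
      · exact SF.pull_congr g fun x => by simp
      · rw [SF.form_congr (y' := fun _ => 1) (z' := fun x => y * x.1) (hy' := contDiff_const)
          (hz' := by fun_prop) a (fun x => by simp) (fun x => by simp),
          SF.form_smul a _ _ _ contDiff_fst]
        exact SF.form_congr a (fun x => by simp) (fun x => by simp)
    · cases i <;> simp
  rw [← h1, h2, (hF.alt _ _ _).cons_smul, hF.ext1_translate]
  rfl

/-- The `dy ∧ dz` component is independent of `y` and `z`: translation in `z` and the scaling `(c y,
c⁻¹ z)` preserve `y dz`, and the scaling also preserves `dy ∧ dz`. Letting `c` tend to zero moves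
`y` to the origin. -/
theorem ext2_cons_cons (hF : IsNat (q + 2) F) (a : Fin n) (g : SF n E) (y z : ℝ) (x : E)
    (v : ℕ → E) :
    F (ℝ × ℝ × E) (SF.ext2 a g) (y, z, x) (scons (1, 0, 0) (scons (0, 1, 0) fun i => (0, 0, v i))) =
      Fam.contrT a F E g x v := by
  set u : ℕ → ℝ × ℝ × E := fun i => (0, 0, v i) with hu
  have hz : F (ℝ × ℝ × E) (SF.ext2 a g) (y, z, x) (scons (1, 0, 0) (scons (0, 1, 0) u)) =
      F (ℝ × ℝ × E) (SF.ext2 a g) (y, 0, x) (scons (1, 0, 0) (scons (0, 1, 0) u)) := by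
    refine (hF.transfer_affine (ContinuousLinearMap.id ℝ (ℝ × ℝ × E)) (0, z, 0) ?_ (by simp)
      fun i => by simp).symm
    rw [SF.pull_ext2, SF.ext2]
    congr 1
    · exact SF.pull_congr g fun x => by simp
    · refine Subtype.ext <| funext fun x => ?_
      simp [SF.form]
  rw [hz]
  have hc : ∀ c : ℝ, c ≠ 0 →
      F (ℝ × ℝ × E) (SF.ext2 a g) (y, 0, x) (scons (1, 0, 0) (scons (0, 1, 0) u)) =
      F (ℝ × ℝ × E) (SF.ext2 a g) (c * y, 0, x) (scons (1, 0, 0) (scons (0, 1, 0) u)) := by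
    intro c hc
    have h1 : F (ℝ × ℝ × E) (SF.ext2 a g) (y, 0, x) (scons (1, 0, 0) (scons (0, 1, 0) u)) =
      F (ℝ × ℝ × E) (SF.ext2 a g) (c * y, 0, x)
        (scons (c • (1, 0, 0)) (scons (c⁻¹ • (0, 1, 0)) u)) := by
      refine hF.transfer_affine ((c • ContinuousLinearMap.fst ℝ ℝ (ℝ × E)).prod
        ((c⁻¹ • (ContinuousLinearMap.fst ℝ ℝ E).comp (ContinuousLinearMap.snd ℝ ℝ (ℝ × E))).prod
        ((ContinuousLinearMap.snd ℝ ℝ E).comp (ContinuousLinearMap.snd ℝ ℝ (ℝ × E))))) 0 ?_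
        (by simp) fun i => ?_
      · rw [SF.pull_ext2, SF.ext2]
        congr 1
        · exact SF.pull_congr g fun x => by simp
        · rw [SF.form_congr (y' := fun x => c * x.1) (z' := fun x => c⁻¹ * x.2.1)
            (hy' := by fun_prop) (hz' := by fun_prop) a (fun x => by simp)
            (fun x => by simp), SF.form_smul a _ (fun x : ℝ × ℝ × E => x.2.1) _ (contDiff_fst.comp contDiff_snd)]
          exact SF.form_congr a (fun x => by field_simp) (fun x => by simp)
      · rcases i with _ | _ | i <;> simp [hu]
    rw [h1, (hF.alt _ _ _).cons_smul, ((hF.alt _ _ _).cons _).cons_smul, ← mul_assoc,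
      mul_inv_cancel₀ hc, one_mul]
  -- The scaling is invertible only for `c ≠ 0`; smoothness in the base point gives the value at `c
  -- = 0` as a limit of equal values.
  have hcont : Continuous fun c : ℝ =>
      F (ℝ × ℝ × E) (SF.ext2 a g) (c * y, 0, x) (scons (1, 0, 0) (scons (0, 1, 0) u)) :=
    (hF.smooth _ (SF.ext2 a g) (scons (1, 0, 0) (scons (0, 1, 0) u))).continuous.comp
      (f := fun c : ℝ => (c * y, (0 : ℝ), x)) (by fun_prop)
  have h0 := (hcont.tendsto 0).mono_left (nhdsWithin_le_nhds (s := {0}ᶜ))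
  have h1 := (tendsto_const_nhds (f := 𝓝[≠] (0 : ℝ))
    (x := F (ℝ × ℝ × E) (SF.ext2 a g) (y, 0, x) (scons (1, 0, 0) (scons (0, 1, 0) u)))).congr'
    (eventually_nhdsWithin_of_forall (s := {(0 : ℝ)}ᶜ) fun c hc' => hc c hc')
  rw [tendsto_nhds_unique h1 h0, zero_mul]
  rfl

/-- The argument is the pullback of `SF.ext2 a g` along the graph `x ↦ (y x, z x, x)`. Upstairs the
components along `dy`, `dz` and `dy ∧ dz` all vanish, so only the value at `g` remains. The guard on
`h2` is there because `Fam.contrT` has meaning only from degree two on. -/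
theorem add_form (hF : IsNat (q + 1) F) (h1 : ∀ a, Fam.contr a F = 0)
    (h2 : ∀ a, 1 < q + 1 → Fam.contrT a F = 0) (a : Fin n) (g : SF n E)
    (y z : E → ℝ) (hy : ContDiff ℝ ∞ y) (hz : ContDiff ℝ ∞ z) (x : E) (v : ℕ → E) :
    F E (g + SF.form a y z hy hz) x v = F E g x v := by
  have hdy := (hy.differentiable (by simp) x).hasFDerivAt
  have hdz := (hz.differentiable (by simp) x).hasFDerivAt
  rw [hF.transfer (fun x => (y x, z x, x)) (hy.prodMk (hz.prodMk contDiff_id)) (g' := SF.ext2 a g) ?_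
    rfl (hdy.prodMk (hdz.prodMk (hasFDerivAt_id x))) fun i => rfl]
  · refine ((hF.alt _ _ _).eq_of_cons_fst_snd ?_ ?_ ?_ _).trans (hF.ext2_inr a g _ _ x _)
    · exact fun _ v => hF.ext2_cons_fst a g _ _ _ v
    · intro _ v
      rw [hF.ext2_cons_snd, h1]
      exact mul_zero _
    · intro hq v
      obtain ⟨q, rfl⟩ := Nat.exists_eq_succ_of_ne_zero (show q ≠ 0 by omega)
      rw [hF.ext2_cons_cons, h2 a hq]
      rfl
  · rw [SF.pull_ext2, SF.pull_id]

theorem eq_zero (hF : IsNat (q + 1) F) (h1 : ∀ a, Fam.contr a F = 0)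
    (h2 : ∀ a, 1 < q + 1 → Fam.contrT a F = 0) :
    F = 0 := by
  ext E _ _ _ g x v
  change F E g x v = 0
  let b := Module.finBasis ℝ E
  let z : Fin (Module.finrank ℝ E) → E →L[ℝ] ℝ := fun j => LinearMap.toContinuousLinearMap (b.coord j)
  have hy : ∀ c : Fin n × Fin (Module.finrank ℝ E), ContDiff ℝ ∞ fun x => g.1 x (b c.2) c.1 :=
    fun c => contDiff_pi.1 ((SF.contDiff g).clm_apply contDiff_const) c.1
  -- Linear coordinates `z_j` on `E` write `g` as a finite sum of terms `g_{a j} dz_j e_a`, to be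
  -- removed one at a time.
  have hg : g = ∑ c : Fin n × Fin (Module.finrank ℝ E),
      SF.form c.1 (fun x => g.1 x (b c.2) c.1) (fun x => z c.2 x) (hy c) (z c.2).contDiff := by
    refine Subtype.ext <| funext fun x => ContinuousLinearMap.ext fun v => funext fun a => ?_
    rw [AddSubmonoidClass.coe_finsetSum, Finset.sum_apply, _root_.sum_apply,
      Finset.sum_apply, Fintype.sum_prod_type]
    simp only [SF.form, ContinuousLinearMap.fderiv, _root_.smul_apply,
      ContinuousLinearMap.smulRight_apply, Pi.smul_apply, smul_eq_mul, Pi.single_apply, mul_ite,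
      mul_one, mul_zero]
    rw [Finset.sum_comm]
    simp only [Finset.sum_ite_eq, Finset.mem_univ, if_true]
    conv_lhs => rw [← b.sum_repr v]
    simp only [map_sum, map_smul, Finset.sum_apply, Pi.smul_apply, smul_eq_mul]
    exact Finset.sum_congr rfl fun j _ => mul_comm _ _
  have hs : ∀ s : Finset (Fin n × Fin (Module.finrank ℝ E)), F E (∑ c ∈ s,
      SF.form c.1 (fun x => g.1 x (b c.2) c.1) (fun x => z c.2 x) (hy c) (z c.2).contDiff) x v =
      F E 0 x v := by
    intro s
    induction s using Finset.induction_on with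
    | empty => rw [Finset.sum_empty]
    | insert c s hc ih => rw [Finset.sum_insert hc, add_comm, hF.add_form h1 h2, ih]
  -- The zero form is its own pullback along a constant map, whose differential kills every vector.
  rw [hg, hs, hF.transfer (fun _ => (0 : E)) contDiff_const (g' := 0) ?_ rfl
    (hasFDerivAt_const _ _) (w := scons 0 0) fun i => by cases i <;> rfl]
  · exact (hF.alt E 0 0).cons_zero 0
  · exact Subtype.ext <| funext fun x => ContinuousLinearMap.zero_comp _

end IsNat

theorem fderiv_comp_affine {X Y : Type*} [NormedAddCommGroup X] [NormedSpace ℝ X]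
    [NormedAddCommGroup Y] [NormedSpace ℝ Y] {Φ : Y → ℝ} (hΦ : Differentiable ℝ Φ) (L : X →L[ℝ] Y)
    (c : Y) (x w : X) : fderiv ℝ (fun s => Φ (L s + c)) x w = fderiv ℝ Φ (L x + c) (L w) := by
  have h := (hΦ (L x + c)).hasFDerivAt.comp x (L.hasFDerivAt.add_const c)
  have h2 : fderiv ℝ (fun s => Φ (L s + c)) x = _ := h.fderiv
  rw [h2]
  rfl

section
variable {E X : Type*} [NormedAddCommGroup E] [NormedSpace ℝ E] [FiniteDimensional ℝ E]
  [NormedAddCommGroup X] [NormedSpace ℝ X]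

/-- An alternating form is determined linearly by its values on tuples of basis vectors, and a
linear left inverse is continuous in finite dimension. -/
theorem contDiff_alt_of_apply {q : ℕ} {w : X → E [⋀^Fin q]→L[ℝ] ℝ}
    (h : ∀ v : Fin q → E, ContDiff ℝ ∞ fun x => w x v) : ContDiff ℝ ∞ w := by
  let b := Module.finBasis ℝ E
  let L : (E [⋀^Fin q]→L[ℝ] ℝ) →ₗ[ℝ] ((Fin q → Fin (Module.finrank ℝ E)) → ℝ) :=
    { toFun := fun a c => a fun i => b (c i)
      map_add' := fun _ _ => rfl
      map_smul' := fun _ _ => rfl }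
  have hL : Function.Injective L := by
    intro a a' haa
    have : a.toAlternatingMap = a'.toAlternatingMap :=
      Module.Basis.ext_alternating b fun c _ => congrFun haa c
    ext v
    exact congrArg (fun T : E [⋀^Fin q]→ₗ[ℝ] ℝ => T v) this
  obtain ⟨R, hR⟩ := L.exists_leftInverse_of_injective (LinearMap.ker_eq_bot.2 hL)
  have h1 : ContDiff ℝ ∞ fun x => L (w x) := contDiff_pi.2 fun c => h _
  have h2 := (LinearMap.toContinuousLinearMap R).contDiff (n := ∞) |>.comp h1
  convert h2 using 1
  funext x
  exact (congrArg (fun T => T (w x)) hR).symm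

end

/-! ### Commutation, product and differential rules for the contractions -/

namespace IsNat
variable {n p q m : ℕ} {F G : Fam n}

/-- Naturality along `f` is naturality of `F` along `id × f`, which pulls `g + dt` back to `f^* g +
dt`. -/
theorem contr (hF : IsNat (q + 1) F) (a : Fin n) : IsNat q (Fam.contr a F) where
  alt E _ _ _ g x := ((hF.alt (ℝ × E) (SF.ext1 a g) (0, x)).cons (1, 0)).comp
    (ContinuousLinearMap.inr ℝ ℝ E)
  smooth E _ _ _ g v := (hF.smooth (ℝ × E) (SF.ext1 a g) (scons (1, 0) fun i => (0, v i))).comp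
    (contDiff_const.prodMk contDiff_id)
  nat E E' _ _ _ _ _ _ f hf g x v := by
    have hd := (hf.differentiable (by simp) x).hasFDerivAt
    refine hF.transfer (fun x : ℝ × E => (x.1, f x.2)) (contDiff_fst.prodMk (hf.comp contDiff_snd))
      ?_ rfl (hasFDerivAt_fst.prodMk (HasFDerivAt.comp ((0 : ℝ), x) hd hasFDerivAt_snd)) fun i => ?_
    · rw [SF.pull_ext1, SF.ext1, SF.pull_pull]
    · cases i <;> simp

theorem contrT (hF : IsNat (q + 2) F) (a : Fin n) : IsNat q (Fam.contrT a F) where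
  alt E _ _ _ g x := (((hF.alt (ℝ × ℝ × E) (SF.ext2 a g) (0, 0, x)).cons (1, 0, 0)).cons
    (0, 1, 0)).comp ((ContinuousLinearMap.inr ℝ ℝ (ℝ × E)).comp (ContinuousLinearMap.inr ℝ ℝ E))
  smooth E _ _ _ g v := (hF.smooth (ℝ × ℝ × E) (SF.ext2 a g)
    (scons (1, 0, 0) (scons (0, 1, 0) fun i => (0, 0, v i)))).comp
    (contDiff_const.prodMk (contDiff_const.prodMk contDiff_id))
  nat E E' _ _ _ _ _ _ f hf g x v := by
    have hd := (hf.differentiable (by simp) x).hasFDerivAt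
    refine hF.transfer (fun x : ℝ × ℝ × E => (x.1, x.2.1, f x.2.2))
      (contDiff_fst.prodMk ((contDiff_fst.comp contDiff_snd).prodMk
        (hf.comp (contDiff_snd.comp contDiff_snd))))
      ?_ rfl (hasFDerivAt_fst.prodMk ((hasFDerivAt_fst.comp _ hasFDerivAt_snd).prodMk
        (HasFDerivAt.comp ((0 : ℝ), (0 : ℝ), x) hd (hasFDerivAt_snd.comp _ hasFDerivAt_snd))))
      fun i => ?_
    · rw [SF.pull_ext2, SF.ext2, SF.pull_pull]
    · rcases i with _ | _ | i <;> simp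

section
variable {E : Type} [NormedAddCommGroup E] [NormedSpace ℝ E] [FiniteDimensional ℝ E]

/-- Exchanging the two added coordinates exchanges the added forms; the sign comes from exchanging
the two contracted vectors. -/
theorem contr_contr (hF : IsNat (q + 2) F) (a b : Fin n) (g : SF n E) (x : E) (v : ℕ → E) :
    Fam.contr a (Fam.contr b F) E g x v = -Fam.contr b (Fam.contr a F) E g x v := by
  have e : ∀ a b, Fam.contr a (Fam.contr b F) E g x v =
      F (ℝ × ℝ × E) (SF.ext1 b (SF.ext1 a g)) (0, 0, x)
        (scons (1, 0, 0) (scons (0, 1, 0) fun i => (0, 0, v i))) := fun a b => by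
    have h := map_scons (fun y : ℝ × E => ((0 : ℝ), y)) (1, 0) fun i => (0, v i)
    simp only [Fam.contr, h]
    rfl
  rw [e, e, (hF.alt _ _ _).cons_swap, neg_inj]
  refine hF.transfer_affine ((((ContinuousLinearMap.fst ℝ ℝ E).comp
    (ContinuousLinearMap.snd ℝ ℝ (ℝ × E)))).prod ((ContinuousLinearMap.fst ℝ ℝ (ℝ × E)).prod
    ((ContinuousLinearMap.snd ℝ ℝ E).comp (ContinuousLinearMap.snd ℝ ℝ (ℝ × E))))) 0 ?_
    (by simp) fun i => ?_
  · simp only [SF.ext1, SF.pull_add, SF.pull_pull, SF.pull_form, add_assoc]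
    congr 1
    · exact SF.pull_congr g fun x => by simp
    · rw [add_comm]
      congr 1 <;> exact SF.form_congr _ (fun x => by simp) (fun x => by simp)
  · rcases i with _ | _ | i <;> simp

/-- Moving `∂_t` past the pair `∂_y`, `∂_z` takes two transpositions, so no sign appears. -/
theorem contr_contrT (hF : IsNat (q + 3) F) (a b : Fin n) (g : SF n E) (x : E) (v : ℕ → E) :
    Fam.contr a (Fam.contrT b F) E g x v = Fam.contrT b (Fam.contr a F) E g x v := by
  have e1 : Fam.contr a (Fam.contrT b F) E g x v =
      F (ℝ × ℝ × ℝ × E) (SF.ext2 b (SF.ext1 a g)) (0, 0, 0, x)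
        (scons (1, 0, 0, 0) (scons (0, 1, 0, 0) (scons (0, 0, 1, 0) fun i => (0, 0, 0, v i)))) := by
    have h := map_scons (fun y : ℝ × E => ((0 : ℝ), (0 : ℝ), y)) (1, 0) fun i => (0, v i)
    simp only [Fam.contr, Fam.contrT, h]
    rfl
  have e2 : Fam.contrT b (Fam.contr a F) E g x v =
      F (ℝ × ℝ × ℝ × E) (SF.ext1 a (SF.ext2 b g)) (0, 0, 0, x)
        (scons (1, 0, 0, 0) (scons (0, 1, 0, 0) (scons (0, 0, 1, 0) fun i => (0, 0, 0, v i)))) := by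
    have h := map_scons (fun y : ℝ × ℝ × E => ((0 : ℝ), y)) (1, 0, 0)
      (scons (0, 1, 0) fun i => (0, 0, v i))
    have h' := map_scons (fun y : ℝ × ℝ × E => ((0 : ℝ), y)) (0, 1, 0) fun i => (0, 0, v i)
    simp only [Fam.contr, Fam.contrT, h, h']
    rfl
  have h1 := (hF.alt (ℝ × ℝ × ℝ × E) (SF.ext1 a (SF.ext2 b g)) (0, 0, 0, x))
  rw [e1, e2, h1.cons_swap, (h1.cons (0, 1, 0, 0)).cons_swap, neg_neg]
  refine hF.transfer_affine
    (((ContinuousLinearMap.fst ℝ ℝ E).comp ((ContinuousLinearMap.snd ℝ ℝ (ℝ × E)).comp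
      (ContinuousLinearMap.snd ℝ ℝ (ℝ × ℝ × E)))).prod
    ((ContinuousLinearMap.fst ℝ ℝ (ℝ × ℝ × E)).prod
    (((ContinuousLinearMap.fst ℝ ℝ (ℝ × E)).comp (ContinuousLinearMap.snd ℝ ℝ (ℝ × ℝ × E))).prod
    ((ContinuousLinearMap.snd ℝ ℝ E).comp ((ContinuousLinearMap.snd ℝ ℝ (ℝ × E)).comp
      (ContinuousLinearMap.snd ℝ ℝ (ℝ × ℝ × E))))))) 0 ?_ (by simp) fun i => ?_
  · simp only [SF.ext1, SF.ext2, SF.pull_add, SF.pull_pull,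
      SF.pull_form, add_assoc]
    congr 1
    · exact SF.pull_congr g fun x => by simp
    · rw [add_comm]
      congr 1 <;> exact SF.form_congr _ (fun x => by simp) (fun x => by simp)
  · rcases i with _ | _ | _ | i <;> simp

theorem contrT_contrT (hF : IsNat (q + 4) F) (a b : Fin n) (g : SF n E) (x : E) (v : ℕ → E) :
    Fam.contrT a (Fam.contrT b F) E g x v = Fam.contrT b (Fam.contrT a F) E g x v := by
  have e : ∀ a b, Fam.contrT a (Fam.contrT b F) E g x v =
      F (ℝ × ℝ × ℝ × ℝ × E) (SF.ext2 b (SF.ext2 a g)) (0, 0, 0, 0, x)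
        (scons (1, 0, 0, 0, 0) (scons (0, 1, 0, 0, 0) (scons (0, 0, 1, 0, 0)
          (scons (0, 0, 0, 1, 0) fun i => (0, 0, 0, 0, v i))))) := fun a b => by
    have h := map_scons (fun y : ℝ × ℝ × E => ((0 : ℝ), (0 : ℝ), y)) (1, 0, 0)
      (scons (0, 1, 0) fun i => (0, 0, v i))
    have h' := map_scons (fun y : ℝ × ℝ × E => ((0 : ℝ), (0 : ℝ), y)) (0, 1, 0)
      fun i => (0, 0, v i)
    simp only [Fam.contrT, h, h']
    rfl
  have h1 := (hF.alt (ℝ × ℝ × ℝ × ℝ × E) (SF.ext2 a (SF.ext2 b g)) (0, 0, 0, 0, x))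
  -- Four transpositions carry one pair of vectors past the other, and the signs cancel.
  rw [e, e, (h1.cons (1, 0, 0, 0, 0)).cons_swap, h1.cons_swap,
    ((h1.cons (0, 0, 1, 0, 0)).cons (1, 0, 0, 0, 0)).cons_swap,
    (h1.cons (0, 0, 1, 0, 0)).cons_swap, neg_neg, neg_neg]
  refine hF.transfer_affine
    (((ContinuousLinearMap.fst ℝ ℝ (ℝ × E)).comp ((ContinuousLinearMap.snd ℝ ℝ (ℝ × ℝ × E)).comp
      (ContinuousLinearMap.snd ℝ ℝ (ℝ × ℝ × ℝ × E)))).prod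
    (((ContinuousLinearMap.fst ℝ ℝ E).comp ((ContinuousLinearMap.snd ℝ ℝ (ℝ × E)).comp
      ((ContinuousLinearMap.snd ℝ ℝ (ℝ × ℝ × E)).comp
        (ContinuousLinearMap.snd ℝ ℝ (ℝ × ℝ × ℝ × E))))).prod
    ((ContinuousLinearMap.fst ℝ ℝ (ℝ × ℝ × ℝ × E)).prod
    (((ContinuousLinearMap.fst ℝ ℝ (ℝ × ℝ × E)).comp
      (ContinuousLinearMap.snd ℝ ℝ (ℝ × ℝ × ℝ × E))).prod
    ((ContinuousLinearMap.snd ℝ ℝ E).comp ((ContinuousLinearMap.snd ℝ ℝ (ℝ × E)).comp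
      ((ContinuousLinearMap.snd ℝ ℝ (ℝ × ℝ × E)).comp
        (ContinuousLinearMap.snd ℝ ℝ (ℝ × ℝ × ℝ × E))))))))) 0 ?_ (by simp) fun i => ?_
  · simp only [SF.ext2, SF.pull_add, SF.pull_pull, SF.pull_form, add_assoc]
    congr 1
    · exact SF.pull_congr g fun x => by simp
    · rw [add_comm]
      congr 1 <;> exact SF.form_congr _ (fun x => by simp) (fun x => by simp)
  · rcases i with _ | _ | _ | _ | i <;> simp

theorem wedge (hF : IsNat p F) (hG : IsNat q G) : IsNat (p + q) (Fam.wedge p q F G) where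
  alt E _ _ _ g x := (hF.alt E g x).seqWedge (hG.alt E g x)
  smooth E _ _ _ g v := contDiff_const.mul <| ContDiff.sum fun _ _ =>
    contDiff_const.mul ((hF.smooth E g _).mul (hG.smooth E g _))
  nat E E' _ _ _ _ _ _ f hf g x v := by
    rw [Fam.wedge, funext (hF.nat E E' f hf g x), funext (hG.nat E E' f hf g x)]
    rfl

/-- This is the antiderivation rule for `∂_t`; the factor that is not contracted sees only vectors
tangent to the slice and returns to its value at `g` by `ext1_inr`. -/
theorem contr_wedge (hF : IsNat p F) (hG : IsNat q G) (h : p + q = m + 1) (a : Fin n) (g : SF n E)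
    (x : E) (v : ℕ → E) : Fam.contr a (Fam.wedge p q F G) E g x v =
      (if p = 0 then 0 else Fam.wedge (p - 1) q (Fam.contr a F) G E g x v) +
      (-1) ^ p * (if q = 0 then 0 else Fam.wedge p (q - 1) F (Fam.contr a G) E g x v) := by
  simp only [Fam.contr, Fam.wedge]
  rw [h, seqWedge_scons h.symm (hF.alt _ _ _) (hG.alt _ _ _)]
  have e1 := funext (hF.ext1_inr a g 0 x)
  have e2 := funext (hG.ext1_inr a g 0 x)
  congr 1
  · split_ifs with hp
    · rfl
    · rw [show p - 1 + q = m by omega, ← e2]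
      rfl
  · congr 1
    split_ifs with hq
    · rfl
    · rw [show p + (q - 1) = m by omega, ← e1]
      rfl

/-- Two antiderivations applied to a product give four terms. The mixed ones vanish because one
factor receives `∂_y` alone (`ext2_cons_fst`), and the others carry no sign, so the double
contraction is a derivation. -/
theorem contrT_wedge (hF : IsNat p F) (hG : IsNat q G) (h : p + q = m + 2) (a : Fin n)
    (g : SF n E) (x : E) (v : ℕ → E) : Fam.contrT a (Fam.wedge p q F G) E g x v =
      (if p < 2 then 0 else Fam.wedge (p - 2) q (Fam.contrT a F) G E g x v) +
      (if q < 2 then 0 else Fam.wedge p (q - 2) F (Fam.contrT a G) E g x v) := by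
  simp only [Fam.contrT, Fam.wedge]
  have hFa := hF.alt _ (SF.ext2 a g) (0, 0, x)
  have hGa := hG.alt _ (SF.ext2 a g) (0, 0, x)
  have e1 := funext (hF.ext2_inr a g 0 0 x)
  have e2 := funext (hG.ext2_inr a g 0 0 x)
  have z0 : ∀ k l (φ ψ : (ℕ → ℝ × ℝ × E) → ℝ) (u : ℕ → E), (∀ u : ℕ → E, φ (fun i => (0, 0, u i)) = 0) →
      seqWedge m k l φ ψ (fun i => (0, 0, u i)) = 0 := fun k l φ ψ u h0 => by
    have : ∀ σ : Equiv.Perm (Fin m), φ (fun i => (0, 0, u (permExt σ i))) = 0 := fun σ => h0 _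
    simp [seqWedge, this]
  have z1 : ∀ k l (φ ψ : (ℕ → ℝ × ℝ × E) → ℝ) (u : ℕ → E), (∀ u : ℕ → E, ψ (fun i => (0, 0, u i)) = 0) →
      seqWedge m k l φ ψ (fun i => (0, 0, u i)) = 0 := fun k l φ ψ u h0 => by
    have : ∀ σ : Equiv.Perm (Fin m), ψ (fun i => (0, 0, u (permExt σ (k + i)))) = 0 := fun σ => h0 _
    simp [seqWedge, this]
  rw [h, seqWedge_scons h.symm hFa hGa]
  congr 1
  · rcases p with _ | p
    · simp
    · rw [if_neg (by omega), Nat.add_sub_cancel,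
        seqWedge_scons (n := m) (by omega) (hFa.cons _) hGa]
      have : (if q = 0 then 0 else seqWedge m p (q - 1)
          (fun u => F (ℝ × ℝ × E) (SF.ext2 a g) (0, 0, x) (scons (1, 0, 0) u))
          (fun u => G (ℝ × ℝ × E) (SF.ext2 a g) (0, 0, x) (scons (0, 1, 0) u))
          fun i => (0, 0, v i)) = 0 := by
        split_ifs
        · rfl
        · exact z0 _ _ _ _ _ fun u => hF.ext2_cons_fst a g 0 0 x u
      rw [this, mul_zero, add_zero]
      rcases p with _ | p
      · simp
      · rw [if_neg (by omega), if_neg (by omega), show p + 1 + 1 - 2 + q = m by omega, ← e2]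
        rfl
  · rcases q with _ | q
    · simp
    · rw [if_neg (by omega), Nat.add_sub_cancel,
        seqWedge_scons (n := m) (by omega) hFa (hGa.cons _)]
      have : (if p = 0 then 0 else seqWedge m (p - 1) q
          (fun u => F (ℝ × ℝ × E) (SF.ext2 a g) (0, 0, x) (scons (0, 1, 0) u))
          (fun u => G (ℝ × ℝ × E) (SF.ext2 a g) (0, 0, x) (scons (1, 0, 0) u))
          fun i => (0, 0, v i)) = 0 := by
        split_ifs
        · rfl
        · exact z1 _ _ _ _ _ fun u => hG.ext2_cons_fst a g 0 0 x u
      rw [this, zero_add, ← mul_assoc, ← pow_add, Even.neg_one_pow ⟨_, rfl⟩, one_mul]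
      rcases q with _ | q
      · simp
      · rw [if_neg (by omega), if_neg (by omega), show p + (q + 1 + 1 - 2) = m by omega, ← e1]
        rfl

theorem exists_form (hF : IsNat q F) (g : SF n E) :
    ∃ w : E → E [⋀^Fin q]→L[ℝ] ℝ, ContDiff ℝ ∞ w ∧ ∀ x v, F E g x v = w x fun i => v i := by
  choose w hw using hF.alt E g
  refine ⟨w, contDiff_alt_of_apply fun v => ?_, hw⟩
  have := hF.smooth E g fun i => if h : i < q then v ⟨i, h⟩ else 0
  simpa [hw] using this
end

end IsNat

section
variable {n q : ℕ} {F : Fam n} {E : Type} [NormedAddCommGroup E] [NormedSpace ℝ E]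
  [FiniteDimensional ℝ E]

/-- The vectors are constant vector fields, so the formula for the exterior derivative has no
bracket terms. -/
theorem Fam.D_eq {g : SF n E} {w : E → E [⋀^Fin q]→L[ℝ] ℝ} (hw : ContDiff ℝ ∞ w)
    (h : ∀ x v, F E g x v = w x fun i => v i) (x : E) (v : ℕ → E) :
    Fam.D q F E g x v = extDeriv w x fun i => v i := by
  rw [extDeriv_apply (hw.differentiable (by simp) x), Fam.D, ← Fin.sum_univ_eq_sum_range
    (fun i => (-1) ^ i * fderiv ℝ (fun y => F E g y (srem i v)) x (v i))]
  refine Finset.sum_congr rfl fun i _ => ?_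
  simp only [zsmul_eq_mul, Int.cast_pow, Int.cast_neg, Int.cast_one]
  congr 3
  funext y
  rw [h]
  refine congrArg _ (funext fun j => ?_)
  simp only [srem, Fin.removeNth_apply, Fin.succAbove, Fin.lt_def, Fin.val_castSucc]
  split_ifs <;> rfl

namespace IsNat

theorem D (hF : IsNat q F) : IsNat (q + 1) (Fam.D q F) where
  alt E _ _ _ g x := by
    obtain ⟨w, hw, h⟩ := hF.exists_form g
    exact ⟨extDeriv w x, Fam.D_eq hw h x⟩
  smooth E _ _ _ g v := ContDiff.sum fun i _ => contDiff_const.mul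
    (((hF.smooth E g _).fderiv_right (m := ∞) (by simp)).clm_apply contDiff_const)
  nat E E' _ _ _ _ _ _ f hf g x v := by
    obtain ⟨w, hw, h⟩ := hF.exists_form g
    have h1 : ∀ x v, F E (SF.pull f hf g) x v =
        ((w (f x)).compContinuousLinearMap (fderiv ℝ f x)) fun i => v i := fun x v => by
      rw [hF.nat, h]
      rfl
    have h2 : ContDiff ℝ ∞ fun x => (w (f x)).compContinuousLinearMap (fderiv ℝ f x) :=
      contDiff_iff_contDiffAt.2 fun x => contDiffAt_alt_comp ((hw.comp hf).contDiffAt)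
        (hf.fderiv_right (m := ∞) (by simp)).contDiffAt
    rw [Fam.D_eq h2 h1, Fam.D_eq hw h, extDeriv_pullback (r := ∞)
      (hw.differentiable (by simp) _) hf.contDiffAt
      (by rw [minSmoothness_of_isRCLikeNormedField]; exact WithTop.coe_le_coe.2 le_top)]
    rfl

/-- This is Cartan's formula for `∂_t`: the Lie derivative term vanishes because the components
along the slices do not depend on `t`. The sign comes from the shift of the summation index. -/
theorem contr_D (hF : IsNat q F) (a : Fin n) (g : SF n E) (x : E) (v : ℕ → E) :
    Fam.contr a (Fam.D q F) E g x v = -∑ i ∈ Finset.range q,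
      (-1) ^ i * fderiv ℝ (fun y => Fam.contr a F E g y (srem i v)) x (v i) := by
  simp only [Fam.contr, Fam.D]
  rw [Finset.sum_range_succ', ← Finset.sum_neg_distrib]
  have h0 : fderiv ℝ (fun y => F (ℝ × E) (SF.ext1 a g) y
      (srem 0 (scons (1, 0) fun i => (0, v i)))) (0, x) (1, 0) = 0 := by
    have e : (fun y => F (ℝ × E) (SF.ext1 a g) y (srem 0 (scons (1, 0) fun i => (0, v i)))) =
        fun y => F E g (ContinuousLinearMap.snd ℝ ℝ E y + 0) v := by
      funext y
      rw [srem_zero_scons, show y = (y.1, y.2) from rfl, hF.ext1_inr]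
      simp
    rw [e, fderiv_comp_affine ((hF.smooth E g v).differentiable (by simp))]
    simp
  rw [scons_zero, h0, mul_zero, add_zero]
  refine Finset.sum_congr rfl fun i _ => ?_
  rw [srem_succ_scons, ← map_srem (fun y : E => ((0 : ℝ), y)), scons_succ]
  have := fderiv_comp_affine ((hF.smooth (ℝ × E) (SF.ext1 a g)
    (scons (1, 0) fun j => (0, srem i v j))).differentiable (by simp))
    (ContinuousLinearMap.inr ℝ ℝ E) 0 x (v i)
  simp only [ContinuousLinearMap.inr_apply, add_zero] at this
  rw [this, pow_succ]
  ring

/-- The component along `dz` is `y · contr a F`; its derivative in `y` produces the extra term. The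
derivative in `z` acts on the component along `dy`, which is zero, and the index shift by two leaves
the other signs alone. -/
theorem contrT_D (hF : IsNat (q + 1) F) (a : Fin n) (g : SF n E) (x : E) (v : ℕ → E) :
    Fam.contrT a (Fam.D (q + 1) F) E g x v = Fam.contr a F E g x v + ∑ i ∈ Finset.range q,
      (-1) ^ i * fderiv ℝ (fun y => Fam.contrT a F E g y (srem i v)) x (v i) := by
  simp only [Fam.contrT, Fam.D]
  rw [Finset.sum_range_succ', Finset.sum_range_succ']
  have h0 : fderiv ℝ (fun y => F (ℝ × ℝ × E) (SF.ext2 a g) y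
      (srem 0 (scons (1, 0, 0) (scons (0, 1, 0) fun i => (0, 0, v i))))) (0, 0, x) (1, 0, 0) =
      Fam.contr a F E g x v := by
    have := fderiv_comp_affine ((hF.smooth (ℝ × ℝ × E) (SF.ext2 a g)
      (scons (0, 1, 0) fun i => (0, 0, v i))).differentiable (by simp))
      (ContinuousLinearMap.inl ℝ ℝ (ℝ × E)) (0, 0, x) 0 1
    have e : (fun s : ℝ => F (ℝ × ℝ × E) (SF.ext2 a g)
        (ContinuousLinearMap.inl ℝ ℝ (ℝ × E) s + (0, 0, x))
        (scons (0, 1, 0) fun i => (0, 0, v i))) = fun s => s * Fam.contr a F E g x v := by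
      funext s
      rw [← hF.ext2_cons_snd a g s 0 x v]
      simp
    rw [e, fderiv_mul_const differentiableAt_fun_id] at this
    simp only [ContinuousLinearMap.inl_apply, Prod.mk_add_mk, zero_add] at this
    rw [srem_zero_scons]
    refine this.symm.trans ?_
    simp
  have h1 : fderiv ℝ (fun y => F (ℝ × ℝ × E) (SF.ext2 a g) y
      (srem (0 + 1) (scons (1, 0, 0) (scons (0, 1, 0) fun i => (0, 0, v i))))) (0, 0, x)
      (0, 1, 0) = 0 := by
    have e : (fun y => F (ℝ × ℝ × E) (SF.ext2 a g) y
        (srem (0 + 1) (scons (1, 0, 0) (scons (0, 1, 0) fun i => (0, 0, v i))))) = fun _ => 0 := by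
      funext y
      rw [srem_succ_scons, srem_zero_scons]
      exact hF.ext2_cons_fst a g _ _ _ v
    rw [e]
    simp
  rw [scons_zero, scons_succ, scons_zero, h0, h1, pow_zero, one_mul, mul_zero, add_zero, add_comm]
  congr 1
  refine Finset.sum_congr rfl fun i _ => ?_
  rw [srem_succ_scons, srem_succ_scons, ← map_srem (fun y : E => ((0 : ℝ), (0 : ℝ), y)), scons_succ,
    scons_succ]
  have := fderiv_comp_affine ((hF.smooth (ℝ × ℝ × E) (SF.ext2 a g)
    (scons (1, 0, 0) (scons (0, 1, 0) fun j => (0, 0, srem i v j)))).differentiable (by simp))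
    ((ContinuousLinearMap.inr ℝ ℝ (ℝ × E)).comp (ContinuousLinearMap.inr ℝ ℝ E)) 0 x (v i)
  simp only [ContinuousLinearMap.comp_apply, ContinuousLinearMap.inr_apply, add_zero] at this
  rw [this, pow_succ, pow_succ]
  ring

end IsNat
end

/-! ### The Koszul element of a natural family -/

theorem Koszul.algebraMap_injective {W : Type*} [AddCommGroup W] [Module ℝ W] :
    Function.Injective (algebraMap ℝ (Koszul W)) := by
  let e : Koszul W →ₐ[ℝ] ℝ := Algebra.TensorProduct.lift ExteriorAlgebra.algebraMapInv
    SymmetricAlgebra.algebraMapInv fun _ _ => mul_comm _ _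
  exact Function.LeftInverse.injective (g := e) fun r => e.commutes r

section
variable {n : ℕ} {W : Type*} [AddCommGroup W] [Module ℝ W]

open Koszul

/-- The element of the Koszul algebra with the same iterated contractions as a natural form. -/
noncomputable def taylor (l : Fin n → W) : ℕ → Fam n → Koszul W
  | 0, F => algebraMap ℝ _ (F ℝ 0 0 0)
  | 1, F => ∑ a, gen (l a) * taylor l 0 (Fam.contr a F)
  | q + 2, F => ((q + 2 : ℕ) : ℝ)⁻¹ • (∑ a, gen (l a) * taylor l (q + 1) (Fam.contr a F) +
      (2 : ℝ) • ∑ a, tilde (l a) * taylor l q (Fam.contrT a F))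

variable (l : Fin n → W)

theorem taylor_add (q : ℕ) (F G : Fam n) : taylor l q (F + G) = taylor l q F + taylor l q G := by
  have h1 : ∀ a, Fam.contr a (F + G) = Fam.contr a F + Fam.contr a G := fun _ => rfl
  have h2 : ∀ a, Fam.contrT a (F + G) = Fam.contrT a F + Fam.contrT a G := fun _ => rfl
  induction q using Nat.strong_induction_on generalizing F G with
  | _ q ih =>
    rcases q with _ | _ | q
    · exact map_add (algebraMap ℝ (Koszul W)) _ _
    · rw [zero_add]
      simp only [taylor.eq_2, h1, ih 0 (by omega) _ _ (fun _ => rfl) (fun _ => rfl), mul_add,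
        Finset.sum_add_distrib]
    · simp only [taylor.eq_3, h1, h2, ih (q + 1) (by omega) _ _ (fun _ => rfl) (fun _ => rfl),
        ih q (by omega) _ _ (fun _ => rfl) (fun _ => rfl), mul_add, Finset.sum_add_distrib, smul_add]
      abel

theorem taylor_smul (q : ℕ) (r : ℝ) (F : Fam n) : taylor l q (r • F) = r • taylor l q F := by
  have h1 : ∀ a, Fam.contr a (r • F) = r • Fam.contr a F := fun _ => rfl
  have h2 : ∀ a, Fam.contrT a (r • F) = r • Fam.contrT a F := fun _ => rfl
  induction q using Nat.strong_induction_on generalizing F with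
  | _ q ih =>
    rcases q with _ | _ | q
    · rw [taylor, taylor, Algebra.algebraMap_eq_smul_one, Algebra.algebraMap_eq_smul_one, smul_smul]
      rfl
    · rw [zero_add]
      simp only [taylor.eq_2, h1, ih 0 (by omega) _ (fun _ => rfl) (fun _ => rfl), mul_smul_comm,
        Finset.smul_sum]
    · simp only [taylor.eq_3, h1, h2, ih (q + 1) (by omega) _ (fun _ => rfl) (fun _ => rfl),
        ih q (by omega) _ (fun _ => rfl) (fun _ => rfl), mul_smul_comm, ← Finset.smul_sum]
      rw [smul_comm (2 : ℝ) r, ← smul_add, smul_comm]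

theorem taylor_zero (q : ℕ) : taylor l q (0 : Fam n) = 0 := by
  simpa using taylor_smul l q 0 0

theorem taylor_neg (q : ℕ) (F : Fam n) : taylor l q (-F) = -taylor l q F := by
  rw [← neg_one_smul ℝ F, taylor_smul]
  exact neg_one_smul ℝ (taylor l q F)

theorem taylor_mem (q : ℕ) (F : Fam n) : taylor l q F ∈ grade W q := by
  induction q using Nat.strong_induction_on generalizing F with
  | _ q ih =>
    rcases q with _ | _ | q
    · rw [taylor, Algebra.algebraMap_eq_smul_one]
      exact Submodule.smul_mem _ _ one_mem_grade
    · exact Submodule.sum_mem _ fun a _ => gen_mul_mem _ (ih 0 (by omega) _)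
    · exact Submodule.smul_mem _ _ (Submodule.add_mem _
        (Submodule.sum_mem _ fun a _ => gen_mul_mem _ (ih (q + 1) (by omega) _))
        (Submodule.smul_mem _ _ (Submodule.sum_mem _ fun a _ =>
          tilde_mul_mem _ (ih q (by omega) _))))

variable {l} {c : Fin n → Module.Dual ℝ W}

theorem del_algebraMap (c : Module.Dual ℝ W) (r : ℝ) : del c (algebraMap ℝ (Koszul W) r) = 0 := by
  rw [Algebra.algebraMap_eq_smul_one, map_smul, del_one, smul_zero]

theorem delT_algebraMap (c : Module.Dual ℝ W) (r : ℝ) : delT c (algebraMap ℝ (Koszul W) r) = 0 := by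
  rw [Algebra.algebraMap_eq_smul_one, map_smul, delT_one, smul_zero]

/-- Contracting the recursion with `c a` gives `taylor` of `contr a F` once from the generator `l
a`. The other terms reassemble by the commutation rules into Euler's identity for `contr a F`, of
degree `q - 1`. Together this is `q` copies, cancelled by the factor in the definition. -/
theorem del_taylor
    (hlc : ∀ a k, c a (l k) = if k = a then 1 else 0)
    (q : ℕ) (F : Fam n) (hF : IsNat q F) (a : Fin n) :
    del (c a) (taylor l q F) = if q = 0 then 0 else taylor l (q - 1) (Fam.contr a F) := by
  induction q using Nat.strong_induction_on generalizing F with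
  | _ q ih =>
    rcases q with _ | _ | q
    · exact del_algebraMap _ _
    · rw [zero_add, taylor.eq_2, map_sum]
      simp only [del_gen_mul, taylor.eq_1, del_algebraMap, hlc, mul_zero, sub_zero, ite_smul,
        one_smul, zero_smul, Finset.sum_ite_eq', Finset.mem_univ, if_true]
      rfl
    · have h1 : ∀ k, del (c a) (taylor l (q + 1) (Fam.contr k F)) =
          -taylor l q (Fam.contr k (Fam.contr a F)) := fun k => by
        rw [ih (q + 1) (by omega) _ (hF.contr k), if_neg (by omega), Nat.add_sub_cancel, ← taylor_neg]
        congr 1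
        ext E _ _ _ g x v
        exact hF.contr_contr a k g x v
      have h2 : ∀ k, del (c a) (taylor l q (Fam.contrT k F)) =
          if q = 0 then 0 else taylor l (q - 1) (Fam.contrT k (Fam.contr a F)) := fun k => by
        rw [ih q (by omega) _ (hF.contrT k)]
        split_ifs with hq
        · rfl
        · obtain ⟨q, rfl⟩ := Nat.exists_eq_succ_of_ne_zero hq
          congr 1
          ext E _ _ _ g x v
          exact hF.contr_contrT a k g x v
      rw [taylor, map_smul, map_add, map_smul, map_sum, map_sum, if_neg (by omega)]
      simp only [del_gen_mul, del_tilde_mul, h1, h2, hlc, ite_smul, one_smul, zero_smul,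
        Finset.sum_sub_distrib, Finset.sum_ite_eq', Finset.mem_univ, if_true]
      have h5 : ∀ k, gen (l k) * -taylor l q (Fam.contr k (Fam.contr a F)) =
          -(gen (l k) * taylor l q (Fam.contr k (Fam.contr a F))) := fun k => by
        rw [← neg_one_smul ℝ, mul_smul_comm, neg_one_smul]
      rw [Finset.sum_congr rfl fun k _ => h5 k, Finset.sum_neg_distrib, sub_neg_eq_add]
      -- This is the recursion for `contr a F` with its normalising factor cleared; in degree one
      -- the symmetric part is absent.
      have h3 : ∑ k, gen (l k) * taylor l q (Fam.contr k (Fam.contr a F)) +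
          (2 : ℝ) • ∑ k, tilde (l k) *
            (if q = 0 then 0 else taylor l (q - 1) (Fam.contrT k (Fam.contr a F))) =
          ((q + 1 : ℕ) : ℝ) • taylor l (q + 1) (Fam.contr a F) := by
        rcases q with _ | q
        · simp [taylor]
        · rw [taylor, smul_smul, mul_inv_cancel₀ (by positivity), one_smul]
          simp
      rw [add_assoc, h3, show q + 1 + 1 - 1 = q + 1 from rfl]
      have h4 : ((q + 2 : ℕ) : ℝ) ≠ 0 := by positivity
      rw [inv_smul_eq_iff₀ h4, show ((q + 2 : ℕ) : ℝ) = 1 + ((q + 1 : ℕ) : ℝ) by push_cast; ring,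
        add_smul, one_smul]

/-- Now `tilde (l a)` contributes two copies of the element of `contrT a F`, by its weight in
Euler's identity, and the remaining terms contribute `q - 2` copies. -/
theorem delT_taylor
    (hlc : ∀ a k, c a (l k) = if k = a then 1 else 0)
    (q : ℕ) (F : Fam n) (hF : IsNat q F) (a : Fin n) :
    delT (c a) (taylor l q F) = if q < 2 then 0 else taylor l (q - 2) (Fam.contrT a F) := by
  induction q using Nat.strong_induction_on generalizing F with
  | _ q ih =>
    rcases q with _ | _ | q
    · exact delT_algebraMap _ _
    · rw [zero_add, taylor.eq_2, map_sum]
      simp only [delT_gen_mul, taylor.eq_1, delT_algebraMap, mul_zero, Finset.sum_const_zero]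
      rfl
    · have h1 : ∀ k, delT (c a) (taylor l (q + 1) (Fam.contr k F)) =
          if q = 0 then 0 else taylor l (q - 1) (Fam.contr k (Fam.contrT a F)) := fun k => by
        rw [ih (q + 1) (by omega) _ (hF.contr k)]
        rcases q with _ | q
        · rfl
        · rw [if_neg (by omega), if_neg (by omega)]
          congr 1
          ext E _ _ _ g x v
          exact (hF.contr_contrT k a g x v).symm
      have h2 : ∀ k, delT (c a) (taylor l q (Fam.contrT k F)) =
          if q < 2 then 0 else taylor l (q - 2) (Fam.contrT k (Fam.contrT a F)) := fun k => by
        rw [ih q (by omega) _ (hF.contrT k)]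
        split_ifs with hq
        · rfl
        · obtain ⟨q, rfl⟩ := Nat.exists_eq_add_of_le' (not_lt.1 hq)
          congr 1
          ext E _ _ _ g x v
          exact hF.contrT_contrT a k g x v
      rw [taylor, map_smul, map_add, map_smul, map_sum, map_sum, if_neg (by omega)]
      simp only [delT_gen_mul, delT_tilde_mul, h1, h2, hlc, ite_smul, one_smul, zero_smul,
        Finset.sum_add_distrib, Finset.sum_ite_eq', Finset.mem_univ, if_true]
      have h3 : ∑ k, gen (l k) *
            (if q = 0 then 0 else taylor l (q - 1) (Fam.contr k (Fam.contrT a F))) +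
          (2 : ℝ) • ∑ k, tilde (l k) *
            (if q < 2 then 0 else taylor l (q - 2) (Fam.contrT k (Fam.contrT a F))) =
          (q : ℝ) • taylor l q (Fam.contrT a F) := by
        rcases q with _ | _ | q
        · simp
        · simp [taylor]
        · rw [taylor, smul_smul, mul_inv_cancel₀ (by positivity), one_smul]
          simp
      rw [smul_add (2 : ℝ), add_left_comm, h3, show q + 1 + 1 - 2 = q from rfl]
      have h4 : ((q + 2 : ℕ) : ℝ) ≠ 0 := by positivity
      rw [inv_smul_eq_iff₀ h4, ← add_smul]
      push_cast
      rw [add_comm]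

/-- Pulling back along a constant map from `ℝ` makes the argument zero while keeping the value at
the point, so a natural function is constant. This justifies the base case of `taylor`. -/
theorem IsNat.apply_eq {F : Fam n} (hF : IsNat 0 F) {E : Type} [NormedAddCommGroup E]
    [NormedSpace ℝ E] [FiniteDimensional ℝ E] (g : SF n E) (x : E) (v : ℕ → E) :
    F E g x v = F ℝ 0 0 0 := by
  rw [hF.transfer (fun _ : ℝ => x) contDiff_const (g' := g) (g := 0) ?_ rfl
    (hasFDerivAt_const _ _) (w := 0) fun i => rfl]
  · exact (hF.alt E g x).congr (by simp)
  · refine Subtype.ext <| funext fun y => ?_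
    change (g.1 x).comp (fderiv ℝ (fun _ : ℝ => x) y) = 0
    rw [fderiv_fun_const]
    exact ContinuousLinearMap.comp_zero _

/-- The contractions have zero `taylor` elements too, so they vanish by induction and the criterion
`IsNat.eq_zero` applies. -/
theorem eq_zero_of_taylor
    (hlc : ∀ a k, c a (l k) = if k = a then 1 else 0)
    (q : ℕ) (F : Fam n) (hF : IsNat q F) (h : taylor l q F = 0) : F = 0 := by
  induction q using Nat.strong_induction_on generalizing F with
  | _ q ih =>
    rcases q with _ | q
    · have h0 : F ℝ 0 0 0 = 0 := algebraMap_injective (h.trans (map_zero _).symm)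
      ext E _ _ _ g x v
      exact (hF.apply_eq g x v).trans h0
    · refine hF.eq_zero (fun a => ?_) fun a hq => ?_
      · refine ih q (by omega) _ (hF.contr a) ?_
        have := del_taylor hlc (q + 1) F hF a
        rw [h, map_zero] at this
        exact this.symm
      · obtain ⟨q, rfl⟩ := Nat.exists_eq_succ_of_ne_zero (show q ≠ 0 by omega)
        refine ih q (by omega) _ (hF.contrT a) ?_
        have := delT_taylor hlc (q + 2) F hF a
        rw [h, map_zero, if_neg (by omega)] at this
        exact this.symm

/-- Both sides have the same degree, and `contr` and `contrT` obey the product rules of `del` and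
`delT`; induction on the total degree makes all derivatives agree. -/
theorem taylor_wedge
    (hlc : ∀ a k, c a (l k) = if k = a then 1 else 0)
    (h : ∀ w, ∑ k, c k w • l k = w)
    (p q : ℕ) (F G : Fam n) (hF : IsNat p F) (hG : IsNat q G) :
    taylor l (p + q) (Fam.wedge p q F G) = taylor l p F * taylor l q G := by
  obtain ⟨m, hm⟩ : ∃ m, p + q = m := ⟨_, rfl⟩
  induction m using Nat.strong_induction_on generalizing p q F G with
  | _ m ih =>
    rcases m with _ | m
    · obtain ⟨rfl, rfl⟩ : p = 0 ∧ q = 0 := by omega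
      rw [taylor, taylor, taylor, ← map_mul]
      exact congrArg _ (seqWedge_zero_zero _ _ _)
    · refine eq_of_del_eq h (n := p + q) (by omega) (taylor_mem _ _ _)
        (mul_mem_grade (taylor_mem _ _ _) (taylor_mem _ _ _)) (fun a => ?_) fun a => ?_
      · rw [del_mul _ (taylor_mem _ _ _), del_taylor hlc _ _ (hF.wedge hG), del_taylor hlc _ _ hF,
          del_taylor hlc _ _ hG, if_neg (by omega)]
        have e : Fam.contr a (Fam.wedge p q F G) =
            (if p = 0 then 0 else Fam.wedge (p - 1) q (Fam.contr a F) G) +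
            (-1 : ℝ) ^ p • (if q = 0 then 0 else Fam.wedge p (q - 1) F (Fam.contr a G)) := by
          ext E _ _ _ g x v
          refine (hF.contr_wedge hG hm a g x v).trans ?_
          split_ifs <;> rfl
        rw [e, taylor_add, taylor_smul]
        congr 1
        · split_ifs with hp
          · rw [taylor_zero, zero_mul]
          · obtain ⟨p, rfl⟩ := Nat.exists_eq_succ_of_ne_zero hp
            rw [← ih m (by omega) (p + 1 - 1) q _ _ (hF.contr a) hG (by omega)]
            congr 1
            omega
        · congr 1
          split_ifs with hq
          · rw [taylor_zero, mul_zero]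
          · obtain ⟨q, rfl⟩ := Nat.exists_eq_succ_of_ne_zero hq
            rw [← ih m (by omega) p (q + 1 - 1) _ _ hF (hG.contr a) (by omega)]
            congr 1
      · rw [delT_mul, delT_taylor hlc _ _ (hF.wedge hG), delT_taylor hlc _ _ hF,
          delT_taylor hlc _ _ hG]
        rcases m with _ | m
        · rw [if_pos (by omega), if_pos (by omega), if_pos (by omega), zero_mul, mul_zero, add_zero]
        rw [if_neg (by omega)]
        have e : Fam.contrT a (Fam.wedge p q F G) =
            (if p < 2 then 0 else Fam.wedge (p - 2) q (Fam.contrT a F) G) +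
            (if q < 2 then 0 else Fam.wedge p (q - 2) F (Fam.contrT a G)) := by
          ext E _ _ _ g x v
          refine (hF.contrT_wedge hG hm a g x v).trans ?_
          split_ifs <;> rfl
        rw [e, taylor_add]
        congr 1
        · split_ifs with hp
          · rw [taylor_zero, zero_mul]
          · obtain ⟨p, rfl⟩ := Nat.exists_eq_add_of_le' (not_lt.1 hp)
            rw [← ih m (by omega) (p + 2 - 2) q _ _ (hF.contrT a) hG (by omega)]
            congr 1
            omega
        · split_ifs with hq
          · rw [taylor_zero, mul_zero]
          · obtain ⟨q, rfl⟩ := Nat.exists_eq_add_of_le' (not_lt.1 hq)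
            rw [← ih m (by omega) p (q + 2 - 2) _ _ hF (hG.contrT a) (by omega)]
            congr 1

/-- The rules `contr_D` and `contrT_D` match `del_d` and `delT_d`, so the derivatives of both sides
agree by induction. The target degree is positive even for `q = 0`, so `eq_of_del_eq` always
applies. -/
theorem taylor_D [FiniteDimensional ℝ W]
    (hlc : ∀ a k, c a (l k) = if k = a then 1 else 0)
    (h : ∀ w, ∑ k, c k w • l k = w)
    (q : ℕ) (F : Fam n) (hF : IsNat q F) :
    taylor l (q + 1) (Fam.D q F) = d W (taylor l q F) := by
  induction q using Nat.strong_induction_on generalizing F with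
  | _ q ih =>
    refine eq_of_del_eq h (n := q + 1) (by omega) (taylor_mem _ _ _)
      (d_mem_grade (taylor_mem _ _ _)) (fun a => ?_) fun a => ?_
    · rw [del_d, del_taylor hlc _ _ hF.D, del_taylor hlc _ _ hF, if_neg (by omega),
        Nat.add_sub_cancel]
      rcases q with _ | q
      · rw [if_pos rfl, map_zero, neg_zero, show Fam.contr a (Fam.D 0 F) = 0 from ?_, taylor_zero]
        ext E _ _ _ g x v
        refine (hF.contr_D a g x v).trans ?_
        simp
        rfl
      · rw [if_neg (by omega), Nat.add_sub_cancel, ← ih q (by omega) _ (hF.contr a), ← taylor_neg]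
        congr 1
        ext E _ _ _ g x v
        exact hF.contr_D a g x v
    · rw [delT_d, delT_taylor hlc _ _ hF.D, delT_taylor hlc _ _ hF, del_taylor hlc _ _ hF]
      rcases q with _ | _ | q
      · simp
      · rw [if_neg (by omega), if_pos (by omega), if_neg (by omega), map_zero, zero_add]
        refine congrArg (taylor l 0) ?_
        ext E _ _ _ g x v
        refine (hF.contrT_D a g x v).trans ?_
        simp
      · rw [if_neg (by omega), if_neg (by omega), if_neg (by omega),
          show q + 1 + 1 + 1 - 2 = q + 1 from rfl, show q + 1 + 1 - 1 = q + 1 from rfl,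
          show q + 1 + 1 - 2 = q from rfl, ← ih q (by omega) _ (hF.contrT a), ← taylor_add]
        refine congrArg (taylor l (q + 1)) ?_
        rw [add_comm (Fam.D q _)]
        ext E _ _ _ g x v
        exact hF.contrT_D a g x v

end

/-! ### Vector spaces as manifolds, and parametrisations of manifolds by vector spaces -/

section
variable {E : Type*} [NormedAddCommGroup E] [NormedSpace ℝ E]

theorem smoothAt_model_iff {q : ℕ} (w : RawForm E E q) (x : E) :
    SmoothAt w x ↔ ContDiffAt ℝ ∞ (fun y => (show E [⋀^Fin q]→L[ℝ] ℝ from w y)) x := by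
  have h : rep w x = fun y : E => (show E [⋀^Fin q]→L[ℝ] ℝ from w y) :=
    funext fun y => congrFun (rawPull_id w) y
  rw [smoothAt_iff, h, extChartAt_model_space_eq_id]
  rfl
end

section
variable (E : Type) [NormedAddCommGroup E] [NormedSpace ℝ E] [FiniteDimensional ℝ E]

/-- A finite-dimensional vector space as a manifold. -/
noncomputable def Man.vec : Man where
  carrier := E
  model := E
  secondCountable := by
    have := FiniteDimensional.proper_real E
    infer_instance
end

namespace Man.vec
variable {E E' : Type} [NormedAddCommGroup E] [NormedSpace ℝ E] [FiniteDimensional ℝ E]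
  [NormedAddCommGroup E'] [NormedSpace ℝ E'] [FiniteDimensional ℝ E']

/-- A smooth map of vector spaces as a morphism. -/
noncomputable def hom (f : E → E') (hf : ContDiff ℝ ∞ f) : Man.vec E ⟶ Man.vec E' :=
  (⟨f, hf.contMDiff⟩ : C^∞⟮𝓘(ℝ, E), E; 𝓘(ℝ, E'), E'⟯)

/-- A smooth map from a vector space to a manifold as a morphism. -/
noncomputable def homTo {M : Man} (f : E → M.carrier)
    (hf : ContMDiff 𝓘(ℝ, E) 𝓘(ℝ, M.model) ∞ f) : Man.vec E ⟶ M :=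
  (⟨f, hf⟩ : C^∞⟮𝓘(ℝ, E), E; 𝓘(ℝ, M.model), M.carrier⟯)

variable {q : ℕ}

/-- The form on a vector space given by a smooth function. -/
noncomputable def form (w : E → E [⋀^Fin q]→L[ℝ] ℝ) (hw : ContDiff ℝ ∞ w) : Form (Man.vec E) q :=
  Form.mk (M := Man.vec E) (show RawForm E E q from w)
    fun x => (smoothAt_model_iff (E := E) w x).2 hw.contDiffAt

/-- The function that gives a form on a vector space. -/
noncomputable def fn (w : Form (Man.vec E) q) : E → E [⋀^Fin q]→L[ℝ] ℝ := w.raw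

theorem contDiff_fn (w : Form (Man.vec E) q) : ContDiff ℝ ∞ (fn w) :=
  contDiff_iff_contDiffAt.2 fun x => (smoothAt_model_iff (E := E) (fn w) x).1 (w.smoothAt x)

theorem fn_injective : Function.Injective (fn : Form (Man.vec E) q → _) := Form.raw_injective

theorem fn_pullback (f : E → E') (hf : ContDiff ℝ ∞ f) (w : Form (Man.vec E') q) (x : E) :
    fn (Form.pullback (hom f hf) w) x = (fn w (f x)).compContinuousLinearMap (fderiv ℝ f x) := by
  rw [← mfderiv_eq_fderiv]
  rfl

theorem fn_d (w : Form (Man.vec E) q) : fn (Form.d w) = extDeriv (fn w) :=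
  rawD_model (E := E) (fn w)

end Man.vec

/-- A bump function squeezes the whole model space into the target of a chart without changing it
near the origin, up to translation. Naturality needs a globally defined map, and a surjective
differential lets the pullback determine a form at `p`. -/
theorem Man.exists_param (M : Man) (p : M.carrier) :
    ∃ (f : M.model → M.carrier) (_ : ContMDiff 𝓘(ℝ, M.model) 𝓘(ℝ, M.model) ∞ f),
      f 0 = p ∧ Function.Surjective (mfderiv 𝓘(ℝ, M.model) 𝓘(ℝ, M.model) f 0) := by
  set φ := extChartAt 𝓘(ℝ, M.model) p with hφ
  obtain ⟨ε, hε, hball⟩ := Metric.mem_nhds_iff.1 (extChartAt_target_mem_nhds (I := 𝓘(ℝ, M.model)) p)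
  -- With outer radius `ε / 2` the vector `χ y • y` always has norm below `ε`, so `ρ` stays in the
  -- ball inside the chart target.
  let χ : ContDiffBump (0 : M.model) := ⟨ε / 3, ε / 2, by positivity, by linarith⟩
  let ρ : M.model → M.model := fun y => φ p + χ y • y
  have hρ : ContDiff ℝ ∞ ρ := contDiff_const.add (χ.contDiff.smul contDiff_id)
  have hρt : ∀ y, ρ y ∈ φ.target := fun y => hball <| by
    rw [Metric.mem_ball, dist_eq_norm, add_sub_cancel_left, norm_smul, Real.norm_of_nonneg χ.nonneg]
    by_cases hy : ε / 2 ≤ ‖y‖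
    · rw [χ.zero_of_le_dist (by simpa using hy), zero_mul]
      exact hε
    · nlinarith [χ.le_one (x := y), χ.nonneg (x := y), norm_nonneg y]
  have hρ0 : ρ 0 = φ p := by simp [ρ]
  have hdρ : mfderiv 𝓘(ℝ, M.model) 𝓘(ℝ, M.model) ρ 0 = ContinuousLinearMap.id ℝ M.model := by
    have e : ρ =ᶠ[𝓝 0] fun y => φ p + y := by
      filter_upwards [χ.eventuallyEq_one] with y hy
      simp [ρ, hy]
    rw [mfderiv_eq_fderiv, e.fderiv_eq, fderiv_const_add, fderiv_fun_id]
  have hs : ∀ y ∈ φ.target, ContMDiffAt 𝓘(ℝ, M.model) 𝓘(ℝ, M.model) ∞ φ.symm y :=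
    fun y hy => contMDiffAt_chart_symm hy
  refine ⟨φ.symm ∘ ρ, fun y => (hs _ (hρt y)).comp y hρ.contMDiff.contMDiffAt, ?_, ?_⟩
  · rw [Function.comp_apply, hρ0, extChartAt_to_inv]
  · rw [mfderiv_comp (I' := 𝓘(ℝ, M.model)) 0 ((hs _ (hρt 0)).mdifferentiableAt (by simp))
      (hρ.contMDiff.contMDiffAt.mdifferentiableAt (by simp)), hdρ]
    have h1 := isInvertible_mfderivWithin_extChartAt_symm (I := 𝓘(ℝ, M.model)) (hρt 0)
    rw [modelWithCornersSelf_coe, Set.range_id, mfderivWithin_univ] at h1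
    exact h1.bijective.surjective

/-! ### From natural forms on manifolds to families on vector spaces -/

section
variable {V : Type*} [AddCommGroup V] [Module ℝ V] {n : ℕ}
  {E E' : Type} [NormedAddCommGroup E] [NormedSpace ℝ E] [FiniteDimensional ℝ E]
  [NormedAddCommGroup E'] [NormedSpace ℝ E'] [FiniteDimensional ℝ E']

open Man

variable (b : Module.Basis (Fin n) ℝ V)

namespace SF

/-- The coordinates of an `ℝⁿ`-valued one-form. -/
noncomputable def coord (g : SF n E) (a : Fin n) : Form (vec E) 1 :=
  vec.form (fun x => ContinuousAlternatingMap.ofSubsingleton ℝ E ℝ (0 : Fin 1)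
      ((ContinuousLinearMap.proj a).comp (g.1 x))) <| contDiff_alt_of_apply fun v => by
    have h1 : ContDiff ℝ ∞ fun x => g.1 x (v 0) := (contDiff g).clm_apply contDiff_const
    exact contDiff_pi.1 h1 a

theorem coord_add (g g' : SF n E) (a : Fin n) : coord (g + g') a = coord g a + coord g' a :=
  vec.fn_injective rfl

theorem coord_zero (a : Fin n) : coord (0 : SF n E) a = 0 := vec.fn_injective rfl

theorem coord_pull (f : E → E') (hf : ContDiff ℝ ∞ f) (g : SF n E') (a : Fin n) :
    coord (pull f hf g) a = Form.pullback (vec.hom f hf) (coord g a) := by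
  refine vec.fn_injective <| funext fun x => ?_
  rw [vec.fn_pullback]
  rfl

/-- The `V`-valued one-form with given coordinates in a basis. -/
noncomputable def tens (g : SF n E) : OneFormTensor V (vec E) := ∑ a, coord g a ⊗ₜ[ℝ] b a

theorem tens_pull (f : E → E') (hf : ContDiff ℝ ∞ f) (g : SF n E') :
    tens b (pull f hf g) = OneFormTensor.pullback (vec.hom f hf) (tens b g) := by
  rw [tens, tens, map_sum]
  refine Finset.sum_congr rfl fun a _ => ?_
  rw [coord_pull, OneFormTensor.pullback, LinearMap.rTensor_tmul]

/-- Ensures that the concrete `ℝⁿ`-valued forms reach every element of the abstract tensor product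
over a vector space. -/
theorem tens_surjective (α : OneFormTensor V (vec E)) : ∃ g : SF n E, tens b g = α := by
  induction α using TensorProduct.induction_on with
  | zero => exact ⟨0, Finset.sum_eq_zero fun a _ => by rw [coord_zero, TensorProduct.zero_tmul]⟩
  | add α β hα hβ =>
    obtain ⟨g, rfl⟩ := hα
    obtain ⟨g', rfl⟩ := hβ
    refine ⟨g + g', ?_⟩
    simp only [tens, coord_add, TensorProduct.add_tmul, Finset.sum_add_distrib]
  | tmul w v =>
    let u : E → E →L[ℝ] (Fin n → ℝ) := fun x =>
      ((ContinuousAlternatingMap.ofSubsingleton ℝ E ℝ (0 : Fin 1)).symm (vec.fn w x)).smulRight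
        fun a => b.repr v a
    have hu : ContDiff ℝ ∞ u := contDiff_clm_apply_iff.2 fun y => by
      let L : (E [⋀^Fin 1]→L[ℝ] ℝ) →L[ℝ] ℝ := ContinuousAlternatingMap.apply ℝ E ℝ fun _ => y
      have h1 : ContDiff ℝ ∞ fun x => L (vec.fn w x) := L.contDiff.comp (vec.contDiff_fn w)
      have h2 : ContDiff ℝ ∞ fun x => L (vec.fn w x) • fun a => b.repr v a :=
        h1.smul contDiff_const
      exact h2
    let g : SF n E := ⟨u, hu⟩
    have hg : ∀ a, coord g a = b.repr v a • w := fun a => by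
      refine vec.fn_injective <| funext fun x => ?_
      ext u
      change vec.fn w x (fun _ => u 0) * b.repr v a = b.repr v a * vec.fn w x u
      rw [mul_comm, show (fun _ => u 0) = u from funext fun i => by rw [Subsingleton.elim i 0]]
    refine ⟨g, ?_⟩
    conv_rhs => rw [← b.sum_repr v]
    rw [TensorProduct.tmul_sum]
    exact Finset.sum_congr rfl fun a _ => by rw [hg, TensorProduct.smul_tmul]

end SF

namespace NatForm
variable {q : ℕ}

/-- The values of a natural form on vector spaces. -/
noncomputable def fam (τ : NatForm V q) : Fam n := fun E _ _ _ g x v =>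
  vec.fn (τ.1 (vec E) (SF.tens b g)) x fun i => v i

theorem fam_isNat (τ : NatForm V q) : IsNat q (fam b τ) where
  alt E _ _ _ g x := ⟨vec.fn (τ.1 (vec E) (SF.tens b g)) x, fun _ => rfl⟩
  smooth E _ _ _ g v := by
    let L : (E [⋀^Fin q]→L[ℝ] ℝ) →L[ℝ] ℝ := ContinuousAlternatingMap.apply ℝ E ℝ fun i => v i
    exact L.contDiff.comp (vec.contDiff_fn _)
  nat E E' _ _ _ _ _ _ f hf g x v := by
    have h := τ.2 (vec.hom f hf) (SF.tens b g)
    rw [fam, SF.tens_pull, h, vec.fn_pullback]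
    rfl

theorem fam_wedge {p : ℕ} (σ : NatForm V p) (τ : NatForm V q) :
    fam b (wedge σ τ) = Fam.wedge p q (fam b σ) (fam b τ) := by
  ext E _ _ _ g x v
  exact altWedge_eq_seqWedge _ _ v

theorem fam_d (τ : NatForm V q) : fam b (d τ) = Fam.D q (fam b τ) := by
  ext E _ _ _ g x v
  rw [Fam.D_eq (vec.contDiff_fn (τ.1 (vec E) (SF.tens b g))) fun _ _ => rfl]
  exact congrArg (fun w : E → E [⋀^Fin (q + 1)]→L[ℝ] ℝ => w x fun i => v i) (vec.fn_d _)

/-- Near each point the value is tested by pulling back along `Man.exists_param`: every tuple of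
tangent vectors lifts through the surjective differential, and the pulled back value is a value of
the family. -/
theorem eq_zero_of_fam {τ : NatForm V q} (h : fam b τ = 0) : τ = 0 := by
  refine Subtype.ext <| funext fun M => funext fun α => Form.raw_injective <| funext fun p => ?_
  obtain ⟨f, hf, rfl, hs⟩ := M.exists_param p
  obtain ⟨g, hg⟩ := SF.tens_surjective b (OneFormTensor.pullback (vec.homTo f hf) α)
  have h1 := τ.2 (vec.homTo f hf) α
  rw [← hg] at h1
  ext v
  choose u hu using fun i => hs (v i)
  have h2 : vec.fn (τ.1 (vec M.model) (SF.tens b g)) 0 u = 0 := by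
    have := congrArg (fun F : Fam n => F M.model g 0 fun i => if h : i < q then u ⟨i, h⟩ else 0) h
    refine Eq.trans ?_ this
    simp [fam]
  rw [h1] at h2
  change (τ.1 M α).raw (f 0) (fun i => mfderiv 𝓘(ℝ, M.model) 𝓘(ℝ, M.model) f 0 (u i)) = 0 at h2
  rw [funext hu] at h2
  exact h2

end NatForm
end

/-! ### The isomorphism of differential graded algebras -/

open Koszul

/-- By Euler's identity the degree `m` part lies in the eigenspace for `m` of the total number
operator `N`, and eigenspaces are independent. -/
theorem Koszul.iSupIndep_grade {n : ℕ} {W : Type*} [AddCommGroup W] [Module ℝ W]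
    {l : Fin n → W} {c : Fin n → Module.Dual ℝ W} (h : ∀ w, ∑ k, c k w • l k = w) :
    iSupIndep (grade W) := by
  let N : Module.End ℝ (Koszul W) := ∑ k, LinearMap.mulLeft ℝ (gen (l k)) ∘ₗ del (c k) +
    (2 : ℝ) • ∑ k, LinearMap.mulLeft ℝ (tilde (l k)) ∘ₗ delT (c k)
  refine ((Module.End.eigenspaces_iSupIndep N).comp (f := fun m : ℕ => (m : ℝ))
    Nat.cast_injective).mono fun m x hx => Module.End.mem_eigenspace_iff.2 ?_
  simpa [N] using euler h hx

section
variable {V : Type*} [AddCommGroup V] [Module ℝ V] {n : ℕ} (b : Module.Basis (Fin n) ℝ V)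

theorem NatForm.fam_eval (w : Module.Dual ℝ V) {E : Type} [NormedAddCommGroup E] [NormedSpace ℝ E]
    [FiniteDimensional ℝ E] (g : SF n E) (x : E) (v : ℕ → E) :
    fam b (eval w) E g x v = ∑ k, w (b k) * g.1 x (v 0) k := by
  let L : Form (Man.vec E) 1 →ₗ[ℝ] ℝ :=
    { toFun := fun w => Man.vec.fn w x fun i => v i
      map_add' := fun _ _ => rfl
      map_smul' := fun _ _ => rfl }
  change L (evalAt w _ (∑ k, SF.coord g k ⊗ₜ b k)) = _
  rw [map_sum, map_sum]
  rfl

/-- The general theory is applied with `W = V*`, generators `b.coord k`, and contractions with the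
evaluations at the vectors `b k`. -/
theorem basis_dual_apply (a k : Fin n) :
    Module.Dual.eval ℝ V (b a) (b.coord k) = if k = a then 1 else 0 := by
  rw [Module.Dual.eval_apply, Module.Basis.coord_apply, Module.Basis.repr_self,
    Finsupp.single_apply]
  simp only [eq_comm]

theorem basis_dual_sum (w : Module.Dual ℝ V) :
    ∑ k, Module.Dual.eval ℝ V (b k) w • b.coord k = w :=
  b.sum_dual_apply_smul_coord w

/-- The Koszul element of a natural form. -/
noncomputable def NatForm.toKoszul (q : ℕ) : NatForm V q →ₗ[ℝ] Koszul (Module.Dual ℝ V) where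
  toFun τ := taylor b.coord q (fam b τ)
  map_add' σ τ := taylor_add b.coord q (fam b σ) (fam b τ)
  map_smul' r τ := taylor_smul b.coord q r (fam b τ)

theorem NatForm.toKoszul_injective {q : ℕ} {τ : NatForm V q} (h : toKoszul b q τ = 0) : τ = 0 :=
  eq_zero_of_fam b (eq_zero_of_taylor (basis_dual_apply b) q _ (fam_isNat b τ) h)

theorem NatForm.toKoszul_mem {q : ℕ} (τ : NatForm V q) : toKoszul b q τ ∈ Koszul.grade _ q :=
  taylor_mem _ _ _

theorem NatForm.toKoszul_eval (w : Module.Dual ℝ V) : toKoszul b 1 (eval w) = gen w := by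
  -- Contracting the one-form `w(g + dt e_a)` with `∂_t` leaves the constant `w (b a)`.
  have h : ∀ a, Fam.contr a (fam b (eval w)) ℝ 0 0 0 = w (b a) := fun a => by
    rw [Fam.contr, fam_eval, Finset.sum_eq_single a]
    · simp [SF.ext1, SF.pull, SF.form, fderiv_fst]
    · intro k _ hk
      simp [SF.ext1, SF.pull, SF.form, hk]
    · simp
  change taylor b.coord 1 (fam b (eval w)) = _
  rw [taylor.eq_2]
  simp only [taylor.eq_1, h, Algebra.algebraMap_eq_smul_one, mul_smul_comm, mul_one]
  simp only [← map_smul]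
  rw [← map_sum]
  exact congrArg gen (basis_dual_sum b w)

/-- The inverse of the isomorphism of the Koszul algebra with the algebra of natural forms. -/
noncomputable def DeRham.toKoszul : DeRham V →ₗ[ℝ] Koszul (Module.Dual ℝ V) :=
  DirectSum.toModule ℝ ℕ _ (NatForm.toKoszul b)

namespace DeRham

theorem toKoszul_of (q : ℕ) (τ : NatForm V q) :
    toKoszul b (of V q τ) = NatForm.toKoszul b q τ :=
  DirectSum.toModule_lof _ _ _

theorem toKoszul_one : toKoszul b (1 : DeRham V) = 1 := by
  refine (toKoszul_of b 0 _).trans ?_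
  exact map_one (algebraMap ℝ (Koszul (Module.Dual ℝ V)))

theorem toKoszul_mul (x y : DeRham V) : toKoszul b (x * y) = toKoszul b x * toKoszul b y := by
  induction x using DirectSum.induction_on with
  | zero => rw [zero_mul, map_zero, zero_mul]
  | add x x' hx hx' => rw [add_mul, map_add, map_add, add_mul, hx, hx']
  | of p σ =>
    induction y using DirectSum.induction_on with
    | zero => rw [mul_zero, map_zero, mul_zero]
    | add y y' hy hy' => rw [mul_add, map_add, map_add, mul_add, hy, hy']
    | of q τ =>
      rw [DirectSum.of_mul_of]
      refine (toKoszul_of b (p + q) _).trans ?_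
      refine Eq.trans ?_ (congrArg₂ _ (toKoszul_of b p σ) (toKoszul_of b q τ)).symm
      refine Eq.trans ?_ (taylor_wedge (basis_dual_apply b) (basis_dual_sum b) p q _ _
        (NatForm.fam_isNat b σ) (NatForm.fam_isNat b τ))
      rw [← NatForm.fam_wedge]
      rfl

theorem toKoszul_d [FiniteDimensional ℝ V] (x : DeRham V) :
    toKoszul b (d V x) = Koszul.d (Module.Dual ℝ V) (toKoszul b x) := by
  induction x using DirectSum.induction_on with
  | zero => rw [map_zero, map_zero, map_zero]
  | add x x' hx hx' => rw [map_add, map_add, map_add, map_add, hx, hx']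
  | of q τ =>
    have h : d V (of V q τ) = of V (q + 1) (NatForm.d τ) := DirectSum.toModule_lof _ _ _
    refine (congrArg (toKoszul b) h).trans ?_
    refine (toKoszul_of b _ _).trans ?_
    refine Eq.trans ?_ (congrArg (Koszul.d _) (toKoszul_of b q τ)).symm
    refine Eq.trans ?_ (taylor_D (basis_dual_apply b) (basis_dual_sum b) q _
      (NatForm.fam_isNat b τ))
    rw [← NatForm.fam_d]
    rfl

/-- Each component of `x` maps into its own degree. Independence of the degrees kills the images of
the components other than the `m`-th, and injectivity in each degree kills these components
themselves. -/
theorem eq_of_toKoszul_mem {m : ℕ} {x : DeRham V}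
    (hx : toKoszul b x ∈ Koszul.grade (Module.Dual ℝ V) m) : x = of V m (x m) := by
  classical
  set s := insert m (DFinsupp.support x) with hs
  have h1 : x = ∑ i ∈ s, of V i (x i) := by
    conv_lhs => rw [← DirectSum.sum_support_of x]
    refine Finset.sum_subset (Finset.subset_insert _ _) fun i _ hi => ?_
    rw [DFinsupp.notMem_support_iff.1 hi, map_zero]
  have h2 : ∑ i ∈ s, NatForm.toKoszul b i (x i) = ∑ i ∈ s, if i = m then toKoszul b x else 0 := by
    rw [Finset.sum_ite_eq' s m, if_pos (Finset.mem_insert_self _ _)]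
    conv_rhs => rw [h1, map_sum]
    exact Finset.sum_congr rfl fun i _ => (toKoszul_of b i _).symm
  have h3 := (iSupIndep_iff_finsetSum_eq_imp_eq _).1 (iSupIndep_grade (basis_dual_sum b)) s _ _
    (fun i _ => ⟨NatForm.toKoszul_mem b _, by
      split_ifs with h
      · exact h ▸ hx
      · exact Submodule.zero_mem _⟩) h2
  conv_lhs => rw [h1]
  refine Finset.sum_eq_single m (fun i hi hm => ?_) fun h => absurd (Finset.mem_insert_self _ _) h
  rw [NatForm.toKoszul_injective b ((h3 i hi).trans (if_neg hm)), map_zero]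

theorem toKoszul_injective : Function.Injective (toKoszul b) := by
  refine (injective_iff_map_eq_zero _).2 fun x hx => ?_
  -- Zero lies in every degree, so `x` is concentrated in degree `0`; any other choice would serve
  -- as well.
  have h1 := eq_of_toKoszul_mem b (m := 0) (x := x) (hx ▸ Submodule.zero_mem _)
  rw [h1, toKoszul_of] at hx
  rw [h1, NatForm.toKoszul_injective b hx, map_zero]

/-- The image is closed under sums, products and the differential; it contains the generators of
degree one, hence their differentials, the generators of degree two. -/
theorem toKoszul_surjective [FiniteDimensional ℝ V] : Function.Surjective (toKoszul b) := by
  have hgen : ∀ w, toKoszul b (of V 1 (NatForm.eval w)) = gen w := fun w =>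
    (toKoszul_of b 1 _).trans (NatForm.toKoszul_eval b w)
  intro x
  induction x using Koszul.induction with
  | h1 r =>
    refine ⟨r • 1, ?_⟩
    rw [map_smul, toKoszul_one, Algebra.algebraMap_eq_smul_one]
  | hgen w => exact ⟨_, hgen w⟩
  | htilde w => exact ⟨d V (of V 1 (NatForm.eval w)), by rw [toKoszul_d, hgen, d_gen]⟩
  | hadd x y hx hy =>
    obtain ⟨x, rfl⟩ := hx
    obtain ⟨y, rfl⟩ := hy
    exact ⟨x + y, map_add _ _ _⟩
  | hmul x y hx hy =>
    obtain ⟨x, rfl⟩ := hx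
    obtain ⟨y, rfl⟩ := hy
    exact ⟨x * y, toKoszul_mul b x y⟩

end DeRham

/-- Compatibility with the differentials forces the value on `tilde w = d (gen w)`, and the two
kinds of generators generate. -/
theorem IsDGAHom.eq_of_gen [FiniteDimensional ℝ V]
    {η η' : Koszul (Module.Dual ℝ V) →ₗ[ℝ] DeRham V} (h : IsDGAHom V η) (h' : IsDGAHom V η')
    (hg : ∀ w, η' (gen w) = η (gen w)) : η' = η := by
  refine LinearMap.ext fun x => ?_
  induction x using Koszul.induction with
  | h1 r => rw [Algebra.algebraMap_eq_smul_one, map_smul, map_smul, h.map_one, h'.map_one]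
  | hgen w => exact hg w
  | htilde w => rw [← d_gen, h.map_d, h'.map_d, hg]
  | hadd x y hx hy => rw [map_add, map_add, hx, hy]
  | hmul x y hx hy => rw [h.map_mul, h'.map_mul, hx, hy]

theorem DeRham.isDGAHom_symm [FiniteDimensional ℝ V] (e : DeRham V ≃ₗ[ℝ] Koszul (Module.Dual ℝ V))
    (he : e.toLinearMap = toKoszul b) : IsDGAHom V e.symm.toLinearMap := by
  have he' : ∀ x, e x = toKoszul b x := fun x => congrArg (fun f => f x) he
  refine ⟨?_, fun x y => ?_, fun n x hx => ?_, fun x => ?_⟩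
  · exact (e.symm_apply_eq).2 ((he' _).trans (toKoszul_one b)).symm
  · refine (e.symm_apply_eq).2 ?_
    rw [he', toKoszul_mul, ← he', ← he']
    exact congrArg₂ _ (e.apply_symm_apply x).symm (e.apply_symm_apply y).symm
  · have h1 : toKoszul b (e.symm x) = x := (he' _).symm.trans (e.apply_symm_apply x)
    -- That the inverse preserves degrees uses the independence of the degrees on the Koszul side.
    exact ⟨_, (eq_of_toKoszul_mem b (h1.symm ▸ hx)).symm⟩
  · refine (e.symm_apply_eq).2 ?_
    rw [he', toKoszul_d, ← he']
    exact congrArg (Koszul.d _) (e.apply_symm_apply x).symm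
end

end NatDeRham

theorem mainTheorem3 (V : Type*) [AddCommGroup V] [Module ℝ V] [FiniteDimensional ℝ V] :
    ∃ η : NatDeRham.Koszul (Module.Dual ℝ V) →ₗ[ℝ] NatDeRham.DeRham V,
      (NatDeRham.IsDGAHom V η ∧
        ∀ l : Module.Dual ℝ V,
          η (NatDeRham.Koszul.gen l) = NatDeRham.DeRham.of V 1 (NatDeRham.NatForm.eval l)) ∧
      (∀ η' : NatDeRham.Koszul (Module.Dual ℝ V) →ₗ[ℝ] NatDeRham.DeRham V,
        NatDeRham.IsDGAHom V η' →
        (∀ l : Module.Dual ℝ V,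
          η' (NatDeRham.Koszul.gen l) = NatDeRham.DeRham.of V 1 (NatDeRham.NatForm.eval l)) →
        η' = η) ∧
      Function.Bijective η := by
  let b := Module.finBasis ℝ V
  let e := LinearEquiv.ofBijective (NatDeRham.DeRham.toKoszul b)
    ⟨NatDeRham.DeRham.toKoszul_injective b, NatDeRham.DeRham.toKoszul_surjective b⟩
  have he := NatDeRham.DeRham.isDGAHom_symm b e rfl
  have hg : ∀ l, e.symm (NatDeRham.Koszul.gen l) =
      NatDeRham.DeRham.of V 1 (NatDeRham.NatForm.eval l) := fun l =>
    e.symm_apply_eq.2 ((NatDeRham.DeRham.toKoszul_of b 1 _).trans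
      (NatDeRham.NatForm.toKoszul_eval b l)).symm
  exact ⟨e.symm.toLinearMap, ⟨he, hg⟩,
    fun η' h' hg' => he.eq_of_gen h' fun l => (hg' l).trans (hg l).symm, e.symm.bijective⟩
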